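/- Let $\mathbb T=\mathbb R/2\pi\mathbb Z$, $\langle y\rangle=\sqrt{1+|y|^2}$, and let $\langle\partial_x^2\rangle=(1+\partial_x^4)^{1/2}$ be the Fourier multiplier on $\mathbb T$ with symbol $\sqrt{k^4+1}$, $k\in\mathbb Z$. For $s,b\ge 0$ let $X^{s,b}$ be the space of tempered distributions $u$ on $\mathbb R\times\mathbb T$ with finite norm $$\|u\|_{X^{s,b}}=\Big\|\langle k\rangle^s\,\big\langle\sigma-\sqrt{k^4+1}\big\rangle^b\,\widehat u(\sigma,k)\Big\|_{\ell^2_kL^2_\sigma},\qquad \widehat u(\sigma,k)=\frac1{2\pi}\int_{\mathbb R}\int_{\mathbb T}u(t,x)e^{-i\sigma t-ikx}\,dx\,dt,$$ and for $T>0$ let $X^{s,b}(T)$ be the space of functions $u$ on $[0,T]\times\mathbb T$ for which $$\|u\|_{X^{s,b}(T)}=\inf\{\|v\|_{X^{s,b}} : v|_{[0,T]}=u\}$$ is finite. Consider the complex first-order form of the "good" Boussinesq equation, $$\partial_tu=i\langle\partial_x^2\rangle u-\frac i4\langle\partial_x^2\rangle^{-1}\big[2(u+\overline u)+\partial_x^2(u+\overline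 u)^2\big],\qquad u(0,\cdot)=u_0, \tag{1}$$ for $u=u(t,x)\in\mathbb C$, $x\in\mathbb T$; for a solution on $[0,T]$ the equation is understood in the sense of distributions on $\mathbb T$, i.e. for every Fourier coefficient, at each time $t\in[0,T]$. Let $s\ge 0$ and $b\in(1/2,1)$. Then $X^{s,b}(T)\subset C([0,T],H^s(\mathbb T))$ for every $T>0$ (functions that agree almost everywhere being identified). Moreover, for every $u_0\in H^s(\mathbb T)$ there is a maximal existence time $T_s\in(0,\infty]$: for every $0<T<T_s$, problem (1) has a unique solution $u\in X^{s,b}(T)\subset C([0,T],H^s(\mathbb T))$ on $[0,T]$, while for finite $T\ge T_s$ it has no solution in $X^{s,b}(T)$ on $[0,T]$. -/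

import Mathlib

open MeasureTheory Filter Topology Set
open scoped ENNReal FourierTransform

noncomputable section

namespace GoodBoussinesq

instance fact_two_pi_pos : Fact (0 < 2 * Real.pi) := ⟨Real.two_pi_pos⟩

/-- The torus `𝕋 = ℝ / 2πℤ`. -/
abbrev Torus : Type := AddCircle (2 * Real.pi)

/-- `L²(𝕋; ℂ)`; the measure is `dx / 2π`. -/
abbrev L2Torus : Type := Lp ℂ 2 (AddCircle.haarAddCircle : Measure Torus)

/-- The Japanese bracket `⟨x⟩ = √(1 + |x|²)`. -/
def jap (x : ℝ) : ℝ := Real.sqrt (1 + x ^ 2)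

/-- The symbol `√(k⁴ + 1)` of the operator `⟨∂ₓ²⟩ = (1 + ∂ₓ⁴)^{1/2}`; it is also the function
`g(k)` that defines the Bourgain space. -/
def disp (k : ℤ) : ℝ := Real.sqrt ((k : ℝ) ^ 4 + 1)

/-- The norm of `H^s(𝕋)`, `(∑ₖ ⟨k⟩^{2s} |f̂ₖ|²)^{1/2}`, with value `∞` if `f ∉ H^s`.
For `s ≥ 0`, `H^s(𝕋)` is the set of `f ∈ L²(𝕋)` with finite norm. -/
def sobolevENorm (s : ℝ) (f : L2Torus) : ℝ≥0∞ :=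
  (∑' k : ℤ, (ENNReal.ofReal (jap k ^ s) * ‖fourierCoeff (f : Torus → ℂ) k‖ₑ) ^ 2) ^ (1 / 2 : ℝ)

/-- `u ∈ C(I, H^s)`: each `u(t)`, `t ∈ I`, lies in `H^s`, and `u` is continuous on `I` for the
norm of `H^s`. -/
def ContinuousIntoSobolev (s : ℝ) (I : Set ℝ) (u : ℝ → L2Torus) : Prop :=
  ∀ t ∈ I, sobolevENorm s (u t) < ⊤ ∧
    Tendsto (fun r => sobolevENorm s (u r - u t)) (𝓝[I] t) (𝓝 0)

/-- Square integrable functions on `ℝ × 𝕋`, as `L²(ℝ; L²(𝕋))`. -/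
abbrev L2SpaceTime : Type := Lp L2Torus 2 (volume : Measure ℝ)

/-- The space-time Fourier transform
`û(σ, k) = (2π)⁻¹ ∫_ℝ ∫_𝕋 u(t, x) e^{-iσt - ikx} dx dt` of `u ∈ L²(ℝ × 𝕋)`.
The transform `𝓕` in time is the Fourier–Plancherel transform with kernel `e^{-2πitξ}`,
hence `ξ = σ / 2π`; the factor `(2π)⁻¹` is part of the Fourier coefficient in space. -/
def spaceTimeFourier (u : L2SpaceTime) (σ : ℝ) (k : ℤ) : ℂ :=
  fourierCoeff (((𝓕 u : L2SpaceTime) (σ / (2 * Real.pi)) : L2Torus) : Torus → ℂ) k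

/-- The Bourgain norm `‖⟨k⟩^s ⟨σ - √(k⁴+1)⟩^b û(σ, k)‖_{ℓ²ₖ L²_σ}`, with value `∞` if
`u ∉ X^{s,b}`. For `s, b ≥ 0` every tempered distribution on `ℝ × 𝕋` of finite norm lies in
`L²(ℝ × 𝕋)`, so that `X^{s,b}` is the set of `u ∈ L²(ℝ × 𝕋)` with finite norm. -/
def bourgainENorm (s b : ℝ) (u : L2SpaceTime) : ℝ≥0∞ :=
  (∑' k : ℤ, ∫⁻ σ : ℝ,
    (ENNReal.ofReal (jap k ^ s * jap (σ - disp k) ^ b) * ‖spaceTimeFourier u σ k‖ₑ) ^ 2)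
      ^ (1 / 2 : ℝ)

/-- The norm of the localized Bourgain space `X^{s,b}(I)`: the infimum of `‖v‖_{X^{s,b}}` over
all `v` whose restriction to `I` is `u` (as functions on `I × 𝕋`, that is almost everywhere);
it is `∞` if there is no extension `v` of finite norm. -/
def bourgainENormOn (s b : ℝ) (I : Set ℝ) (u : ℝ → L2Torus) : ℝ≥0∞ :=
  ⨅ v : {v : L2SpaceTime // (v : ℝ → L2Torus) =ᵐ[volume.restrict I] u}, bourgainENorm s b v.1

/-- `u ∈ X^{s,b}(T) = X^{s,b}([0, T])`. -/
def MemBourgain (s b T : ℝ) (u : ℝ → L2Torus) : Prop :=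
  bourgainENormOn s b (Icc 0 T) u < ⊤

/-- The `k`-th Fourier coefficient of the right-hand side
`i⟨∂ₓ²⟩f - (i/4) ⟨∂ₓ²⟩⁻¹ [2(f + f̄) + ∂ₓ²(f + f̄)²]`. For `f ∈ L²(𝕋)` the square `(f + f̄)²`
is in `L¹(𝕋)`; the Fourier multipliers `⟨∂ₓ²⟩` and `∂ₓ²` have the symbols `√(k⁴+1)` and
`(ik)²`. -/
def rhsCoeff (f : L2Torus) (k : ℤ) : ℂ :=
  Complex.I * (disp k : ℂ) * fourierCoeff (f : Torus → ℂ) k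
    - Complex.I / 4 * (disp k : ℂ)⁻¹ *
      (2 * fourierCoeff (fun x : Torus => f x + (starRingEnd ℂ) (f x)) k
        + (Complex.I * k) ^ 2 *
          fourierCoeff (fun x : Torus => (f x + (starRingEnd ℂ) (f x)) ^ 2) k)

/-- `u` solves on `[0, T]` the initial value problem
`∂ₜu = i⟨∂ₓ²⟩u - (i/4) ⟨∂ₓ²⟩⁻¹ [2(u + ū) + ∂ₓ²(u + ū)²]`, `u(0) = u₀`:
the equation holds at every time `t ∈ [0, T]` in the sense of distributions on `𝕋`, that is,
tested against every character `e^{-ikx}` (with one-sided derivatives at the end points). -/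
structure IsSolution (T : ℝ) (u₀ : L2Torus) (u : ℝ → L2Torus) : Prop where
  initial : u 0 = u₀
  equation : ∀ k : ℤ, ∀ t ∈ Icc 0 T,
    HasDerivWithinAt (fun r => fourierCoeff (u r : Torus → ℂ) k) (rhsCoeff (u t) k) (Icc 0 T) t

end GoodBoussinesq

end

namespace GoodBoussinesq

/-! In the interaction picture W_k(t) = e^{-it√(k⁴+1)} û_k(t), the time derivative of W_k is the
nonlinearity up to a phase. It loses no derivatives, because k² ≤ √(k⁴+1). The difficulty is the
product (u + ū)² when u is only in H^s with s ≥ 0. Dispersion resolves it: the nonlinearity of a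
solution lies in L²([0,T], H^s), and Bourgain norms of negative index are not needed.

The bilinear estimate. Mode k of a product of two free waves, conjugated or not, is an exponential
sum with frequencies ±√(n⁴+1) ± √((k-n)⁴+1). Up to bounded errors these are ±(n² + (k-n)²) or ±(2kn
- k²). For k ≠ 0 they are separated like the integers, apart from the symmetry n ↔ k-n
(`abs_freq_sub`). A large sieve inequality (`integral_gaussian_expSum_le`) then bounds the L²([0,T])
norm of the sum by the ℓ² norm of its coefficients, uniformly in k. The argument fails for k = 0,
where the frequencies of u ū all vanish, but ∂ₓ² removes that mode.

Superpositions. By Cauchy-Schwarz in an auxiliary variable τ, the estimate extends from free waves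
to the superpositions of `IsProfile`. There are two sources of these: functions in X^{s,b}, b > 1/2,
with a kernel of size ⟨τ⟩^{-b} (`exists_profile_of_bourgainENorm`), and Duhamel's formula with
forcing in L²([0,T], H^s), whose kernel is an indicator function (`isProfile_duhamel`).

Consequently X^{s,b}(T) can be replaced by a class that does not mention b, `IsStrongSolution`.
Solutions in X^{s,b}(T) are strong by the bilinear estimate. Conversely, for a strong solution with
data in H^s both W and its derivative are in L²([0,T], H^s), so W extends to an H¹ function of time
on ℝ, which gives X^{s,b}(T) for b ≤ 1. For strong solutions, uniqueness follows from a weight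
e^{-lt} with l large, local existence from a contraction for the unknown forcing with a factor T,
and continuation from gluing. T_s is the supremum of the existence times; it is not attained,
because a solution on [0,T] ends in H^s and can be continued. -/

/-! ### Fourier coefficients on the torus, products, and the nonlinearity -/

/-- The `k`-th Fourier coefficient as a bounded linear functional on `L²(𝕋)`. -/
noncomputable def coeffL (k : ℤ) : L2Torus →L[ℂ] ℂ :=
  innerSL ℂ (fourierBasis k : L2Torus)

lemma coeffL_apply (k : ℤ) (f : L2Torus) : coeffL k f = fourierCoeff (f : Torus → ℂ) k := by
  rw [← fourierBasis_repr, HilbertBasis.repr_apply_apply]; rfl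

lemma ext_coeffL {f g : L2Torus} (h : ∀ k, coeffL k f = coeffL k g) : f = g := by
  apply (fourierBasis (T := 2 * Real.pi)).repr.injective
  ext k
  rw [fourierBasis_repr, fourierBasis_repr, ← coeffL_apply, ← coeffL_apply, h]

lemma enorm_sq_eq_tsum (f : L2Torus) : ‖f‖ₑ ^ 2 = ∑' k, ‖coeffL k f‖ₑ ^ 2 := by
  have h := hasSum_sq_fourierCoeff f
  simp_rw [← coeffL_apply] at h
  have h2 : ∫ t : Torus, ‖f t‖ ^ 2 ∂AddCircle.haarAddCircle = ‖f‖ ^ 2 := by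
    have := congrArg RCLike.re (@L2.inner_def Torus ℂ ℂ _ _ _ _ _ f f)
    rw [inner_self_eq_norm_sq] at this
    rw [this]
    rw [← integral_re (L2.integrable_inner f f)]
    simp only [inner_self_eq_norm_sq]
  rw [h2] at h
  have h3 := ENNReal.ofReal_tsum_of_nonneg (fun k => sq_nonneg ‖coeffL k f‖) h.summable
  rw [h.tsum_eq] at h3
  rw [← ofReal_norm, ← ENNReal.ofReal_pow (norm_nonneg _), h3]
  refine tsum_congr fun k => ?_
  rw [← ofReal_norm, ← ENNReal.ofReal_pow (norm_nonneg _)]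

open scoped Classical in
/-- The element of `L²(𝕋)` with given square summable Fourier coefficients. -/
noncomputable def ofCoeff (c : ℤ → ℂ) : L2Torus :=
  if h : Memℓp c 2 then (fourierBasis (T := 2 * Real.pi)).repr.symm ⟨c, h⟩ else 0

lemma coeffL_ofCoeff {c : ℤ → ℂ} (h : Memℓp c 2) (k : ℤ) : coeffL k (ofCoeff c) = c k := by
  rw [coeffL_apply, ← fourierBasis_repr, ofCoeff, dif_pos h, LinearIsometryEquiv.apply_symm_apply]

lemma memLp_two_of_tsum {c : ℤ → ℂ} (h : ∑' k, ‖c k‖ₑ ^ 2 < ⊤) : Memℓp c 2 := by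
  refine memℓp_gen ?_
  have : Summable fun k => (‖c k‖₊ ^ 2) := by
    rw [← ENNReal.tsum_coe_ne_top_iff_summable]
    simpa [enorm] using h.ne
  simpa using (NNReal.summable_coe.2 this)

lemma coeffL_star (f : L2Torus) (k : ℤ) :
    coeffL k (star f) = (starRingEnd ℂ) (coeffL (-k) f) := by
  rw [coeffL_apply, coeffL_apply]
  unfold fourierCoeff
  rw [← integral_conj]
  refine integral_congr_ae ?_
  filter_upwards [Lp.coeFn_star f] with x hx
  rw [hx]
  simp

/-- `f + f̄ = 2 Re f`. -/
noncomputable def twoRe (f : L2Torus) : L2Torus := f + star f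

lemma coeFn_twoRe (f : L2Torus) :
    (twoRe f : Torus → ℂ) =ᵐ[AddCircle.haarAddCircle] fun x => f x + (starRingEnd ℂ) (f x) := by
  filter_upwards [Lp.coeFn_add f (star f), Lp.coeFn_star f] with x hx hx'
  rw [twoRe, hx]
  simp [hx']

lemma coeffL_twoRe (f : L2Torus) (k : ℤ) :
    coeffL k (twoRe f) = coeffL k f + (starRingEnd ℂ) (coeffL (-k) f) := by
  rw [twoRe, map_add, coeffL_star]

lemma twoRe_sub (f g : L2Torus) : twoRe (f - g) = twoRe f - twoRe g := by
  refine ext_coeffL fun k => ?_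
  simp only [coeffL_twoRe, map_sub]; ring

lemma twoRe_add (f g : L2Torus) : twoRe (f + g) = twoRe f + twoRe g := by
  refine ext_coeffL fun k => ?_
  simp only [coeffL_twoRe, map_add]; ring

lemma continuous_twoRe : Continuous twoRe := by
  let T : L2Torus →+ L2Torus := AddMonoidHom.mk' twoRe twoRe_add
  refine (AddMonoidHomClass.continuous_of_bound T 2 fun f => ?_)
  have h : ‖star f‖ ≤ ‖f‖ := by
    rw [Lp.norm_def, Lp.norm_def]
    refine ENNReal.toReal_mono (Lp.eLpNorm_ne_top f) (eLpNorm_mono_ae ?_)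
    filter_upwards [Lp.coeFn_star f] with x hx
    rw [hx]; simp
  refine (norm_add_le f (star f)).trans ?_
  linarith

/-- The `k`-th Fourier coefficient of a product. -/
noncomputable def mulCoeff (f g : L2Torus) (k : ℤ) : ℂ :=
  fourierCoeff (fun x : Torus => f x * g x) k

lemma norm_fourier_apply (k : ℤ) (x : Torus) : ‖fourier k x‖ = 1 := by
  rw [fourier_apply]; exact Circle.norm_coe _

lemma memLp_conj_mul_fourier (f : L2Torus) (k : ℤ) :
    MemLp (fun x : Torus => (starRingEnd ℂ) (f x) * fourier k x) 2 AddCircle.haarAddCircle := by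
  have h1 : MemLp (fun x : Torus => star (f x)) 2 AddCircle.haarAddCircle :=
    (Lp.memLp f).star
  refine h1.of_le_mul (c := 1) ?_ ?_
  · exact h1.1.mul (fourier k).continuous.aestronglyMeasurable
  · refine Eventually.of_forall fun x => ?_
    rw [norm_mul]
    have : ‖fourier k x‖ = 1 := norm_fourier_apply k x
    rw [this]; simp

/-- This form makes Parseval's identity and the Cauchy-Schwarz inequality available for products
that are only in L¹. -/
lemma mulCoeff_eq_inner (f g : L2Torus) (k : ℤ) :
    mulCoeff f g k = inner ℂ ((memLp_conj_mul_fourier f k).toLp) g := by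
  rw [L2.inner_def, mulCoeff, fourierCoeff]
  refine integral_congr_ae ?_
  filter_upwards [(memLp_conj_mul_fourier f k).coeFn_toLp] with x hx
  rw [hx, fourier_neg]
  simp; ring

/-- Parseval's identity for f̄ e_k and g; the index of the basis is k - n, hence the reindexing. -/
lemma hasSum_mulCoeff (f g : L2Torus) (k : ℤ) :
    HasSum (fun n => coeffL n f * coeffL (k - n) g) (mulCoeff f g k) := by
  rw [mulCoeff_eq_inner]
  have h := (fourierBasis (T := 2 * Real.pi)).hasSum_inner_mul_inner
    ((memLp_conj_mul_fourier f k).toLp) g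
  rw [← (Equiv.subLeft k).hasSum_iff] at h
  convert! h using 1
  ext n
  simp only [Function.comp_apply, Equiv.subLeft_apply]
  congr 1
  rw [L2.inner_def, coeffL_apply, fourierCoeff]
  refine integral_congr_ae ?_
  filter_upwards [(memLp_conj_mul_fourier f k).coeFn_toLp,
    coeFn_fourierLp (T := 2 * Real.pi) 2 (k - n)] with x hx hx'
  rw [hx, coe_fourierBasis, hx', sub_eq_add_neg, fourier_add, fourier_neg]
  have : fourier k x * (starRingEnd ℂ) (fourier k x) = 1 := by
    rw [Complex.mul_conj]; simp [Complex.normSq_eq_norm_sq, norm_fourier_apply, -fourier_apply]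
  simp only [smul_eq_mul, RCLike.inner_apply, map_mul, Complex.conj_conj]
  linear_combination (- (starRingEnd ℂ) (fourier n x) * f x) * this

lemma norm_mulCoeff_le (f g : L2Torus) (k : ℤ) : ‖mulCoeff f g k‖ ≤ ‖f‖ * ‖g‖ := by
  rw [mulCoeff_eq_inner]
  refine (norm_inner_le_norm _ _).trans ?_
  gcongr
  rw [Lp.norm_toLp, Lp.norm_def]
  refine ENNReal.toReal_mono (Lp.eLpNorm_ne_top f) (eLpNorm_mono fun x => ?_)
  rw [norm_mul]
  have : ‖fourier k x‖ = 1 := norm_fourier_apply k x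
  rw [this]; simp

lemma mulCoeff_add_left (f g h : L2Torus) (k : ℤ) :
    mulCoeff (f + g) h k = mulCoeff f h k + mulCoeff g h k := by
  refine (hasSum_mulCoeff (f + g) h k).unique ?_
  convert! (hasSum_mulCoeff f h k).add (hasSum_mulCoeff g h k) using 2
  rw [map_add, add_mul]

lemma mulCoeff_comm (f g : L2Torus) (k : ℤ) : mulCoeff f g k = mulCoeff g f k := by
  simp only [mulCoeff, mul_comm]

/-- Through this factorisation, differences of nonlinearities are estimated by the same bilinear
bound as the nonlinearity itself. -/
lemma mulCoeff_sub_add (f g : L2Torus) (k : ℤ) :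
    mulCoeff (f - g) (f + g) k = mulCoeff f f k - mulCoeff g g k := by
  have h1 := mulCoeff_add_left (f - g) g (f + g) k
  rw [sub_add_cancel] at h1
  rw [mulCoeff_comm f, mulCoeff_add_left, mulCoeff_comm g (f + g), mulCoeff_add_left,
    mulCoeff_comm g f] at h1
  linear_combination -h1

/-- The part `-(i/4)⟨∂ₓ²⟩⁻¹[2(f + f̄) + ∂ₓ²(f + f̄)²]` of the right-hand side. -/
noncomputable def nonlin (f : L2Torus) (k : ℤ) : ℂ :=
  -(Complex.I / 4 * (disp k : ℂ)⁻¹ *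
    (2 * coeffL k (twoRe f) - (k : ℂ) ^ 2 * mulCoeff (twoRe f) (twoRe f) k))

lemma rhsCoeff_eq (f : L2Torus) (k : ℤ) :
    rhsCoeff f k = Complex.I * (disp k : ℂ) * coeffL k f + nonlin f k := by
  have h1 : fourierCoeff (fun x : Torus => f x + (starRingEnd ℂ) (f x)) k
      = coeffL k (twoRe f) := by
    rw [coeffL_apply]
    exact (congrFun (fourierCoeff_congr_ae (coeFn_twoRe f)) k).symm
  have h2 : fourierCoeff (fun x : Torus => (f x + (starRingEnd ℂ) (f x)) ^ 2) k
      = mulCoeff (twoRe f) (twoRe f) k := by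
    refine (congrFun (fourierCoeff_congr_ae ?_) k).symm
    filter_upwards [coeFn_twoRe f] with x hx
    rw [hx, sq]
  rw [rhsCoeff, h1, h2, ← coeffL_apply, mul_pow, Complex.I_sq, nonlin]
  ring

lemma continuous_mulCoeff_self (k : ℤ) : Continuous fun f => mulCoeff f f k := by
  rw [continuous_iff_continuousAt]
  intro f
  rw [ContinuousAt, tendsto_iff_norm_sub_tendsto_zero]
  have h : Tendsto (fun g : L2Torus => ‖g - f‖ * ‖g + f‖) (𝓝 f) (𝓝 (‖f - f‖ * ‖f + f‖)) := by
    have : Continuous fun g : L2Torus => ‖g - f‖ * ‖g + f‖ := by fun_prop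
    exact this.tendsto f
  rw [sub_self, norm_zero, zero_mul] at h
  refine squeeze_zero (fun _ => norm_nonneg _) (fun g => ?_) h
  rw [← mulCoeff_sub_add]
  exact norm_mulCoeff_le _ _ _

lemma continuous_nonlin (k : ℤ) : Continuous fun f => nonlin f k := by
  unfold nonlin
  have h1 : Continuous fun f => mulCoeff (twoRe f) (twoRe f) k :=
    (continuous_mulCoeff_self k).comp continuous_twoRe
  have h2 : Continuous fun f => coeffL k (twoRe f) := (coeffL k).continuous.comp continuous_twoRe
  fun_prop

lemma one_le_disp (k : ℤ) : 1 ≤ disp k := by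
  rw [disp, Real.one_le_sqrt]
  have : (0 : ℝ) ≤ (k : ℝ) ^ 4 := by positivity
  linarith

lemma sq_le_disp (k : ℤ) : (k : ℝ) ^ 2 ≤ disp k :=
  Real.le_sqrt_of_sq_le (by nlinarith)

lemma disp_le (k : ℤ) : disp k ≤ (k : ℝ) ^ 2 + 1 := by
  rw [disp, Real.sqrt_le_left (by positivity)]
  nlinarith [sq_nonneg (k : ℝ)]

/-- The symbol √(k⁴+1) dominates both 1 and k², so both multipliers are bounded by constants. The
factor k² eliminates the product at k = 0, the one mode that the bilinear estimate does not cover.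
-/
lemma norm_nonlin_sub_le (f g : L2Torus) (k : ℤ) :
    ‖nonlin f k - nonlin g k‖ ≤ ‖coeffL k (twoRe (f - g))‖ +
      (if k = 0 then 0 else ‖mulCoeff (twoRe (f - g)) (twoRe (f + g)) k‖) := by
  have h0 : nonlin f k - nonlin g k = -(Complex.I / 4 * (disp k : ℂ)⁻¹ *
      (2 * coeffL k (twoRe (f - g)) -
        (k : ℂ) ^ 2 * mulCoeff (twoRe (f - g)) (twoRe (f + g)) k)) := by
    rw [twoRe_sub, twoRe_add, mulCoeff_sub_add, map_sub, nonlin, nonlin]; ring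
  set A := coeffL k (twoRe (f - g))
  set B := mulCoeff (twoRe (f - g)) (twoRe (f + g)) k
  have hd := one_le_disp k
  have hd2 := sq_le_disp k
  have hd0 : 0 < disp k := by linarith
  rw [h0, norm_neg, norm_mul, norm_mul, norm_inv, norm_div, Complex.norm_I, Complex.norm_real,
    Real.norm_of_nonneg hd0.le]
  have hB : (disp k)⁻¹ * ((k : ℝ) ^ 2 * ‖B‖) ≤ if k = 0 then 0 else ‖B‖ := by
    split_ifs with hk
    · simp [hk]
    · rw [← mul_assoc]
      refine mul_le_of_le_one_left (norm_nonneg _) ?_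
      rw [inv_mul_le_iff₀ hd0]; linarith
  have hA : (disp k)⁻¹ * ‖A‖ ≤ ‖A‖ :=
    mul_le_of_le_one_left (norm_nonneg _) (inv_le_one_of_one_le₀ hd)
  have h3 : ‖2 * A - (k : ℂ) ^ 2 * B‖ ≤ 2 * ‖A‖ + (k : ℝ) ^ 2 * ‖B‖ := by
    refine (norm_sub_le _ _).trans (le_of_eq ?_)
    simp
  have h4 : (disp k)⁻¹ * ‖2 * A - (k : ℂ) ^ 2 * B‖ ≤
      2 * ‖A‖ + if k = 0 then 0 else ‖B‖ := by
    calc _ ≤ (disp k)⁻¹ * (2 * ‖A‖ + (k : ℝ) ^ 2 * ‖B‖) := by gcongr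
      _ = 2 * ((disp k)⁻¹ * ‖A‖) + (disp k)⁻¹ * ((k : ℝ) ^ 2 * ‖B‖) := by ring
      _ ≤ _ := by linarith
  have h5 : (0 : ℝ) ≤ if k = 0 then 0 else ‖B‖ := by split_ifs <;> simp
  have h6 : ‖(4 : ℂ)‖ = 4 := by simp
  rw [h6]
  nlinarith [norm_nonneg A]

lemma norm_nonlin_le (f : L2Torus) (k : ℤ) :
    ‖nonlin f k‖ ≤ ‖coeffL k (twoRe f)‖ +
      (if k = 0 then 0 else ‖mulCoeff (twoRe f) (twoRe f) k‖) := by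
  have h := norm_nonlin_sub_le f 0 k
  have h0 : twoRe (0 : L2Torus) = 0 := by simpa using twoRe_sub 0 0
  have h1 : nonlin 0 k = 0 := by
    have : mulCoeff 0 0 k = 0 := by
      have := norm_mulCoeff_le 0 0 k
      simpa using this
    simp [nonlin, h0, this]
  rwa [h1, sub_zero, sub_zero, add_zero] at h

/-! ### The Fourier-Plancherel transform of integrable functions on the line -/

/-- Square integrable functions on the line. -/
abbrev L2Line : Type := Lp ℂ 2 (volume : Measure ℝ)

open SchwartzMap in
-- Both transforms are tested against smooth functions of compact support: for the Plancherel
-- transform duality is the definition on tempered distributions, for the integral it is Fubini's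
-- theorem.
lemma coeFn_fourier_of_integrable (f : L2Line) (hf : Integrable (f : ℝ → ℂ)) :
    ((𝓕 f : L2Line) : ℝ → ℂ) =ᵐ[volume] 𝓕 (f : ℝ → ℂ) := by
  have hcont : Continuous (𝓕 (f : ℝ → ℂ)) :=
    VectorFourier.fourierIntegral_continuous Real.continuous_fourierChar
      (by exact continuous_inner) hf
  refine ae_eq_of_integral_contDiff_smul_eq
    ((Lp.memLp _).locallyIntegrable (by norm_num)) hcont.locallyIntegrable ?_
  intro g hg hc
  have hc' : HasCompactSupport (fun x => (g x : ℂ)) := hc.comp_left (g := fun x : ℝ => (x : ℂ)) rfl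
  let φ : 𝓢(ℝ, ℂ) := hc'.toSchwartzMap (Complex.ofRealCLM.contDiff.comp hg)
  have hφ : ∀ x, φ x = (g x : ℂ) := fun x => rfl
  have h1 := congrArg (fun D => D φ) (Lp.fourier_toTemperedDistribution_eq f)
  simp only [TemperedDistribution.fourier_apply, Lp.toTemperedDistribution_apply] at h1
  have h2 := VectorFourier.integral_fourierIntegral_smul_eq_flip (L := innerₗ ℝ)
    Real.continuous_fourierChar (by exact continuous_inner) (φ.integrable (μ := volume)) hf
  rw [flip_innerₗ] at h2
  have h3 : ∀ x, (𝓕 φ : 𝓢(ℝ, ℂ)) x = VectorFourier.fourierIntegral Real.fourierChar volume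
    (innerₗ ℝ) φ x := fun x => rfl
  simp_rw [h3] at h1
  rw [h2] at h1
  simp only [smul_eq_mul] at h1
  simp only [Complex.real_smul, ← hφ]
  exact h1.symm

open SchwartzMap in
lemma coeFn_fourierInv_of_integrable (f : L2Line) (hf : Integrable (f : ℝ → ℂ)) :
    ((𝓕⁻ f : L2Line) : ℝ → ℂ) =ᵐ[volume] 𝓕⁻ (f : ℝ → ℂ) := by
  have hcont : Continuous (𝓕⁻ (f : ℝ → ℂ)) :=
    VectorFourier.fourierIntegral_continuous Real.continuous_fourierChar
      (by exact (continuous_inner (𝕜 := ℝ) (E := ℝ)).neg) hf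
  refine ae_eq_of_integral_contDiff_smul_eq
    ((Lp.memLp _).locallyIntegrable (by norm_num)) hcont.locallyIntegrable ?_
  intro g hg hc
  have hc' : HasCompactSupport (fun x => (g x : ℂ)) := hc.comp_left (g := fun x : ℝ => (x : ℂ)) rfl
  let φ : 𝓢(ℝ, ℂ) := hc'.toSchwartzMap (Complex.ofRealCLM.contDiff.comp hg)
  have hφ : ∀ x, φ x = (g x : ℂ) := fun x => rfl
  have h1 := congrArg (fun D => D φ) (Lp.fourierInv_toTemperedDistribution_eq f)
  simp only [TemperedDistribution.fourierInv_apply, Lp.toTemperedDistribution_apply] at h1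
  have h2 := VectorFourier.integral_fourierIntegral_smul_eq_flip (L := -innerₗ ℝ)
    Real.continuous_fourierChar (by exact (continuous_inner (𝕜 := ℝ) (E := ℝ)).neg)
    (φ.integrable (μ := volume)) hf
  have h3 : ∀ x, (𝓕⁻ φ : 𝓢(ℝ, ℂ)) x = VectorFourier.fourierIntegral Real.fourierChar volume
    (-innerₗ ℝ) φ x := fun x => by
      rw [SchwartzMap.fourierInv_coe]; rfl
  simp_rw [h3] at h1
  rw [h2] at h1
  have h4 : ∀ x, 𝓕⁻ (f : ℝ → ℂ) x = VectorFourier.fourierIntegral Real.fourierChar volume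
    (-innerₗ ℝ).flip f x := fun x => by
      have : (-innerₗ ℝ).flip = -innerₗ ℝ := by
        ext; simp
      rw [this]; rfl
  simp only [Complex.real_smul, ← hφ, h4]
  simpa using h1.symm

/-- The Fourier-Plancherel transform commutes with bounded linear maps. -/
lemma compLp_fourier {H : Type*} [NormedAddCommGroup H] [InnerProductSpace ℂ H] [CompleteSpace H]
    (L : H →L[ℂ] ℂ) (u : Lp H 2 (volume : Measure ℝ)) :
    L.compLp (𝓕 u : Lp H 2 (volume : Measure ℝ)) = (𝓕 (L.compLp u : L2Line) : L2Line) := by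
  -- Both sides are continuous in `u`, so Schwartz functions suffice; for these the transform is an
  -- integral, which commutes with `L`.
  refine DenseRange.induction_on (p := fun u : Lp H 2 (volume : Measure ℝ) =>
    L.compLp (𝓕 u : Lp H 2 (volume : Measure ℝ)) = (𝓕 (L.compLp u : L2Line) : L2Line))
    (SchwartzMap.denseRange_toLpCLM (p := 2) ENNReal.ofNat_ne_top) u ?_ ?_
  · apply isClosed_eq
    · exact (L.compLpL 2 volume).continuous.comp (Lp.fourierTransformₗᵢ ℝ H).continuous
    · exact (Lp.fourierTransformₗᵢ ℝ ℂ).continuous.comp (L.compLpL 2 volume).continuous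
  · intro φ
    have h0 : SchwartzMap.toLpCLM ℝ H 2 volume φ = φ.toLp 2 := rfl
    let ψ : SchwartzMap ℝ ℂ := SchwartzMap.postcompCLM L φ
    have hψ : L.compLp (φ.toLp 2 : Lp H 2 (volume : Measure ℝ)) = ψ.toLp 2 := by
      refine Lp.ext ?_
      filter_upwards [L.coeFn_compLp (φ.toLp 2 : Lp H 2 (volume : Measure ℝ)),
        φ.coeFn_toLp 2 volume,
        ψ.coeFn_toLp 2 volume] with x h1 h2 h3
      rw [h1, h2, h3]; rfl
    have hF : (𝓕 (φ.toLp 2 : Lp H 2 (volume : Measure ℝ)) : Lp H 2 (volume : Measure ℝ)) =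
        (𝓕 φ).toLp 2 :=
      SchwartzMap.toLp_fourier_eq φ
    rw [h0, hψ, hF, SchwartzMap.toLp_fourier_eq]
    refine Lp.ext ?_
    filter_upwards [L.coeFn_compLp ((𝓕 φ).toLp 2 : Lp H 2 (volume : Measure ℝ)),
      (𝓕 φ).coeFn_toLp 2 volume,
        (𝓕 ψ).coeFn_toLp 2 volume] with x h1 h2 h3
    rw [h1, h2, h3, SchwartzMap.fourier_coe, SchwartzMap.fourier_coe, Real.fourier_eq,
      Real.fourier_eq]
    rw [← ContinuousLinearMap.integral_comp_comm]
    · refine integral_congr_ae (Eventually.of_forall fun v => ?_)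
      simp only [Circle.smul_def, map_smul]; rfl
    · exact (Real.fourierIntegral_convergent_iff x).2 (φ.integrable (μ := volume))

/-! ### Almost orthogonality of the frequencies in a product of free waves -/

lemma integral_gaussian_exp (l : ℝ) :
    ∫ t : ℝ, Complex.exp (Complex.I * l * t) * Complex.exp (-(t : ℂ) ^ 2) =
      ((Real.sqrt Real.pi * Real.exp (-l ^ 2 / 4) : ℝ) : ℂ) := by
  have h := fourierIntegral_gaussian (b := 1) (by simp) (l : ℂ)
  simp only [neg_mul, one_mul, div_one, mul_one] at h
  rw [h]
  push_cast
  congr 1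
  rw [Real.sqrt_eq_rpow, Complex.ofReal_cpow Real.pi_pos.le]
  norm_num

lemma integrable_gaussian_exp (l : ℝ) :
    Integrable fun t : ℝ => Complex.exp (Complex.I * l * t) * Complex.exp (-(t : ℂ) ^ 2) := by
  have h : Integrable fun t : ℝ => Complex.exp (-(t : ℂ) ^ 2) := by
    simpa using integrable_cexp_neg_mul_sq (b := 1) (by simp)
  refine h.bdd_mul (c := 1) (by fun_prop) (Eventually.of_forall fun t => ?_)
  rw [Complex.norm_exp]; simp

/-- Large sieve inequality: an almost orthogonality estimate for exponential sums, with gaussian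
weight. -/
lemma integral_gaussian_expSum_le (S : Finset ℤ) (l : ℤ → ℝ) (K : ℝ)
    (hK : ∀ m ∈ S, ∑ n ∈ S, Real.exp (-(l m - l n) ^ 2 / 4) ≤ K) (c : ℤ → ℂ) :
    Integrable (fun t : ℝ => Real.exp (-t ^ 2) *
        ‖∑ n ∈ S, Complex.exp (Complex.I * l n * t) * c n‖ ^ 2) ∧
    ∫ t : ℝ, Real.exp (-t ^ 2) * ‖∑ n ∈ S, Complex.exp (Complex.I * l n * t) * c n‖ ^ 2 ≤
      Real.sqrt Real.pi * K * ∑ n ∈ S, ‖c n‖ ^ 2 := by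
  set E : ℤ → ℤ → ℝ := fun m n => Real.exp (-(l m - l n) ^ 2 / 4) with hE
  have hsymm : ∀ m n, E m n = E n m := fun m n => by simp only [hE]; congr 2; ring
  have hexp : ∀ t : ℝ, ((Real.exp (-t ^ 2) *
      ‖∑ n ∈ S, Complex.exp (Complex.I * l n * t) * c n‖ ^ 2 : ℝ) : ℂ) =
      ∑ m ∈ S, ∑ n ∈ S, (c m * (starRingEnd ℂ) (c n)) *
        (Complex.exp (Complex.I * (l m - l n : ℝ) * t) * Complex.exp (-(t : ℂ) ^ 2)) := by
    intro t
    push_cast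
    rw [← Complex.mul_conj', map_sum, Finset.sum_mul_sum, Finset.mul_sum]
    refine Finset.sum_congr rfl fun m _ => ?_
    rw [Finset.mul_sum]
    refine Finset.sum_congr rfl fun n _ => ?_
    rw [map_mul, ← Complex.exp_conj]
    have : Complex.exp (Complex.I * ((l m : ℂ) - l n) * t) =
        Complex.exp (Complex.I * l m * t) *
          Complex.exp ((starRingEnd ℂ) (Complex.I * l n * t)) := by
      rw [← Complex.exp_add]; congr 1; simp; ring
    rw [this]; ring
  have hint : ∀ m n, Integrable fun t : ℝ => (c m * (starRingEnd ℂ) (c n)) *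
        (Complex.exp (Complex.I * (l m - l n : ℝ) * t) * Complex.exp (-(t : ℂ) ^ 2)) :=
    fun m n => (integrable_gaussian_exp _).const_mul _
  have hI : Integrable (fun t : ℝ => ((Real.exp (-t ^ 2) *
      ‖∑ n ∈ S, Complex.exp (Complex.I * l n * t) * c n‖ ^ 2 : ℝ) : ℂ)) := by
    simp_rw [hexp]
    exact integrable_finsetSum _ fun m _ => integrable_finsetSum _ fun n _ => hint m n
  have hI' : Integrable (fun t : ℝ => Real.exp (-t ^ 2) *
      ‖∑ n ∈ S, Complex.exp (Complex.I * l n * t) * c n‖ ^ 2) := by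
    have := hI.re
    simp only [RCLike.re_to_complex, Complex.ofReal_re] at this
    exact this
  refine ⟨hI', ?_⟩
  have hval : ((∫ t : ℝ, Real.exp (-t ^ 2) *
      ‖∑ n ∈ S, Complex.exp (Complex.I * l n * t) * c n‖ ^ 2 : ℝ) : ℂ) =
      ∑ m ∈ S, ∑ n ∈ S, (c m * (starRingEnd ℂ) (c n)) *
        ((Real.sqrt Real.pi * E m n : ℝ) : ℂ) := by
    rw [← integral_complex_ofReal]
    simp_rw [hexp]
    rw [integral_finsetSum _ fun m _ => integrable_finsetSum _ fun n _ => hint m n]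
    refine Finset.sum_congr rfl fun m _ => ?_
    rw [integral_finsetSum _ fun n _ => hint m n]
    refine Finset.sum_congr rfl fun n _ => ?_
    rw [integral_const_mul, integral_gaussian_exp]
  -- Schur's test: the inequality between geometric and arithmetic means decouples c_m from c_n, and
  -- by symmetry only row sums of the Gaussian matrix remain.
  have hle : ∫ t : ℝ, Real.exp (-t ^ 2) *
      ‖∑ n ∈ S, Complex.exp (Complex.I * l n * t) * c n‖ ^ 2 ≤
      ∑ m ∈ S, ∑ n ∈ S, Real.sqrt Real.pi * ((‖c m‖ ^ 2 + ‖c n‖ ^ 2) / 2 * E m n) := by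
    refine (le_abs_self _).trans ?_
    rw [← Real.norm_eq_abs, ← Complex.norm_real, hval]
    refine (norm_sum_le _ _).trans (Finset.sum_le_sum fun m _ => ?_)
    refine (norm_sum_le _ _).trans (Finset.sum_le_sum fun n _ => ?_)
    have hE0 : 0 ≤ E m n := (Real.exp_pos _).le
    rw [norm_mul, norm_mul, Complex.norm_real, RCLike.norm_conj,
      Real.norm_of_nonneg (by positivity)]
    have : ‖c m‖ * ‖c n‖ ≤ (‖c m‖ ^ 2 + ‖c n‖ ^ 2) / 2 := by
      nlinarith [sq_nonneg (‖c m‖ - ‖c n‖)]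
    calc _ ≤ (‖c m‖ ^ 2 + ‖c n‖ ^ 2) / 2 * (Real.sqrt Real.pi * E m n) := by gcongr
      _ = _ := by ring
  refine hle.trans ?_
  have h1 : ∑ m ∈ S, ∑ n ∈ S, Real.sqrt Real.pi * ((‖c m‖ ^ 2 + ‖c n‖ ^ 2) / 2 * E m n) =
      Real.sqrt Real.pi * ∑ m ∈ S, ‖c m‖ ^ 2 * ∑ n ∈ S, E m n := by
    have h2 : ∑ m ∈ S, ∑ n ∈ S, ‖c n‖ ^ 2 * E m n = ∑ m ∈ S, ∑ n ∈ S, ‖c m‖ ^ 2 * E m n := by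
      rw [Finset.sum_comm]
      refine Finset.sum_congr rfl fun m _ => Finset.sum_congr rfl fun n _ => ?_
      rw [hsymm]
    simp_rw [← Finset.mul_sum]
    congr 1
    have h3 : ∀ m n, (‖c m‖ ^ 2 + ‖c n‖ ^ 2) / 2 * E m n =
      (‖c m‖ ^ 2 * E m n) / 2 + (‖c n‖ ^ 2 * E m n) / 2 := fun m n => by ring
    simp_rw [h3, Finset.sum_add_distrib, ← Finset.sum_div]
    rw [h2]
    simp_rw [Finset.mul_sum]
    ring
  rw [h1, mul_assoc]
  gcongr
  rw [Finset.mul_sum]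
  refine Finset.sum_le_sum fun m hm => ?_
  rw [mul_comm]
  gcongr
  exact hK m hm

lemma summable_inv_one_add_sq : Summable fun j : ℤ => 1 / (1 + (j : ℝ) ^ 2) := by
  have h : Summable fun j : ℤ => 1 / |(j : ℝ) + 1 / 2| ^ (2 : ℝ) :=
    (Real.summable_one_div_int_add_rpow (1 / 2) 2).2 (by norm_num)
  refine Summable.of_nonneg_of_le (fun j => by positivity) (fun j => ?_) (h.mul_left 2)
  have hj : (0 : ℝ) < |(j : ℝ) + 1 / 2| ^ (2 : ℝ) := by
    refine Real.rpow_pos_of_pos (abs_pos.2 fun h0 => ?_) _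
    have : (2 * j + 1 : ℤ) = 0 := by
      have : (2 * j + 1 : ℝ) = 0 := by linarith
      exact_mod_cast this
    omega
  rw [mul_one_div, div_le_div_iff₀ (by positivity) hj]
  rw [Real.rpow_two, sq_abs]
  nlinarith [sq_nonneg ((j : ℝ) - 1 / 2)]

/-- For j ≤ 6 the bound 1 + j² ≤ 37 suffices. For j > 6 one has j - 4 ≥ j/3, and exp(j²/36) ≥ 1 +
j²/36 finishes. -/
lemma exp_neg_sq_le {x j : ℝ} (hj : 0 ≤ j) (h : j - 4 ≤ |x|) :
    Real.exp (-x ^ 2 / 4) ≤ 40 * (1 / (1 + j ^ 2)) := by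
  rw [mul_one_div, le_div_iff₀ (by positivity)]
  rcases le_or_gt j 6 with h6 | h6
  · have : Real.exp (-x ^ 2 / 4) ≤ 1 := Real.exp_le_one_iff.2 (by nlinarith [sq_nonneg x])
    nlinarith
  · have hx : j / 3 ≤ |x| := by linarith
    have hx2 : j ^ 2 / 9 ≤ x ^ 2 := by
      rw [← sq_abs x]; nlinarith
    have h1 : Real.exp (-x ^ 2 / 4) ≤ Real.exp (-(j ^ 2 / 36)) :=
      Real.exp_le_exp.2 (by linarith)
    have h2 := Real.add_one_le_exp (j ^ 2 / 36)
    have h3 : Real.exp (-(j ^ 2 / 36)) * Real.exp (j ^ 2 / 36) = 1 := by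
      rw [← Real.exp_add]; simp
    have h4 := Real.exp_pos (-(j ^ 2 / 36))
    nlinarith

/-- The frequencies that produce the mode `k` in a product of two free waves. -/
noncomputable def freq (a b : ℝ) (k n : ℤ) : ℝ := a * disp n + b * disp (k - n)

/-- The constant in `sum_exp_freq_le`. -/
noncomputable def schurConst : ℝ := 1 + 40 * ∑' j : ℤ, 1 / (1 + (j : ℝ) ^ 2)

lemma sub_four_le_abs {j x y : ℝ} (hj : j ≤ |x|)
    (h : (x - y ≤ 4 ∧ y - x ≤ 4) ∨ (x + y ≤ 4 ∧ -(x + y) ≤ 4)) : j - 4 ≤ |y| := by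
  rcases h with ⟨h1, h2⟩ | ⟨h1, h2⟩ <;> rcases abs_cases x with h | h <;>
    rcases abs_cases y with h' | h' <;> linarith

/-- With n² in place of √(n⁴+1), the difference of frequencies is ±2(n-m)(n+m-k) for equal signs and
±2k(n-m) for opposite signs. The integer factors n+m-k and k are nonzero by hypothesis, so both are
at least |n-m| in modulus; the 4 absorbs the errors n² ≤ √(n⁴+1) ≤ n² + 1. -/
lemma abs_freq_sub {a b : ℝ} (ha : a = 1 ∨ a = -1) (hb : b = 1 ∨ b = -1) {k : ℤ} (hk : k ≠ 0)
    {m n : ℤ} (hmn : n ≠ k - m) :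
    |((n - m : ℤ) : ℝ)| - 4 ≤ |freq a b k m - freq a b k n| := by
  have e1 := sq_le_disp m
  have e2 := disp_le m
  have e3 := sq_le_disp n
  have e4 := disp_le n
  have e5 := sq_le_disp (k - m)
  have e6 := disp_le (k - m)
  have e7 := sq_le_disp (k - n)
  have e8 := disp_le (k - n)
  push_cast at e5 e6 e7 e8
  have key : ∀ p : ℤ, p ≠ 0 → |((n - m : ℤ) : ℝ)| ≤ |(((n - m) * p : ℤ) : ℝ)| := by
    intro p hp
    rw [← Int.cast_abs, ← Int.cast_abs, Int.cast_le, abs_mul]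
    exact le_mul_of_one_le_right (abs_nonneg _) (Int.one_le_abs hp)
  have k1 := key (2 * (n + m - k)) (by omega)
  have k2 := key (2 * k) (by omega)
  unfold freq
  push_cast at k1 k2 ⊢
  rcases ha with rfl | rfl <;> rcases hb with rfl | rfl
  · exact sub_four_le_abs k1 (Or.inr ⟨by linarith, by linarith⟩)
  · exact sub_four_le_abs k2 (Or.inr ⟨by linarith, by linarith⟩)
  · exact sub_four_le_abs k2 (Or.inl ⟨by linarith, by linarith⟩)
  · exact sub_four_le_abs k1 (Or.inl ⟨by linarith, by linarith⟩)

/-- The reflected index n = k - m may carry the same frequency as m and is counted separately, with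
contribution at most 1. The bound does not depend on k, m or S. -/
lemma sum_exp_freq_le {a b : ℝ} (ha : a = 1 ∨ a = -1) (hb : b = 1 ∨ b = -1) {k : ℤ} (hk : k ≠ 0)
    (S : Finset ℤ) (m : ℤ) :
    ∑ n ∈ S, Real.exp (-(freq a b k m - freq a b k n) ^ 2 / 4) ≤ schurConst := by
  have h1 : ∀ n, Real.exp (-(freq a b k m - freq a b k n) ^ 2 / 4) ≤
      (if n = k - m then 1 else 0) + 40 * (1 / (1 + ((n - m : ℤ) : ℝ) ^ 2)) := by
    intro n
    split_ifs with h
    · have : Real.exp (-(freq a b k m - freq a b k n) ^ 2 / 4) ≤ 1 :=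
        Real.exp_le_one_iff.2 (by nlinarith [sq_nonneg (freq a b k m - freq a b k n)])
      have h2 : 0 ≤ 40 * (1 / (1 + ((n - m : ℤ) : ℝ) ^ 2)) := by positivity
      linarith
    · rw [zero_add, ← sq_abs ((n - m : ℤ) : ℝ)]
      exact exp_neg_sq_le (abs_nonneg _) (abs_freq_sub ha hb hk h)
  refine (Finset.sum_le_sum fun n _ => h1 n).trans ?_
  rw [Finset.sum_add_distrib, ← Finset.mul_sum, schurConst]
  gcongr
  · rw [Finset.sum_ite_eq']; split_ifs <;> norm_num
  · have h2 : Summable fun n : ℤ => 1 / (1 + ((n - m : ℤ) : ℝ) ^ 2) :=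
      (Equiv.subRight m).summable_iff.2 summable_inv_one_add_sq
    refine (h2.sum_le_tsum S fun n _ => by positivity).trans (le_of_eq ?_)
    exact (Equiv.subRight m).tsum_eq (fun j : ℤ => 1 / (1 + (j : ℝ) ^ 2))

/-- The constant in the bilinear estimates on `[0, T]`. -/
noncomputable def sieveConst (T : ℝ) : ℝ≥0∞ :=
  ENNReal.ofReal (Real.exp (T ^ 2) * (Real.sqrt Real.pi * schurConst))

lemma sieveConst_lt_top (T : ℝ) : sieveConst T < ⊤ := ENNReal.ofReal_lt_top

lemma lintegral_expSum_le {a b : ℝ} (ha : a = 1 ∨ a = -1) (hb : b = 1 ∨ b = -1) {k : ℤ}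
    (hk : k ≠ 0) (T : ℝ) (S : Finset ℤ) (c : ℤ → ℂ) :
    ∫⁻ t in Icc 0 T, ‖∑ n ∈ S, Complex.exp (Complex.I * freq a b k n * t) * c n‖ₑ ^ 2 ≤
      sieveConst T * ∑ n ∈ S, ‖c n‖ₑ ^ 2 := by
  obtain ⟨hI, hle⟩ := integral_gaussian_expSum_le S (freq a b k) schurConst
    (fun m _ => sum_exp_freq_le ha hb hk S m) c
  have hsum : ∑ n ∈ S, ‖c n‖ₑ ^ 2 = ENNReal.ofReal (∑ n ∈ S, ‖c n‖ ^ 2) := by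
    rw [ENNReal.ofReal_sum_of_nonneg fun n _ => sq_nonneg _]
    refine Finset.sum_congr rfl fun n _ => ?_
    rw [← ofReal_norm, ENNReal.ofReal_pow (norm_nonneg _)]
  have hC : 0 ≤ schurConst := by
    have : 0 ≤ ∑' j : ℤ, 1 / (1 + (j : ℝ) ^ 2) := tsum_nonneg fun j => by positivity
    unfold schurConst; linarith
  rw [hsum, sieveConst, ← ENNReal.ofReal_mul (by positivity)]
  -- On [0,T] the sharp cutoff is at most e^{T²} e^{-t²}, which accounts for the factor e^{T²} in
  -- `sieveConst`.
  calc _ ≤ ∫⁻ t in Icc 0 T, ENNReal.ofReal (Real.exp (T ^ 2) * (Real.exp (-t ^ 2) *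
        ‖∑ n ∈ S, Complex.exp (Complex.I * freq a b k n * t) * c n‖ ^ 2)) := by
        refine setLIntegral_mono' measurableSet_Icc fun t ht => ?_
        rw [← ofReal_norm, ← ENNReal.ofReal_pow (norm_nonneg _), ← mul_assoc, ← Real.exp_add]
        refine ENNReal.ofReal_le_ofReal (le_mul_of_one_le_left (sq_nonneg _) ?_)
        rw [Real.one_le_exp_iff]
        nlinarith [ht.1, ht.2]
    _ ≤ ∫⁻ t, ENNReal.ofReal (Real.exp (T ^ 2) * (Real.exp (-t ^ 2) *
        ‖∑ n ∈ S, Complex.exp (Complex.I * freq a b k n * t) * c n‖ ^ 2)) :=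
        setLIntegral_le_lintegral _ _
    _ = ENNReal.ofReal (∫ t, Real.exp (T ^ 2) * (Real.exp (-t ^ 2) *
        ‖∑ n ∈ S, Complex.exp (Complex.I * freq a b k n * t) * c n‖ ^ 2)) := by
        rw [ofReal_integral_eq_lintegral_ofReal (hI.const_mul _)]
        exact Eventually.of_forall fun t => by positivity
    _ ≤ _ := by
        refine ENNReal.ofReal_le_ofReal ?_
        rw [integral_const_mul, mul_assoc]
        gcongr

/-! ### Sobolev weights and convolutions -/

/-- The weight `⟨k⟩^{2s}`. -/
noncomputable def wt (s : ℝ) (k : ℤ) : ℝ≥0∞ := ENNReal.ofReal (jap k ^ s) ^ 2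

lemma one_le_jap (x : ℝ) : 1 ≤ jap x := by
  rw [jap, Real.one_le_sqrt]; nlinarith [sq_nonneg x]

lemma jap_pos (x : ℝ) : 0 < jap x := zero_lt_one.trans_le (one_le_jap x)

lemma jap_neg (x : ℝ) : jap (-x) = jap x := by simp [jap]

lemma jap_add_le (x y : ℝ) : jap (x + y) ≤ 2 * (jap x * jap y) := by
  rw [jap, jap, jap, ← Real.sqrt_mul (by positivity), Real.sqrt_le_left (by positivity), mul_pow,
    Real.sq_sqrt (by positivity)]
  nlinarith [sq_nonneg (x - y), sq_nonneg (x * y), sq_nonneg x, sq_nonneg y]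

lemma wt_neg (s : ℝ) (k : ℤ) : wt s (-k) = wt s k := by simp [wt, jap_neg]

lemma disp_neg (k : ℤ) : disp (-k) = disp k := by
  simp [disp, Even.neg_pow (show Even 4 by decide)]

lemma wt_lt_top (s : ℝ) (k : ℤ) : wt s k < ⊤ := ENNReal.pow_lt_top ENNReal.ofReal_lt_top

lemma one_le_wt {s : ℝ} (hs : 0 ≤ s) (k : ℤ) : 1 ≤ wt s k := by
  refine one_le_pow₀ ?_
  rw [ENNReal.one_le_ofReal]
  exact Real.one_le_rpow (one_le_jap _) hs

lemma wt_ne_zero (s : ℝ) (k : ℤ) : wt s k ≠ 0 := by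
  refine pow_ne_zero 2 ?_
  rw [Ne, ENNReal.ofReal_eq_zero, not_le]
  exact Real.rpow_pos_of_pos (jap_pos _) _

/-- The constant in `wt_le`. -/
noncomputable def wtConst (s : ℝ) : ℝ≥0∞ := ENNReal.ofReal (2 ^ s) ^ 2

lemma wtConst_lt_top (s : ℝ) : wtConst s < ⊤ := ENNReal.pow_lt_top ENNReal.ofReal_lt_top

lemma wt_le {s : ℝ} (hs : 0 ≤ s) (k n : ℤ) : wt s k ≤ wtConst s * (wt s n * wt s (k - n)) := by
  rw [wt, wt, wt, wtConst, ← mul_pow, ← mul_pow]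
  gcongr
  rw [← ENNReal.ofReal_mul (by have := jap_pos n; positivity), ← ENNReal.ofReal_mul (by positivity),
    ← Real.mul_rpow (jap_pos _).le (jap_pos _).le, ← Real.mul_rpow (by norm_num)
      (by have := jap_pos n; have := jap_pos (k - n : ℤ); positivity)]
  refine ENNReal.ofReal_le_ofReal (Real.rpow_le_rpow (jap_pos _).le ?_ hs)
  have := jap_add_le n (k - n : ℤ)
  simpa using this

/-- A weighted Young inequality for convolutions of `ℓ¹` sequences. -/
lemma tsum_wt_conv_le {s : ℝ} (hs : 0 ≤ s) (A B : ℤ → ℝ≥0∞) :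
    ∑' k, wt s k * ∑' n, A n * B (k - n) ≤
      wtConst s * ((∑' n, wt s n * A n) * ∑' n, wt s n * B n) := by
  calc _ ≤ ∑' k, ∑' n, wtConst s * ((wt s n * A n) * (wt s (k - n) * B (k - n))) := by
        refine ENNReal.tsum_le_tsum fun k => ?_
        rw [← ENNReal.tsum_mul_left]
        refine ENNReal.tsum_le_tsum fun n => ?_
        calc _ ≤ wtConst s * (wt s n * wt s (k - n)) * (A n * B (k - n)) := by
              gcongr; exact wt_le hs k n
          _ = _ := by ring
    _ = wtConst s * ∑' n, (wt s n * A n) * ∑' k, (wt s (k - n) * B (k - n)) := by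
        rw [ENNReal.tsum_comm, ← ENNReal.tsum_mul_left]
        refine tsum_congr fun n => ?_
        rw [ENNReal.tsum_mul_left, ENNReal.tsum_mul_left]
    _ = _ := by
        congr 1
        rw [← ENNReal.tsum_mul_right]
        refine tsum_congr fun n => ?_
        congr 1
        exact (Equiv.subRight n).tsum_eq fun k => wt s k * B k

/-! ### Superpositions of free waves and the bilinear estimate -/

/-- Cauchy-Schwarz inequality. -/
lemma lintegral_mul_sq_le {α : Type*} [MeasurableSpace α] {μ : Measure α} {f g : α → ℝ≥0∞}
    (hf : AEMeasurable f μ) (hg : AEMeasurable g μ) :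
    (∫⁻ x, f x * g x ∂μ) ^ 2 ≤ (∫⁻ x, f x ^ 2 ∂μ) * ∫⁻ x, g x ^ 2 ∂μ := by
  have h := ENNReal.lintegral_mul_le_Lp_mul_Lq μ Real.HolderConjugate.two_two hf hg
  simp only [Pi.mul_apply, ENNReal.rpow_two] at h
  calc _ ≤ ((∫⁻ x, f x ^ 2 ∂μ) ^ (1 / 2 : ℝ) * (∫⁻ x, g x ^ 2 ∂μ) ^ (1 / 2 : ℝ)) ^ 2 := by gcongr
    _ = _ := by
      rw [mul_pow, ← ENNReal.rpow_mul_natCast, ← ENNReal.rpow_mul_natCast]; norm_num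

lemma enorm_integral_mul_sq_le {α : Type*} [MeasurableSpace α] {μ : Measure α} {f g : α → ℂ}
    (hf : AEMeasurable f μ) (hg : AEMeasurable g μ) :
    ‖∫ x, f x * g x ∂μ‖ₑ ^ 2 ≤ (∫⁻ x, ‖f x‖ₑ ^ 2 ∂μ) * ∫⁻ x, ‖g x‖ₑ ^ 2 ∂μ := by
  refine le_trans ?_ (lintegral_mul_sq_le hf.enorm hg.enorm)
  gcongr
  refine (enorm_integral_le_lintegral_enorm _).trans (le_of_eq ?_)
  simp only [enorm_mul]

lemma integrable_mul_of_lintegral_sq {α : Type*} [MeasurableSpace α] {μ : Measure α}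
    {f g : α → ℂ} (hf : AEMeasurable f μ) (hg : AEMeasurable g μ)
    (hf2 : ∫⁻ x, ‖f x‖ₑ ^ 2 ∂μ < ⊤) (hg2 : ∫⁻ x, ‖g x‖ₑ ^ 2 ∂μ < ⊤) :
    Integrable (fun x => f x * g x) μ := by
  refine ⟨(hf.mul hg).aestronglyMeasurable, ?_⟩
  rw [HasFiniteIntegral]
  simp only [enorm_mul]
  have h := (lintegral_mul_sq_le hf.enorm hg.enorm).trans_lt (ENNReal.mul_lt_top hf2 hg2)
  by_contra h'
  rw [not_lt, top_le_iff] at h'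
  rw [h'] at h
  simp at h

/-- `y_n(t) = e^{iat√(n⁴+1)} ∫ m(t, τ) F_n(τ) dτ` for `t ∈ I`: the function with the coefficients
`y_n` is a superposition of free waves with data `F(τ) ∈ H^s`. -/
structure IsProfile (a s : ℝ) (I : Set ℝ) (y : ℤ → ℝ → ℂ) (m : ℝ → ℝ → ℂ) (F : ℤ → ℝ → ℂ)
    (M S : ℝ≥0∞) : Prop where
  aemeasurable : ∀ n, AEMeasurable (y n) (volume.restrict I)
  measurable_kernel : ∀ t, Measurable (m t)
  measurable_density : ∀ n, Measurable (F n)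
  kernel_le : ∀ t ∈ I, ∫⁻ τ, ‖m t τ‖ₑ ^ 2 ≤ M
  density_le : ∑' n, wt s n * ∫⁻ τ, ‖F n τ‖ₑ ^ 2 ≤ S
  kernel_lt_top : M < ⊤
  density_lt_top : S < ⊤
  eq : ∀ t ∈ I, ∀ n, y n t = Complex.exp (Complex.I * (a * disp n : ℝ) * t) * ∫ τ, m t τ * F n τ

namespace IsProfile

variable {a b s T : ℝ} {I : Set ℝ} {y z : ℤ → ℝ → ℂ} {m m' : ℝ → ℝ → ℂ} {F G : ℤ → ℝ → ℂ}
  {M S M' S' : ℝ≥0∞}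

/-- Conjugation reverses time frequencies and reflects modes. Thus ū, which enters through u + ū, is
a superposition of waves of the opposite sign. -/
lemma conj (P : IsProfile a s I y m F M S) :
    IsProfile (-a) s I (fun n t => (starRingEnd ℂ) (y (-n) t))
      (fun t τ => (starRingEnd ℂ) (m t τ)) (fun n τ => (starRingEnd ℂ) (F (-n) τ)) M S where
  aemeasurable n := Complex.continuous_conj.measurable.comp_aemeasurable (P.aemeasurable (-n))
  measurable_kernel t := Complex.continuous_conj.measurable.comp (P.measurable_kernel t)
  measurable_density n := Complex.continuous_conj.measurable.comp (P.measurable_density (-n))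
  kernel_le t ht := by simpa using P.kernel_le t ht
  density_le := by
    refine le_trans (le_of_eq ?_) P.density_le
    rw [← (Equiv.neg ℤ).tsum_eq]
    simp [wt_neg]
  kernel_lt_top := P.kernel_lt_top
  density_lt_top := P.density_lt_top
  eq t ht n := by
    rw [P.eq t ht (-n), map_mul, ← Complex.exp_conj, ← integral_conj]
    congr 1
    · congr 1; simp [disp_neg]
    · simp

/-- The right side does not depend on t, so it also serves as the majorant for continuity in H^s. -/
lemma enorm_sq_le (P : IsProfile a s I y m F M S) {t : ℝ} (ht : t ∈ I) (n : ℤ) :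
    ‖y n t‖ₑ ^ 2 ≤ M * ∫⁻ τ, ‖F n τ‖ₑ ^ 2 := by
  have h1 : ‖Complex.exp (Complex.I * (a * disp n : ℝ) * t)‖ₑ = 1 := by
    rw [← ofReal_norm, Complex.norm_exp]; simp
  rw [P.eq t ht n, enorm_mul, h1, one_mul]
  refine (enorm_integral_mul_sq_le (P.measurable_kernel t).aemeasurable
    (P.measurable_density n).aemeasurable).trans ?_
  gcongr
  exact P.kernel_le t ht

lemma tsum_wt_le (P : IsProfile a s I y m F M S) {t : ℝ} (ht : t ∈ I) :
    ∑' n, wt s n * ‖y n t‖ₑ ^ 2 ≤ M * S := by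
  calc _ ≤ ∑' n, M * (wt s n * ∫⁻ τ, ‖F n τ‖ₑ ^ 2) := by
        refine ENNReal.tsum_le_tsum fun n => ?_
        rw [mul_left_comm]
        gcongr
        exact P.enorm_sq_le ht n
    _ ≤ _ := by
        rw [ENNReal.tsum_mul_left]
        gcongr
        exact P.density_le

lemma tsum_lintegral_le (P : IsProfile a s I y m F M S) (hI : MeasurableSet I) :
    ∑' n, wt s n * ∫⁻ t in I, ‖y n t‖ₑ ^ 2 ≤ volume I * (M * S) := by
  calc _ ≤ ∑' n, volume I * (M * (wt s n * ∫⁻ τ, ‖F n τ‖ₑ ^ 2)) := by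
        refine ENNReal.tsum_le_tsum fun n => ?_
        rw [mul_left_comm M, mul_left_comm _ (wt s n)]
        gcongr
        refine (setLIntegral_mono' hI fun t ht => P.enorm_sq_le ht n).trans (le_of_eq ?_)
        rw [setLIntegral_const, mul_comm]
    _ ≤ _ := by
        rw [ENNReal.tsum_mul_left, ENNReal.tsum_mul_left]
        gcongr
        exact P.density_le

lemma lintegral_density_lt_top (P : IsProfile a s I y m F M S) (n : ℤ) :
    ∫⁻ τ, ‖F n τ‖ₑ ^ 2 < ⊤ := by
  have h := (ENNReal.le_tsum n).trans_lt (P.density_le.trans_lt P.density_lt_top)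
  by_contra h'
  rw [not_lt, top_le_iff] at h'
  rw [h', ENNReal.mul_top (wt_ne_zero s n)] at h
  exact lt_irrefl _ h

lemma summable_sq (hs : 0 ≤ s) (P : IsProfile a s I y m F M S) {t : ℝ} (ht : t ∈ I) :
    Summable fun n => ‖y n t‖ ^ 2 := by
  have h : ∑' n, ‖y n t‖ₑ ^ 2 < ⊤ := by
    refine (ENNReal.tsum_le_tsum fun n => ?_).trans_lt
      ((P.tsum_wt_le ht).trans_lt (ENNReal.mul_lt_top P.kernel_lt_top P.density_lt_top))
    exact le_mul_of_one_le_left zero_le (one_le_wt hs n)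
  have h2 := (memLp_two_of_tsum h).summable (by norm_num)
  simpa using h2

lemma summable_mul (hs : 0 ≤ s) (P : IsProfile a s I y m F M S)
    (Q : IsProfile b s I z m' G M' S') {t : ℝ} (ht : t ∈ I) (k : ℤ) :
    Summable fun n => y n t * z (k - n) t := by
  have h1 := P.summable_sq hs ht
  have h2 : Summable fun n => ‖z (k - n) t‖ ^ 2 :=
    (Equiv.subLeft k).summable_iff.2 (Q.summable_sq hs ht)
  refine Summable.of_norm_bounded (h1.add h2) fun n => ?_
  rw [norm_mul]
  nlinarith [sq_nonneg (‖y n t‖ - ‖z (k - n) t‖), sq_nonneg ‖y n t‖, sq_nonneg ‖z (k - n) t‖]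

lemma aemeasurable_tsum (hs : 0 ≤ s) (P : IsProfile a s I y m F M S)
    (Q : IsProfile b s I z m' G M' S') (hI : MeasurableSet I) (k : ℤ) :
    AEMeasurable (fun t => ∑' n, y n t * z (k - n) t) (volume.restrict I) := by
  refine aemeasurable_of_tendsto_metrizable_ae (atTop : Filter (Finset ℤ))
    (f := fun A t => ∑ n ∈ A, y n t * z (k - n) t) (fun A => ?_) ?_
  · exact Finset.aemeasurable_fun_sum _ fun n _ => (P.aemeasurable n).mul (Q.aemeasurable (k - n))
  · filter_upwards [ae_restrict_mem hI] with t ht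
    exact (P.summable_mul hs Q ht k).hasSum

/-- The product is a superposition, over (τ, τ'), of products of free waves with weight m(t,τ)
m'(t,τ'). Cauchy-Schwarz in (τ, τ') removes the kernels and leaves, for each (τ, τ'), an exponential
sum in t with constant coefficients. -/
lemma enorm_sum_sq_le (P : IsProfile a s I y m F M S)
    (Q : IsProfile b s I z m' G M' S') {t : ℝ} (ht : t ∈ I) (k : ℤ) (A : Finset ℤ) :
    ‖∑ n ∈ A, y n t * z (k - n) t‖ₑ ^ 2 ≤ M * M' * ∫⁻ p : ℝ × ℝ,
      ‖∑ n ∈ A, Complex.exp (Complex.I * freq a b k n * t) * (F n p.1 * G (k - n) p.2)‖ₑ ^ 2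
        ∂(volume.prod volume) := by
  have hmt : ∫⁻ τ, ‖m t τ‖ₑ ^ 2 < ⊤ := (P.kernel_le t ht).trans_lt P.kernel_lt_top
  have hmt' : ∫⁻ τ, ‖m' t τ‖ₑ ^ 2 < ⊤ := (Q.kernel_le t ht).trans_lt Q.kernel_lt_top
  have hint : ∀ n, Integrable (fun p : ℝ × ℝ => (m t p.1 * F n p.1) * (m' t p.2 * G (k - n) p.2))
      (volume.prod volume) := fun n =>
    (integrable_mul_of_lintegral_sq (P.measurable_kernel t).aemeasurable
      (P.measurable_density n).aemeasurable hmt (P.lintegral_density_lt_top n)).mul_prod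
    (integrable_mul_of_lintegral_sq (Q.measurable_kernel t).aemeasurable
      (Q.measurable_density (k - n)).aemeasurable hmt' (Q.lintegral_density_lt_top (k - n)))
  have heq : ∑ n ∈ A, y n t * z (k - n) t = ∫ p : ℝ × ℝ, (m t p.1 * m' t p.2) *
      ∑ n ∈ A, Complex.exp (Complex.I * freq a b k n * t) * (F n p.1 * G (k - n) p.2)
        ∂(volume.prod volume) := by
    have h1 : ∀ p : ℝ × ℝ, (m t p.1 * m' t p.2) *
        ∑ n ∈ A, Complex.exp (Complex.I * freq a b k n * t) * (F n p.1 * G (k - n) p.2) =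
        ∑ n ∈ A, Complex.exp (Complex.I * freq a b k n * t) *
          ((m t p.1 * F n p.1) * (m' t p.2 * G (k - n) p.2)) := by
      intro p
      rw [Finset.mul_sum]
      exact Finset.sum_congr rfl fun n _ => by ring
    simp_rw [h1]
    rw [integral_finsetSum _ fun n _ => (hint n).const_mul _]
    refine Finset.sum_congr rfl fun n _ => ?_
    rw [integral_const_mul, integral_prod_mul (fun τ => m t τ * F n τ)
      (fun τ => m' t τ * G (k - n) τ), P.eq t ht n, Q.eq t ht (k - n)]
    have : Complex.exp (Complex.I * freq a b k n * t) =
        Complex.exp (Complex.I * (a * disp n : ℝ) * t) *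
          Complex.exp (Complex.I * (b * disp (k - n) : ℝ) * t) := by
      rw [← Complex.exp_add, freq]; congr 1; push_cast; ring
    rw [this]; ring
  have hm1 : Measurable fun p : ℝ × ℝ => m t p.1 * m' t p.2 :=
    ((P.measurable_kernel t).comp measurable_fst).mul ((Q.measurable_kernel t).comp measurable_snd)
  have hm2 : Measurable fun p : ℝ × ℝ => ∑ n ∈ A, Complex.exp (Complex.I * freq a b k n * t) *
      (F n p.1 * G (k - n) p.2) :=
    Finset.measurable_fun_sum _ fun n _ => (((P.measurable_density n).comp measurable_fst).mul
      ((Q.measurable_density (k - n)).comp measurable_snd)).const_mul _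
  rw [heq]
  refine (enorm_integral_mul_sq_le hm1.aemeasurable hm2.aemeasurable).trans ?_
  gcongr
  simp only [enorm_mul, mul_pow]
  rw [lintegral_prod_mul (f := fun τ => ‖m t τ‖ₑ ^ 2) (g := fun τ => ‖m' t τ‖ₑ ^ 2)
    ((P.measurable_kernel t).enorm.pow_const 2).aemeasurable
    ((Q.measurable_kernel t).enorm.pow_const 2).aemeasurable]
  gcongr
  · exact P.kernel_le t ht
  · exact Q.kernel_le t ht

/-- The bilinear `L²` estimate for a single mode of a product. -/
lemma lintegral_conv_le (hs : 0 ≤ s) (ha : a = 1 ∨ a = -1) (hb : b = 1 ∨ b = -1)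
    (P : IsProfile a s (Icc 0 T) y m F M S) (Q : IsProfile b s (Icc 0 T) z m' G M' S')
    {k : ℤ} (hk : k ≠ 0) :
    ∫⁻ t in Icc 0 T, ‖∑' n, y n t * z (k - n) t‖ₑ ^ 2 ≤ sieveConst T * (M * M') *
      ∑' n, (∫⁻ τ, ‖F n τ‖ₑ ^ 2) * ∫⁻ τ, ‖G (k - n) τ‖ₑ ^ 2 := by
  -- The sieve bound concerns finite sums, with a constant independent of the index set. Exhausting
  -- ℤ by intervals and applying Fatou's lemma gives the full convolution.
  set A : ℕ → Finset ℤ := fun N => Finset.Icc (-(N : ℤ)) N with hA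
  have hAtop : Tendsto A atTop atTop := by
    refine tendsto_atTop_finset_of_monotone (fun i j hij => ?_) fun x => ⟨x.natAbs, ?_⟩
    · exact Finset.Icc_subset_Icc (by simpa using hij) (by simpa using hij)
    · simp only [hA, Finset.mem_Icc]; omega
  set f : ℕ → ℝ → ℝ × ℝ → ℝ≥0∞ := fun N t p => ‖∑ n ∈ A N,
    Complex.exp (Complex.I * freq a b k n * t) * (F n p.1 * G (k - n) p.2)‖ₑ ^ 2 with hf
  have hfm : ∀ N, Measurable (Function.uncurry (f N)) := by
    intro N
    refine (Measurable.enorm (Finset.measurable_fun_sum _ fun n _ => ?_)).pow_const 2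
    refine Measurable.mul ?_ (((P.measurable_density n).comp (by fun_prop)).mul
      ((Q.measurable_density (k - n)).comp (by fun_prop)))
    fun_prop
  have hfm' : ∀ N, Measurable fun t => ∫⁻ p, f N t p ∂(volume.prod volume) :=
    fun N => (hfm N).lintegral_prod_right'
  have h1 : ∀ t ∈ Icc 0 T, ‖∑' n, y n t * z (k - n) t‖ₑ ^ 2 ≤
      liminf (fun N => M * M' * ∫⁻ p, f N t p ∂(volume.prod volume)) atTop := by
    intro t ht
    have h2 : Tendsto (fun N => ‖∑ n ∈ A N, y n t * z (k - n) t‖ₑ ^ 2) atTop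
        (𝓝 (‖∑' n, y n t * z (k - n) t‖ₑ ^ 2)) :=
      ((ENNReal.continuous_pow 2).tendsto _).comp
        ((P.summable_mul hs Q ht k).hasSum.comp hAtop).enorm
    rw [← h2.liminf_eq]
    exact liminf_le_liminf (Eventually.of_forall fun N => P.enorm_sum_sq_le Q ht k (A N))
  have h3 : ∀ N, ∫⁻ t in Icc 0 T, M * M' * ∫⁻ p, f N t p ∂(volume.prod volume) ≤
      sieveConst T * (M * M') *
        ∑' n, (∫⁻ τ, ‖F n τ‖ₑ ^ 2) * ∫⁻ τ, ‖G (k - n) τ‖ₑ ^ 2 := by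
    intro N
    rw [lintegral_const_mul _ (hfm' N), lintegral_lintegral_swap
      (hfm N).aemeasurable, mul_comm (sieveConst T) (M * M'), mul_assoc (M * M')]
    gcongr
    calc _ ≤ ∫⁻ p : ℝ × ℝ, sieveConst T * ∑ n ∈ A N, ‖F n p.1 * G (k - n) p.2‖ₑ ^ 2
          ∂(volume.prod volume) :=
          lintegral_mono fun p => lintegral_expSum_le ha hb hk T (A N) _
      _ = sieveConst T * ∑ n ∈ A N, (∫⁻ τ, ‖F n τ‖ₑ ^ 2) * ∫⁻ τ, ‖G (k - n) τ‖ₑ ^ 2 := by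
          have hm : ∀ n, Measurable fun p : ℝ × ℝ => ‖F n p.1 * G (k - n) p.2‖ₑ ^ 2 := fun n =>
            (((P.measurable_density n).comp measurable_fst).mul
              ((Q.measurable_density (k - n)).comp measurable_snd)).enorm.pow_const 2
          rw [lintegral_const_mul _ (Finset.measurable_fun_sum _ fun n _ => hm n),
            lintegral_finsetSum _ fun n _ => hm n]
          congr 1
          refine Finset.sum_congr rfl fun n _ => ?_
          simp only [enorm_mul, mul_pow]
          exact lintegral_prod_mul ((P.measurable_density n).enorm.pow_const 2).aemeasurable
            ((Q.measurable_density (k - n)).enorm.pow_const 2).aemeasurable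
      _ ≤ _ := by
          gcongr
          exact ENNReal.sum_le_tsum _
  calc _ ≤ ∫⁻ t in Icc 0 T,
        liminf (fun N => M * M' * ∫⁻ p, f N t p ∂(volume.prod volume)) atTop :=
        setLIntegral_mono' measurableSet_Icc h1
    _ ≤ liminf (fun N => ∫⁻ t in Icc 0 T, M * M' * ∫⁻ p, f N t p ∂(volume.prod volume)) atTop :=
        lintegral_liminf_le fun N => (hfm' N).const_mul _
    _ ≤ _ := by
        refine (liminf_le_liminf (Eventually.of_forall h3)).trans (le_of_eq ?_)
        exact liminf_const _

/-- The bilinear estimate in `L²([0,T], H^s)`, for the part of the product of mean zero. -/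
lemma tsum_lintegral_conv_le (hs : 0 ≤ s) (ha : a = 1 ∨ a = -1) (hb : b = 1 ∨ b = -1)
    (P : IsProfile a s (Icc 0 T) y m F M S) (Q : IsProfile b s (Icc 0 T) z m' G M' S') :
    ∑' k, wt s k * ∫⁻ t in Icc 0 T, ‖if k = 0 then 0 else ∑' n, y n t * z (k - n) t‖ₑ ^ 2 ≤
      sieveConst T * wtConst s * ((M * S) * (M' * S')) := by
  calc _ ≤ ∑' k, sieveConst T * (M * M') * (wt s k *
        ∑' n, (∫⁻ τ, ‖F n τ‖ₑ ^ 2) * ∫⁻ τ, ‖G (k - n) τ‖ₑ ^ 2) := by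
        refine ENNReal.tsum_le_tsum fun k => ?_
        by_cases hk : k = 0
        · simp [hk]
        · simp only [hk, if_false]
          rw [mul_left_comm]
          gcongr
          exact P.lintegral_conv_le hs ha hb Q hk
    _ ≤ sieveConst T * (M * M') * (wtConst s * (S * S')) := by
        rw [ENNReal.tsum_mul_left]
        gcongr
        refine (tsum_wt_conv_le hs (fun n => ∫⁻ τ, ‖F n τ‖ₑ ^ 2)
          (fun n => ∫⁻ τ, ‖G n τ‖ₑ ^ 2)).trans ?_
        gcongr
        · exact P.density_le
        · exact Q.density_le
    _ = _ := by ring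

end IsProfile

/-! ### The nonlinearity in L²([0,T], H^s) -/

lemma sq_add_le_two_mul (a b : ℝ≥0∞) : (a + b) ^ 2 ≤ 2 * (a ^ 2 + b ^ 2) := by
  have h := ENNReal.rpow_add_le_mul_rpow_add_rpow a b (p := 2) (by norm_num)
  have e : (2 : ℝ≥0∞) ^ ((2 : ℝ) - 1) = 2 := by norm_num
  rw [e] at h
  simpa only [ENNReal.rpow_two] using h

lemma enorm_add_sq_le (x y : ℂ) :
    ‖x + y‖ₑ ^ 2 ≤ 2 * (‖x‖ₑ ^ 2 + ‖y‖ₑ ^ 2) :=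
  (pow_le_pow_left' (enorm_add_le x y) 2).trans (sq_add_le_two_mul _ _)

lemma enorm_add_four_sq_le (x y z w : ℂ) :
    ‖x + y + z + w‖ₑ ^ 2 ≤ 4 * (‖x‖ₑ ^ 2 + ‖y‖ₑ ^ 2 + ‖z‖ₑ ^ 2 + ‖w‖ₑ ^ 2) := by
  rw [add_assoc (x + y)]
  refine (enorm_add_sq_le _ _).trans ?_
  calc _ ≤ 2 * (2 * (‖x‖ₑ ^ 2 + ‖y‖ₑ ^ 2) + 2 * (‖z‖ₑ ^ 2 + ‖w‖ₑ ^ 2)) := by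
        gcongr <;> exact enorm_add_sq_le _ _
    _ = _ := by ring

/-- The square of the norm of `L²(I, H^s)`, in terms of Fourier coefficients. -/
noncomputable def energy (s : ℝ) (I : Set ℝ) (N : ℤ → ℝ → ℂ) : ℝ≥0∞ :=
  ∑' k, wt s k * ∫⁻ t in I, ‖N k t‖ₑ ^ 2

lemma energy_mono {s : ℝ} {I : Set ℝ} (hI : MeasurableSet I) {N N' : ℤ → ℝ → ℂ}
    (h : ∀ k, ∀ t ∈ I, ‖N k t‖ₑ ≤ ‖N' k t‖ₑ) : energy s I N ≤ energy s I N' := by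
  refine ENNReal.tsum_le_tsum fun k => ?_
  gcongr wt s k * ?_
  exact setLIntegral_mono' hI fun t ht => pow_le_pow_left' (h k t ht) 2

lemma energy_congr {s : ℝ} {I : Set ℝ} (hI : MeasurableSet I) {N N' : ℤ → ℝ → ℂ}
    (h : ∀ k, ∀ t ∈ I, ‖N k t‖ₑ = ‖N' k t‖ₑ) : energy s I N = energy s I N' :=
  le_antisymm (energy_mono hI fun k t ht => (h k t ht).le)
    (energy_mono hI fun k t ht => (h k t ht).ge)

lemma energy_add_le {s : ℝ} {I : Set ℝ} {N N' : ℤ → ℝ → ℂ}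
    (hN : ∀ k, AEMeasurable (N k) (volume.restrict I)) :
    energy s I (fun k t => N k t + N' k t) ≤ 2 * (energy s I N + energy s I N') := by
  rw [energy, energy, energy, ← ENNReal.tsum_add, ← ENNReal.tsum_mul_left]
  refine ENNReal.tsum_le_tsum fun k => ?_
  rw [← mul_add, mul_left_comm]
  gcongr wt s k * ?_
  rw [← lintegral_add_left' ((hN k).enorm.pow_const 2), ← lintegral_const_mul' _ _ (by simp)]
  exact lintegral_mono fun t => enorm_add_sq_le _ _

lemma energy_add_four_le {s : ℝ} {I : Set ℝ} {N₁ N₂ N₃ N₄ : ℤ → ℝ → ℂ}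
    (h₁ : ∀ k, AEMeasurable (N₁ k) (volume.restrict I))
    (h₂ : ∀ k, AEMeasurable (N₂ k) (volume.restrict I))
    (h₃ : ∀ k, AEMeasurable (N₃ k) (volume.restrict I)) :
    energy s I (fun k t => N₁ k t + N₂ k t + N₃ k t + N₄ k t) ≤
      4 * (energy s I N₁ + energy s I N₂ + energy s I N₃ + energy s I N₄) := by
  simp only [energy]
  rw [← ENNReal.tsum_add, ← ENNReal.tsum_add, ← ENNReal.tsum_add, ← ENNReal.tsum_mul_left]
  refine ENNReal.tsum_le_tsum fun k => ?_
  rw [← mul_add, ← mul_add, ← mul_add, mul_left_comm]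
  gcongr wt s k * ?_
  have m₁ := (h₁ k).enorm.pow_const 2
  have m₂ := (h₂ k).enorm.pow_const 2
  have m₃ := (h₃ k).enorm.pow_const 2
  have m₁₂ : AEMeasurable (fun t => ‖N₁ k t‖ₑ ^ 2 + ‖N₂ k t‖ₑ ^ 2) (volume.restrict I) :=
    m₁.add m₂
  have m₁₂₃ : AEMeasurable (fun t => ‖N₁ k t‖ₑ ^ 2 + ‖N₂ k t‖ₑ ^ 2 + ‖N₃ k t‖ₑ ^ 2)
      (volume.restrict I) := m₁₂.add m₃
  rw [← lintegral_add_left' m₁, ← lintegral_add_left' m₁₂, ← lintegral_add_left' m₁₂₃,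
    ← lintegral_const_mul' _ _ (by simp)]
  exact lintegral_mono fun t => enorm_add_four_sq_le _ _ _ _

/-- The Fourier coefficients of a function of time with values in `L²(𝕋)`. -/
noncomputable def modes (w : ℝ → L2Torus) (n : ℤ) (t : ℝ) : ℂ := coeffL n (w t)

/-- The constant in `energy_mulCoeff_le` and `energy_le_of_norm_le`. -/
noncomputable def nlConst (s T : ℝ) : ℝ≥0∞ := 32 * (ENNReal.ofReal T + sieveConst T * wtConst s)

lemma nlConst_lt_top (s T : ℝ) : nlConst s T < ⊤ :=
  ENNReal.mul_lt_top (by simp) (ENNReal.add_lt_top.2 ⟨ENNReal.ofReal_lt_top,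
    ENNReal.mul_lt_top (sieveConst_lt_top T) (wtConst_lt_top s)⟩)

lemma nlConst_mono (s : ℝ) {T T' : ℝ} (hT : 0 ≤ T) (h : T ≤ T') : nlConst s T ≤ nlConst s T' := by
  unfold nlConst sieveConst
  have hC : 0 ≤ schurConst := by
    have : 0 ≤ ∑' j : ℤ, 1 / (1 + (j : ℝ) ^ 2) := tsum_nonneg fun j => by positivity
    unfold schurConst; linarith
  gcongr

section

variable {s T : ℝ} {w₁ w₂ : ℝ → L2Torus} {m m' : ℝ → ℝ → ℂ} {F G : ℤ → ℝ → ℂ}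
  {M S M' S' : ℝ≥0∞}

/-- The product (w₁ + w̄₁)(w₂ + w̄₂) splits into four convolutions, one for each pair of signs. The
constant 16 is the 4 of the four-term square inequality times the four equal bounds. -/
lemma energy_mulCoeff_le (hs : 0 ≤ s)
    (P : IsProfile 1 s (Icc 0 T) (modes w₁) m F M S)
    (Q : IsProfile 1 s (Icc 0 T) (modes w₂) m' G M' S') :
    energy s (Icc 0 T)
      (fun k t => if k = 0 then 0 else mulCoeff (twoRe (w₁ t)) (twoRe (w₂ t)) k) ≤
      16 * (sieveConst T * wtConst s * ((M * S) * (M' * S'))) := by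
  set conv : (ℤ → ℝ → ℂ) → (ℤ → ℝ → ℂ) → ℤ → ℝ → ℂ := fun y z k t =>
    if k = 0 then 0 else ∑' n, y n t * z (k - n) t with hconv
  have h1 : (1 : ℝ) = 1 ∨ (1 : ℝ) = -1 := Or.inl rfl
  have h2 : (-1 : ℝ) = 1 ∨ (-1 : ℝ) = -1 := Or.inr rfl
  set y := modes w₁
  set z := modes w₂
  set y' : ℤ → ℝ → ℂ := fun n t => (starRingEnd ℂ) (y (-n) t) with hy'
  set z' : ℤ → ℝ → ℂ := fun n t => (starRingEnd ℂ) (z (-n) t) with hz'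
  have key : energy s (Icc 0 T)
      (fun k t => if k = 0 then 0 else mulCoeff (twoRe (w₁ t)) (twoRe (w₂ t)) k) =
      energy s (Icc 0 T) (fun k t => conv y z k t + conv y z' k t + conv y' z k t
        + conv y' z' k t) := by
    refine energy_congr measurableSet_Icc fun k t ht => ?_
    simp only [hconv]
    split_ifs with hk
    · simp
    congr 1
    refine (hasSum_mulCoeff _ _ k).unique ?_
    have e1 := (P.summable_mul hs Q ht k).hasSum
    have e2 := (P.summable_mul hs Q.conj ht k).hasSum
    have e3 := (P.conj.summable_mul hs Q ht k).hasSum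
    have e4 := (P.conj.summable_mul hs Q.conj ht k).hasSum
    refine (((e1.add e2).add e3).add e4).congr_fun ?_
    intro n
    simp only [coeffL_twoRe, y, z, modes]
    ring
  have meas : ∀ {a b : ℝ} {y z : ℤ → ℝ → ℂ} {m m' : ℝ → ℝ → ℂ} {F G : ℤ → ℝ → ℂ}
      {M S M' S' : ℝ≥0∞}, IsProfile a s (Icc 0 T) y m F M S →
      IsProfile b s (Icc 0 T) z m' G M' S' →
      ∀ k, AEMeasurable (conv y z k) (volume.restrict (Icc 0 T)) := by
    intro a b y z m m' F G M S M' S' P Q k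
    simp only [hconv]
    split_ifs
    · exact aemeasurable_const
    · exact P.aemeasurable_tsum hs Q measurableSet_Icc k
  rw [key]
  refine (energy_add_four_le (meas P Q) (meas P Q.conj) (meas P.conj Q)).trans ?_
  have b1 := P.tsum_lintegral_conv_le hs h1 h1 Q
  have b2 := P.tsum_lintegral_conv_le hs h1 h2 Q.conj
  have b3 := P.conj.tsum_lintegral_conv_le hs h2 h1 Q
  have b4 := P.conj.tsum_lintegral_conv_le hs h2 h2 Q.conj
  refine (mul_le_mul_right (add_le_add (add_le_add (add_le_add b1 b2) b3) b4) 4).trans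
    (le_of_eq ?_)
  ring

/-- The majorised `N` is left free so that the estimate applies to the nonlinearity, to differences,
and to differences with a weight in time. The bound is linear in M S, the size of the first factor;
smallness of its kernel yields contraction and uniqueness. -/
lemma energy_le_of_norm_le (hs : 0 ≤ s) (P : IsProfile 1 s (Icc 0 T) (modes w₁) m F M S)
    (Q : IsProfile 1 s (Icc 0 T) (modes w₂) m' G M' S') {N : ℤ → ℝ → ℂ}
    (hN : ∀ k, ∀ t ∈ Icc 0 T, ‖N k t‖ ≤ ‖coeffL k (twoRe (w₁ t))‖ +
      (if k = 0 then 0 else ‖mulCoeff (twoRe (w₁ t)) (twoRe (w₂ t)) k‖)) :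
    energy s (Icc 0 T) N ≤ nlConst s T * ((M * S) * (1 + M' * S')) := by
  set A : ℤ → ℝ → ℂ := fun k t => (‖coeffL k (twoRe (w₁ t))‖ : ℂ) with hA
  set B : ℤ → ℝ → ℂ := fun k t => (‖if k = 0 then 0 else
    mulCoeff (twoRe (w₁ t)) (twoRe (w₂ t)) k‖ : ℂ) with hB
  have hAe : ∀ k t, ‖A k t‖ₑ = ‖coeffL k (twoRe (w₁ t))‖ₑ := fun k t => by
    simp only [hA]; rw [← ofReal_norm, Complex.norm_real, norm_norm, ofReal_norm]
  have hBe : ∀ k t, ‖B k t‖ₑ = ‖if k = 0 then 0 else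
      mulCoeff (twoRe (w₁ t)) (twoRe (w₂ t)) k‖ₑ := fun k t => by
    simp only [hB]; rw [← ofReal_norm, Complex.norm_real, norm_norm, ofReal_norm]
  have hAm : ∀ k, AEMeasurable (A k) (volume.restrict (Icc 0 T)) := by
    intro k
    have h := (P.aemeasurable k).add (P.conj.aemeasurable k)
    refine Complex.measurable_ofReal.comp_aemeasurable (h.norm.congr ?_)
    refine Eventually.of_forall fun t => ?_
    simp only [coeffL_twoRe, modes, Pi.add_apply]
  have hAE : energy s (Icc 0 T) A ≤ 4 * (ENNReal.ofReal T * (M * S)) := by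
    calc _ = energy s (Icc 0 T) (fun k t => modes w₁ k t + (starRingEnd ℂ) (modes w₁ (-k) t)) := by
          refine energy_congr measurableSet_Icc fun k t _ => ?_
          rw [hAe, coeffL_twoRe]; rfl
      _ ≤ 2 * (energy s (Icc 0 T) (modes w₁) +
          energy s (Icc 0 T) (fun k t => (starRingEnd ℂ) (modes w₁ (-k) t))) :=
          energy_add_le P.aemeasurable
      _ ≤ 2 * (ENNReal.ofReal T * (M * S) + ENNReal.ofReal T * (M * S)) := by
          have h1 := P.tsum_lintegral_le measurableSet_Icc
          have h2 := P.conj.tsum_lintegral_le measurableSet_Icc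
          rw [Real.volume_Icc, sub_zero] at h1 h2
          gcongr <;> assumption
      _ = _ := by ring
  have hBE : energy s (Icc 0 T) B ≤ 16 * (sieveConst T * wtConst s * ((M * S) * (M' * S'))) := by
    refine le_trans (le_of_eq ?_) (energy_mulCoeff_le hs P Q)
    exact energy_congr measurableSet_Icc fun k t _ => hBe k t
  calc _ ≤ energy s (Icc 0 T) (fun k t => A k t + B k t) := by
        refine energy_mono measurableSet_Icc fun k t ht => ?_
        rw [← ofReal_norm, ← ofReal_norm]
        refine ENNReal.ofReal_le_ofReal ((hN k t ht).trans (le_of_eq ?_))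
        simp only [hA, hB]
        rw [← Complex.ofReal_add, Complex.norm_real, Real.norm_of_nonneg (by positivity)]
        split_ifs <;> simp
    _ ≤ 2 * (energy s (Icc 0 T) A + energy s (Icc 0 T) B) := energy_add_le hAm
    _ ≤ 2 * (4 * (ENNReal.ofReal T * (M * S)) +
        16 * (sieveConst T * wtConst s * ((M * S) * (M' * S')))) := by gcongr
    _ ≤ 32 * (ENNReal.ofReal T * ((M * S) * (1 + M' * S'))) +
        32 * (sieveConst T * wtConst s * ((M * S) * (1 + M' * S'))) := by
        generalize M * S = X
        generalize M' * S' = Y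
        have h1 : X ≤ X * (1 + Y) := le_mul_of_one_le_right zero_le (le_add_right le_rfl)
        have h2 : X * Y ≤ X * (1 + Y) := by gcongr; exact le_add_self
        calc _ = 8 * (ENNReal.ofReal T * X) + 32 * (sieveConst T * wtConst s * (X * Y)) := by ring
          _ ≤ _ := by gcongr; norm_num
    _ = _ := by rw [nlConst]; ring

lemma energy_nonlin_lt_top (hs : 0 ≤ s) (P : IsProfile 1 s (Icc 0 T) (modes w₁) m F M S) :
    energy s (Icc 0 T) (fun k t => nonlin (w₁ t) k) < ⊤ := by
  refine (energy_le_of_norm_le hs P P fun k t _ => norm_nonlin_le _ _).trans_lt ?_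
  have h := ENNReal.mul_lt_top P.kernel_lt_top P.density_lt_top
  exact ENNReal.mul_lt_top (nlConst_lt_top s T)
    (ENNReal.mul_lt_top h (ENNReal.add_lt_top.2 ⟨ENNReal.one_lt_top, h⟩))

end

/-! ### Sobolev norms and continuity in time -/

lemma sobolevENorm_eq (s : ℝ) (f : L2Torus) :
    sobolevENorm s f = (∑' k, wt s k * ‖coeffL k f‖ₑ ^ 2) ^ (1 / 2 : ℝ) := by
  simp only [sobolevENorm, mul_pow, wt, coeffL_apply]

lemma sobolevENorm_lt_top_iff (s : ℝ) (f : L2Torus) :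
    sobolevENorm s f < ⊤ ↔ ∑' k, wt s k * ‖coeffL k f‖ₑ ^ 2 < ⊤ := by
  rw [sobolevENorm_eq, ENNReal.rpow_lt_top_iff_of_pos (by norm_num)]

lemma enorm_le_sobolevENorm {s : ℝ} (hs : 0 ≤ s) (f : L2Torus) : ‖f‖ₑ ≤ sobolevENorm s f := by
  have h : ‖f‖ₑ = (‖f‖ₑ ^ 2) ^ (1 / 2 : ℝ) := by
    rw [← ENNReal.rpow_natCast_mul]; norm_num
  rw [h, enorm_sq_eq_tsum, sobolevENorm_eq]
  gcongr with k
  exact le_mul_of_one_le_left zero_le (one_le_wt hs k)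

/-- Dominated convergence for the sum over modes: each mode is continuous, and
`IsProfile.enorm_sq_le` gives a summable majorant independent of time. -/
lemma IsProfile.continuousIntoSobolev {a s : ℝ} {I : Set ℝ} {w : ℝ → L2Torus}
    {m : ℝ → ℝ → ℂ} {F : ℤ → ℝ → ℂ} {M S : ℝ≥0∞} (P : IsProfile a s I (modes w) m F M S)
    (hw : ∀ k, ContinuousOn (modes w k) I) : ContinuousIntoSobolev s I w := by
  intro t ht
  refine ⟨(sobolevENorm_lt_top_iff s _).2 ((P.tsum_wt_le ht).trans_lt
    (ENNReal.mul_lt_top P.kernel_lt_top P.density_lt_top)), ?_⟩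
  have h : Tendsto (fun r => ∑' k, wt s k * ‖coeffL k (w r - w t)‖ₑ ^ 2) (𝓝[I] t) (𝓝 0) := by
    have h1 : Tendsto (fun r => ∫⁻ k : ℤ, wt s k * ‖coeffL k (w r - w t)‖ₑ ^ 2 ∂Measure.count)
        (𝓝[I] t) (𝓝 (∫⁻ _ : ℤ, 0 ∂Measure.count)) := by
      refine tendsto_lintegral_filter_of_dominated_convergence
        (fun k => 4 * (M * (wt s k * ∫⁻ τ, ‖F k τ‖ₑ ^ 2))) ?_ ?_ ?_ ?_
      · exact Eventually.of_forall fun r => measurable_of_countable _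
      · filter_upwards [self_mem_nhdsWithin] with r hr
        refine Eventually.of_forall fun k => ?_
        rw [map_sub, sub_eq_add_neg]
        calc _ ≤ wt s k * (2 * (M * (∫⁻ τ, ‖F k τ‖ₑ ^ 2) + M * ∫⁻ τ, ‖F k τ‖ₑ ^ 2)) := by
              gcongr
              refine (enorm_add_sq_le _ _).trans ?_
              rw [enorm_neg]
              gcongr
              · exact P.enorm_sq_le hr k
              · exact P.enorm_sq_le ht k
          _ = _ := by ring
      · rw [lintegral_count, ENNReal.tsum_mul_left, ENNReal.tsum_mul_left]
        exact (ENNReal.mul_lt_top (by simp) (ENNReal.mul_lt_top P.kernel_lt_top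
          (P.density_le.trans_lt P.density_lt_top))).ne
      · refine Eventually.of_forall fun k => ?_
        have h2 : Tendsto (fun r => ‖modes w k r - modes w k t‖ₑ ^ 2) (𝓝[I] t)
            (𝓝 (‖modes w k t - modes w k t‖ₑ ^ 2)) :=
          ((ENNReal.continuous_pow 2).tendsto _).comp ((hw k t ht).sub_const _).enorm
        have h3 := ENNReal.Tendsto.const_mul h2 (Or.inr (wt_lt_top s k).ne)
        simpa [modes] using h3
    simpa [lintegral_count] using h1
  have h2 := (ENNReal.continuous_rpow_const (y := (1 / 2 : ℝ))).tendsto 0 |>.comp h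
  simp only [Function.comp_def, ← sobolevENorm_eq] at h2
  simpa using h2

lemma ContinuousIntoSobolev.continuousOn {s : ℝ} (hs : 0 ≤ s) {I : Set ℝ} {w : ℝ → L2Torus}
    (h : ContinuousIntoSobolev s I w) : ContinuousOn w I := by
  intro t ht
  rw [ContinuousWithinAt, tendsto_iff_edist_tendsto_0]
  refine tendsto_of_tendsto_of_tendsto_of_le_of_le tendsto_const_nhds (h t ht).2
    (fun _ => zero_le) fun r => ?_
  rw [edist_eq_enorm_sub]
  exact enorm_le_sobolevENorm hs _

lemma IsProfile.mono {a s : ℝ} {I J : Set ℝ} {y : ℤ → ℝ → ℂ} {m : ℝ → ℝ → ℂ} {F : ℤ → ℝ → ℂ}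
    {M S : ℝ≥0∞} (P : IsProfile a s I y m F M S) (h : J ⊆ I) : IsProfile a s J y m F M S where
  aemeasurable n := (P.aemeasurable n).mono_measure (Measure.restrict_mono h le_rfl)
  measurable_kernel := P.measurable_kernel
  measurable_density := P.measurable_density
  kernel_le t ht := P.kernel_le t (h ht)
  density_le := P.density_le
  kernel_lt_top := P.kernel_lt_top
  density_lt_top := P.density_lt_top
  eq t ht := P.eq t (h ht)

/-! ### Bourgain functions as superpositions of free waves -/

lemma continuous_jap : Continuous jap := by unfold jap; fun_prop

lemma measurable_jap_rpow (b : ℝ) : Measurable fun x => jap x ^ b :=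
  continuous_jap.measurable.pow_const b

/-- This is where b > 1/2 enters. -/
lemma lintegral_jap_lt_top {b : ℝ} (hb : 1 / 2 < b) :
    ∫⁻ τ : ℝ, ENNReal.ofReal (jap τ ^ (-b)) ^ 2 < ⊤ := by
  have h := integrable_rpow_neg_one_add_norm_sq (E := ℝ) (μ := volume) (r := 2 * b)
    (by simp; linarith)
  refine lt_of_le_of_lt (le_of_eq ?_) h.lintegral_lt_top
  refine lintegral_congr fun τ => ?_
  rw [← ENNReal.ofReal_pow (Real.rpow_nonneg (jap_pos _).le _), jap, Real.sqrt_eq_rpow,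
    ← Real.rpow_mul (by positivity), ← Real.rpow_mul_natCast (by positivity)]
  congr 1
  rw [Real.norm_eq_abs, sq_abs]
  congr 1
  push_cast
  ring

lemma quasiMeasurePreserving_div {c : ℝ} (hc : c ≠ 0) :
    Measure.QuasiMeasurePreserving (fun x : ℝ => x / c) volume volume := by
  refine ⟨by fun_prop, ?_⟩
  have : (fun x : ℝ => x / c) = fun x => c⁻¹ * x := by ext x; rw [div_eq_inv_mul]
  rw [this, Real.map_volume_mul_left (inv_ne_zero hc)]
  exact Measure.smul_absolutelyContinuous

/-- The `k`-th mode of the space-time Fourier transform. -/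
noncomputable def fourierMode (v : L2SpaceTime) (k : ℤ) : L2Line :=
  (coeffL k).compLp (𝓕 v : L2SpaceTime)

lemma fourierMode_eq (v : L2SpaceTime) (k : ℤ) :
    fourierMode v k = (𝓕 ((coeffL k).compLp v : L2Line) : L2Line) :=
  compLp_fourier (coeffL k) v

lemma measurable_fourierMode (v : L2SpaceTime) (k : ℤ) :
    Measurable (fourierMode v k : ℝ → ℂ) := (Lp.stronglyMeasurable _).measurable

lemma spaceTimeFourier_ae_eq (v : L2SpaceTime) (k : ℤ) :
    (fun σ => spaceTimeFourier v σ k) =ᵐ[volume]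
      fun σ => (fourierMode v k : ℝ → ℂ) (σ / (2 * Real.pi)) := by
  have h := (coeffL k).coeFn_compLp (𝓕 v : L2SpaceTime)
  filter_upwards [(quasiMeasurePreserving_div (c := 2 * Real.pi) Real.two_pi_pos.ne').ae h]
    with σ hσ
  rw [fourierMode, hσ, spaceTimeFourier, coeffL_apply]

/-- The substitution σ = τ + √(k⁴+1) makes the modulation weight independent of k, so that one
kernel can serve all modes. -/
lemma bourgainENorm_eq (s b : ℝ) (v : L2SpaceTime) :
    bourgainENorm s b v = (∑' k, wt s k * ∫⁻ τ : ℝ,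
      ‖((jap τ ^ b : ℝ) : ℂ) *
        (fourierMode v k : ℝ → ℂ) ((τ + disp k) / (2 * Real.pi))‖ₑ ^ 2) ^ (1 / 2 : ℝ) := by
  rw [bourgainENorm]
  congr 1
  refine tsum_congr fun k => ?_
  rw [wt, ← lintegral_const_mul' _ _ (ENNReal.pow_lt_top ENNReal.ofReal_lt_top).ne]
  conv_rhs => rw [← lintegral_sub_right_eq_self _ (disp k)]
  refine lintegral_congr_ae ?_
  filter_upwards [spaceTimeFourier_ae_eq v k] with σ hσ
  have h0 : 0 ≤ jap k ^ s := Real.rpow_nonneg (jap_pos _).le _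
  have h1 : 0 ≤ jap (σ - disp k) ^ b := Real.rpow_nonneg (jap_pos _).le _
  rw [hσ, sub_add_cancel, ← mul_pow, enorm_mul, ENNReal.ofReal_mul h0, mul_assoc]
  congr 3
  rw [← ofReal_norm, Complex.norm_real, Real.norm_of_nonneg h1]

/-- Functions in `X^{s,b}`, `b > 1/2`, are superpositions of free waves with data in `H^s`. -/
lemma exists_profile_of_bourgainENorm {s b : ℝ} (hs : 0 ≤ s) (hb : 1 / 2 < b) (v : L2SpaceTime)
    (hv : bourgainENorm s b v < ⊤) :
    ∃ w : ℝ → L2Torus, w =ᵐ[volume] v ∧ (∀ k, Continuous (modes w k)) ∧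
      ∃ m F M S, IsProfile 1 s univ (modes w) m F M S := by
  have hpi : (0 : ℝ) < 2 * Real.pi := Real.two_pi_pos
  set H : ℤ → ℝ → ℂ := fun k => (fourierMode v k : ℝ → ℂ) with hH
  have hHm : ∀ k, Measurable (H k) := measurable_fourierMode v
  set F : ℤ → ℝ → ℂ := fun k τ => ((jap τ ^ b : ℝ) : ℂ) * H k ((τ + disp k) / (2 * Real.pi))
    with hF
  have hFm : ∀ k, Measurable (F k) := fun k =>
    (Complex.measurable_ofReal.comp (measurable_jap_rpow b)).mul ((hHm k).comp (by fun_prop))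
  set S : ℝ≥0∞ := ∑' k, wt s k * ∫⁻ τ, ‖F k τ‖ₑ ^ 2 with hS
  have hSt : S < ⊤ := by
    rw [bourgainENorm_eq, ENNReal.rpow_lt_top_iff_of_pos (by norm_num)] at hv
    exact hv
  -- The transform of mode k is split as ⟨τ⟩^{-b} · F_k(τ): the first factor is in L² and common to
  -- all modes, the second carries the Bourgain norm.
  set j : ℝ → ℂ := fun τ => ((jap τ ^ (-b) : ℝ) : ℂ) with hj
  have hjm : Measurable j := Complex.measurable_ofReal.comp (measurable_jap_rpow (-b))
  have hj2 : ∫⁻ τ, ‖j τ‖ₑ ^ 2 < ⊤ := by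
    refine lt_of_le_of_lt (le_of_eq (lintegral_congr fun τ => ?_)) (lintegral_jap_lt_top hb)
    simp only [hj]
    rw [← ofReal_norm, Complex.norm_real, Real.norm_of_nonneg (Real.rpow_nonneg (jap_pos _).le _)]
  have hjF : ∀ k τ, j τ * F k τ = H k ((τ + disp k) / (2 * Real.pi)) := by
    intro k τ
    simp only [hj, hF]
    rw [← mul_assoc, ← Complex.ofReal_mul, ← Real.rpow_add (jap_pos _)]
    simp
  have hF2 : ∀ k, ∫⁻ τ, ‖F k τ‖ₑ ^ 2 < ⊤ := by
    intro k
    have h := (ENNReal.le_tsum k).trans_lt hSt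
    by_contra h'
    rw [not_lt, top_le_iff] at h'
    rw [h', ENNReal.mul_top (wt_ne_zero s k)] at h
    exact lt_irrefl _ h
  -- As a product of two L² functions each mode of the transform is integrable. Its inverse
  -- transform is therefore a genuine integral and provides the continuous representative.
  have hHi : ∀ k, Integrable (H k) := by
    intro k
    have h1 : Integrable fun τ => H k ((τ + disp k) / (2 * Real.pi)) := by
      simp_rw [← hjF]
      exact integrable_mul_of_lintegral_sq hjm.aemeasurable (hFm k).aemeasurable hj2 (hF2 k)
    have h2 := h1.comp_sub_right (disp k)
    simp only [sub_add_cancel] at h2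
    exact (integrable_comp_div_iff (H k) hpi.ne').1 h2
  set Y : ℤ → ℝ → ℂ := fun k => 𝓕⁻ (H k) with hY
  have hYc : ∀ k, Continuous (Y k) := fun k =>
    VectorFourier.fourierIntegral_continuous Real.continuous_fourierChar
      (by exact (continuous_inner (𝕜 := ℝ) (E := ℝ)).neg) (hHi k)
  -- The factor (2π)⁻¹ is the Jacobian of ξ = σ/2π.
  set m : ℝ → ℝ → ℂ := fun t τ =>
    ((2 * Real.pi)⁻¹ : ℝ) * Complex.exp (Complex.I * t * τ) * j τ with hm
  have hmm : ∀ t, Measurable (m t) := fun t => by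
    refine Measurable.mul ?_ hjm
    fun_prop
  have hYeq : ∀ t k, Y k t = Complex.exp (Complex.I * (1 * disp k : ℝ) * t) *
      ∫ τ, m t τ * F k τ := by
    intro t k
    have h1 : Y k t = ∫ ξ : ℝ, Complex.exp (2 * Real.pi * Complex.I * ξ * t) * H k ξ := by
      simp only [hY]
      rw [Real.fourierInv_eq']
      refine integral_congr_ae (Eventually.of_forall fun ξ => ?_)
      simp only [smul_eq_mul]
      congr 2
      simp only [RCLike.inner_apply, conj_trivial]
      push_cast
      ring
    have h2 : ∀ τ, m t τ * F k τ = ((2 * Real.pi)⁻¹ : ℝ) • (Complex.exp (Complex.I * t * τ) *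
        H k ((τ + disp k) / (2 * Real.pi))) := by
      intro τ
      simp only [hm]
      rw [mul_assoc, hjF, Complex.real_smul, mul_assoc]
    simp_rw [h2]
    rw [integral_smul, ← integral_sub_right_eq_self _ (disp k), ← integral_smul,
      ← integral_const_mul]
    simp only [sub_add_cancel]
    rw [h1]
    have h3 := Measure.integral_comp_div
      (fun ξ : ℝ => Complex.exp (2 * Real.pi * Complex.I * ξ * t) * H k ξ)
      (2 * Real.pi)
    rw [abs_of_pos hpi] at h3
    rw [eq_comm, ← eq_inv_smul_iff₀ hpi.ne'] at h3
    rw [h3, ← integral_smul]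
    refine integral_congr_ae (Eventually.of_forall fun σ => ?_)
    simp only [Complex.real_smul]
    have h4 : Complex.exp (2 * Real.pi * Complex.I * (σ / (2 * Real.pi) : ℝ) * t) =
        Complex.exp (Complex.I * (1 * disp k : ℝ) * t) *
          Complex.exp (Complex.I * t * (σ - disp k : ℝ)) := by
      rw [← Complex.exp_add]
      congr 1
      have : (Real.pi : ℂ) ≠ 0 := by exact_mod_cast Real.pi_ne_zero
      push_cast
      field_simp
      ring
    rw [h4]; ring
  set M : ℝ≥0∞ := ‖((2 * Real.pi)⁻¹ : ℝ)‖ₑ ^ 2 * ∫⁻ τ, ‖j τ‖ₑ ^ 2 with hM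
  have P : IsProfile 1 s univ Y m F M S :=
    { aemeasurable := fun n => (hYc n).aemeasurable
      measurable_kernel := hmm
      measurable_density := hFm
      kernel_le := by
        intro t _
        rw [hM, ← lintegral_const_mul' _ _ (ENNReal.pow_lt_top enorm_lt_top).ne]
        refine le_of_eq (lintegral_congr fun τ => ?_)
        have : ‖Complex.exp (Complex.I * t * τ)‖ₑ = 1 := by
          rw [← ofReal_norm, Complex.norm_exp]; simp
        simp only [hm]
        rw [enorm_mul, enorm_mul, this, mul_one, mul_pow]
        congr 2
        rw [← ofReal_norm, Complex.norm_real, ofReal_norm]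
      density_le := le_rfl
      kernel_lt_top := ENNReal.mul_lt_top (ENNReal.pow_lt_top enorm_lt_top) hj2
      density_lt_top := hSt
      eq := fun t _ n => hYeq t n }
  have hmodes : modes (fun t => ofCoeff fun k => Y k t) = Y := by
    ext k t
    refine coeffL_ofCoeff (memLp_two_of_tsum ?_) k
    refine (ENNReal.tsum_le_tsum fun n => ?_).trans_lt
      ((P.tsum_wt_le (mem_univ t)).trans_lt (ENNReal.mul_lt_top P.kernel_lt_top hSt))
    exact le_mul_of_one_le_left zero_le (one_le_wt hs n)
  refine ⟨fun t => ofCoeff fun k => Y k t, ?_, ?_, m, F, M, S, ?_⟩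
  · have h1 : ∀ k, (fun t => coeffL k (v t)) =ᵐ[volume] Y k := by
      intro k
      have e1 : ((coeffL k).compLp v : L2Line) = 𝓕⁻ (fourierMode v k : L2Line) := by
        rw [fourierMode_eq]; exact (FourierTransform.fourierInv_fourier_eq _).symm
      have e2 := coeFn_fourierInv_of_integrable (fourierMode v k) (hHi k)
      rw [← e1] at e2
      filter_upwards [(coeffL k).coeFn_compLp v, e2] with t h2 h3
      rw [← h2, h3]
    filter_upwards [ae_all_iff.2 h1] with t ht
    refine ext_coeffL fun k => ?_
    rw [ht k]
    exact congrFun (congrFun hmodes k) t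
  · rw [hmodes]; exact hYc
  · rw [hmodes]; exact P

/-! ### Strong solutions and Duhamel's formula -/

lemma lintegral_exp_neg_mul_sub {a : ℝ} (ha : 0 < a) (t : ℝ) :
    ∫⁻ τ in Iio t, ENNReal.ofReal (Real.exp (-(a * (t - τ)))) = ENNReal.ofReal (1 / a) := by
  have h1 : IntegrableOn (fun x : ℝ => Real.exp (-a * x)) (Ioi 0) := exp_neg_integrableOn_Ioi 0 ha
  have h2 : ∫ x in Ioi (0 : ℝ), Real.exp (-a * x) = 1 / a := by
    have := integral_exp_mul_Ioi (a := -a) (by linarith) 0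
    rw [this]; simp
  rw [← h2, ofReal_integral_eq_lintegral_ofReal h1
      (Eventually.of_forall fun _ => (Real.exp_pos _).le),
    ← lintegral_indicator measurableSet_Iio, ← lintegral_indicator measurableSet_Ioi,
    ← lintegral_sub_left_eq_self _ t]
  refine lintegral_congr fun x => ?_
  simp only [indicator, mem_Iio, mem_Ioi, sub_lt_self_iff, sub_sub_cancel, neg_mul]

lemma IsSolution.continuousOn_modes {T : ℝ} {u₀ : L2Torus} {w : ℝ → L2Torus}
    (h : IsSolution T u₀ w) (k : ℤ) : ContinuousOn (modes w k) (Icc 0 T) := by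
  have : modes w k = fun r => fourierCoeff (w r : Torus → ℂ) k := by
    ext r; exact coeffL_apply _ _
  rw [this]
  exact fun t ht => (h.equation k t ht).continuousWithinAt

lemma exists_rep_of_memBourgain {s b T : ℝ} (hs : 0 ≤ s) (hb : 1 / 2 < b) {u : ℝ → L2Torus}
    (hu : MemBourgain s b T u) :
    ∃ w : ℝ → L2Torus, w =ᵐ[volume.restrict (Icc 0 T)] u ∧ (∀ k, Continuous (modes w k)) ∧
      ∃ m F M S, IsProfile 1 s (Icc 0 T) (modes w) m F M S := by
  rw [MemBourgain, bourgainENormOn, iInf_lt_iff] at hu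
  obtain ⟨⟨v, hvu⟩, hv⟩ := hu
  obtain ⟨w, hw, hc, m, F, M, S, P⟩ := exists_profile_of_bourgainENorm hs hb v hv
  exact ⟨w, EventuallyEq.trans (ae_restrict_of_ae hw) hvu, hc, m, F, M, S, P.mono (subset_univ _)⟩

/-- Membership in X^{s,b}(T) determines `u` only almost everywhere. The equation makes each mode of
`u` continuous, so `u` agrees with the continuous representative at every time. -/
lemma IsSolution.exists_profile {s b T : ℝ} (hs : 0 ≤ s) (hb : 1 / 2 < b) (hT : 0 < T)
    {u₀ : L2Torus} {u : ℝ → L2Torus} (h : IsSolution T u₀ u) (hu : MemBourgain s b T u) :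
    ∃ m F M S, IsProfile 1 s (Icc 0 T) (modes u) m F M S := by
  obtain ⟨w, hw, hc, m, F, M, S, P⟩ := exists_rep_of_memBourgain hs hb hu
  have heq : EqOn w u (Icc 0 T) := by
    have h1 : ∀ k, EqOn (modes w k) (modes u k) (Icc 0 T) := by
      intro k
      refine Measure.eqOn_Icc_of_ae_eq volume hT.ne ?_ (hc k).continuousOn (h.continuousOn_modes k)
      filter_upwards [hw] with t ht
      rw [modes, modes, ht]
    intro t ht
    exact ext_coeffL fun k => h1 k ht
  refine ⟨m, F, M, S, ?_⟩
  exact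
    { aemeasurable := fun n => (h.continuousOn_modes n).aemeasurable measurableSet_Icc
      measurable_kernel := P.measurable_kernel
      measurable_density := P.measurable_density
      kernel_le := P.kernel_le
      density_le := P.density_le
      kernel_lt_top := P.kernel_lt_top
      density_lt_top := P.density_lt_top
      eq := fun t ht n => by
        rw [← P.eq t ht n, modes, modes, heq ht] }

/-- Solutions, continuous in `L²`, with nonlinearity in `L²([0,T], H^s)`. -/
structure IsStrongSolution (s T : ℝ) (u₀ : L2Torus) (w : ℝ → L2Torus) : Prop where
  isSolution : IsSolution T u₀ w
  continuousOn : ContinuousOn w (Icc 0 T)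
  energy_lt_top : energy s (Icc 0 T) (fun k t => nonlin (w t) k) < ⊤

/-- The exponent b disappears here: the bilinear estimate turns membership in X^{s,b}(T) into an L²
bound for the nonlinearity. -/
lemma IsSolution.isStrongSolution {s b T : ℝ} (hs : 0 ≤ s) (hb : 1 / 2 < b) (hT : 0 < T)
    {u₀ : L2Torus} {u : ℝ → L2Torus} (h : IsSolution T u₀ u) (hu : MemBourgain s b T u) :
    IsStrongSolution s T u₀ u ∧ ContinuousIntoSobolev s (Icc 0 T) u := by
  obtain ⟨m, F, M, S, P⟩ := h.exists_profile hs hb hT hu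
  have hc := P.continuousIntoSobolev h.continuousOn_modes
  exact ⟨⟨h, hc.continuousOn hs, energy_nonlin_lt_top hs P⟩, hc⟩

/-- The time derivative of the modes, in the interaction picture. -/
noncomputable def forcing (w : ℝ → L2Torus) (k : ℤ) (t : ℝ) : ℂ :=
  Complex.exp (-(Complex.I * (1 * disp k : ℝ) * t)) * nonlin (w t) k

lemma norm_exp_I_mul (x t : ℝ) : ‖Complex.exp (Complex.I * x * t)‖ = 1 := by
  rw [Complex.norm_exp]; simp

lemma enorm_forcing (w : ℝ → L2Torus) (k : ℤ) (t : ℝ) : ‖forcing w k t‖ₑ = ‖nonlin (w t) k‖ₑ := by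
  have h : ‖Complex.exp (-(Complex.I * (1 * disp k : ℝ) * t))‖ = 1 := by
    rw [Complex.norm_exp]; simp
  rw [forcing, enorm_mul, ← ofReal_norm, h, ENNReal.ofReal_one, one_mul]

namespace IsStrongSolution

variable {s T : ℝ} {u₀ : L2Torus} {w : ℝ → L2Torus}

lemma continuousOn_forcing (h : IsStrongSolution s T u₀ w) (k : ℤ) :
    ContinuousOn (forcing w k) (Icc 0 T) := by
  have h1 : ContinuousOn (fun t => nonlin (w t) k) (Icc 0 T) :=
    (continuous_nonlin k).comp_continuousOn h.continuousOn
  exact ContinuousOn.mul (by fun_prop) h1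

lemma integrableOn_forcing (h : IsStrongSolution s T u₀ w) (k : ℤ) :
    IntegrableOn (forcing w k) (Icc 0 T) :=
  (h.continuousOn_forcing k).integrableOn_compact isCompact_Icc

lemma hasDerivWithinAt (h : IsStrongSolution s T u₀ w) (k : ℤ) {t : ℝ} (ht : t ∈ Icc 0 T) :
    HasDerivWithinAt (fun r : ℝ => Complex.exp (-(Complex.I * (1 * disp k : ℝ) * r)) * modes w k r)
      (forcing w k t) (Icc 0 T) t := by
  have h1 := h.isSolution.equation k t ht
  rw [rhsCoeff_eq] at h1
  simp only [← coeffL_apply] at h1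
  have h2 : HasDerivWithinAt (fun r : ℝ => Complex.exp (-(Complex.I * (1 * disp k : ℝ) * r)))
      (Complex.exp (-(Complex.I * (1 * disp k : ℝ) * t)) * -(Complex.I * (1 * disp k : ℝ) * 1))
      (Icc 0 T) t :=
    ((((hasDerivAt_id t).ofReal_comp.const_mul
      (Complex.I * (1 * disp k : ℝ))).neg).cexp).hasDerivWithinAt
  refine (h2.mul h1).congr_deriv ?_
  rw [forcing]
  push_cast
  ring

lemma duhamel (h : IsStrongSolution s T u₀ w) (k : ℤ) {t : ℝ} (ht : t ∈ Icc 0 T) :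
    modes w k t = Complex.exp (Complex.I * (1 * disp k : ℝ) * t) *
      (coeffL k u₀ + ∫ τ in Ico 0 t, forcing w k τ) := by
  have hsub : Icc 0 t ⊆ Icc 0 T := Icc_subset_Icc_right ht.2
  have hd : ∀ x ∈ Icc 0 T, HasDerivWithinAt (fun r : ℝ =>
      Complex.exp (-(Complex.I * (1 * disp k : ℝ) * r)) * modes w k r) (forcing w k x)
        (Icc 0 T) x :=
    fun x hx => h.hasDerivWithinAt k hx
  have h1 := intervalIntegral.integral_eq_sub_of_hasDeriv_right_of_le (a := 0) (b := t)
    (f := fun r : ℝ => Complex.exp (-(Complex.I * (1 * disp k : ℝ) * r)) * modes w k r)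
    (f' := forcing w k) ht.1 (fun x hx => ((hd x (hsub hx)).continuousWithinAt).mono hsub)
    (fun x hx => ((hd x (hsub (Ioo_subset_Icc_self hx))).hasDerivAt
      (Icc_mem_nhds hx.1 (hx.2.trans_le ht.2))).hasDerivWithinAt)
    ((intervalIntegrable_iff_integrableOn_Icc_of_le ht.1).2
      ((h.integrableOn_forcing k).mono_set hsub))
  rw [intervalIntegral.integral_of_le ht.1, integral_Ioc_eq_integral_Ioo,
    ← integral_Ico_eq_integral_Ioo] at h1
  have h2 : modes w k 0 = coeffL k u₀ := by rw [modes, h.isSolution.initial]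
  rw [h1]
  simp only [Complex.ofReal_zero, mul_zero, neg_zero, Complex.exp_zero, one_mul]
  rw [h2, add_sub_cancel, ← mul_assoc, ← Complex.exp_add]
  simp

lemma aemeasurable_modes (h : IsStrongSolution s T u₀ w) (k : ℤ) :
    AEMeasurable (modes w k) (volume.restrict (Icc 0 T)) :=
  (h.isSolution.continuousOn_modes k).aemeasurable measurableSet_Icc

end IsStrongSolution

lemma integrableOn_of_energy {s T : ℝ} {γ : ℤ → ℝ → ℂ} (hγ : ∀ n, Measurable (γ n))
    (hE : energy s (Icc 0 T) γ < ⊤) (n : ℤ) : IntegrableOn (γ n) (Icc 0 T) := by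
  have h := (ENNReal.le_tsum n).trans_lt hE
  have h2 : ∫⁻ t in Icc 0 T, ‖γ n t‖ₑ ^ 2 < ⊤ := by
    by_contra h'
    rw [not_lt, top_le_iff] at h'
    rw [h', ENNReal.mul_top (wt_ne_zero s n)] at h
    exact lt_irrefl _ h
  have h3 := integrable_mul_of_lintegral_sq (μ := volume.restrict (Icc 0 T))
    (f := fun _ => 1) aemeasurable_const (hγ n).aemeasurable (by simp) h2
  simp only [one_mul] at h3
  exact h3

/-- Functions given by Duhamel's formula are superpositions of free waves. -/
lemma isProfile_duhamel {s T : ℝ} {y : ℤ → ℝ → ℂ} {α : ℤ → ℂ} {γ : ℤ → ℝ → ℂ}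
    (hy : ∀ n, AEMeasurable (y n) (volume.restrict (Icc 0 T))) (hγ : ∀ n, Measurable (γ n))
    (hα : ∑' n, wt s n * ‖α n‖ₑ ^ 2 < ⊤) (hE : energy s (Icc 0 T) γ < ⊤)
    (heq : ∀ t ∈ Icc 0 T, ∀ n, y n t = Complex.exp (Complex.I * (1 * disp n : ℝ) * t) *
      (α n + ∫ τ in Ico 0 t, γ n τ)) :
    ∃ m F, IsProfile 1 s (Icc 0 T) y m F (ENNReal.ofReal (1 + T))
      (∑' n, wt s n * ‖α n‖ₑ ^ 2 + energy s (Icc 0 T) γ) := by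
  -- The initial datum is spread over [-1,0), an interval of length one placed before time 0. The
  -- single kernel 1_{[-1,t)} then reproduces both the datum and the Duhamel integral; its squared
  -- norm is at most 1 + T.
  set F : ℤ → ℝ → ℂ := fun n τ => (Ico (-1 : ℝ) 0).indicator (fun _ => α n) τ +
    (Icc 0 T).indicator (γ n) τ with hF
  refine ⟨fun t => (Ico (-1 : ℝ) t).indicator fun _ => 1, F, hy, fun t => ?_, fun n => ?_,
    fun t ht => ?_, ?_, ENNReal.ofReal_lt_top, ENNReal.add_lt_top.2 ⟨hα, hE⟩, fun t ht n => ?_⟩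
  · exact measurable_const.indicator measurableSet_Ico
  · exact (measurable_const.indicator measurableSet_Ico).add ((hγ n).indicator measurableSet_Icc)
  · have : ∀ τ, ‖(Ico (-1 : ℝ) t).indicator (fun _ => (1 : ℂ)) τ‖ₑ ^ 2 =
        (Ico (-1 : ℝ) t).indicator (fun _ => (1 : ℝ≥0∞)) τ := by
      intro τ
      by_cases h : τ ∈ Ico (-1 : ℝ) t <;> simp [h]
    simp_rw [this]
    rw [lintegral_indicator_const measurableSet_Ico, one_mul, Real.volume_Ico]
    exact ENNReal.ofReal_le_ofReal (by linarith [ht.2])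
  · rw [energy, ← ENNReal.tsum_add]
    refine ENNReal.tsum_le_tsum fun n => ?_
    rw [← mul_add]
    gcongr wt s n * ?_
    have : ∀ τ, ‖F n τ‖ₑ ^ 2 = (Ico (-1 : ℝ) 0).indicator (fun _ => ‖α n‖ₑ ^ 2) τ +
        (Icc 0 T).indicator (fun τ => ‖γ n τ‖ₑ ^ 2) τ := by
      intro τ
      simp only [hF]
      by_cases h1 : τ ∈ Ico (-1 : ℝ) 0
      · have h2 : τ ∉ Icc 0 T := fun h => absurd h1.2 (not_lt.2 h.1)
        simp [h1, h2]
      · by_cases h2 : τ ∈ Icc 0 T <;> simp [h1, h2]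
    simp_rw [this]
    rw [lintegral_add_left (measurable_const.indicator measurableSet_Ico),
      lintegral_indicator_const measurableSet_Ico, lintegral_indicator measurableSet_Icc]
    simp
  · rw [heq t ht n]
    congr 1
    have h1 : ∀ τ, (Ico (-1 : ℝ) t).indicator (fun _ => (1 : ℂ)) τ * F n τ =
        (Ico (-1 : ℝ) t).indicator (F n) τ := by
      intro τ
      by_cases h : τ ∈ Ico (-1 : ℝ) t <;> simp [h]
    simp_rw [h1]
    have h2 : IntegrableOn ((Ico (-1 : ℝ) 0).indicator (fun _ => α n)) (Ico (-1) t) := by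
      refine Integrable.integrableOn ?_
      rw [integrable_indicator_iff measurableSet_Ico]
      exact integrableOn_const (by simp)
    have h3 : IntegrableOn ((Icc 0 T).indicator (γ n)) (Ico (-1) t) := by
      refine Integrable.integrableOn ?_
      rw [integrable_indicator_iff measurableSet_Icc]
      exact integrableOn_of_energy hγ hE n
    have e1 : Ico (-1 : ℝ) t ∩ Ico (-1) 0 = Ico (-1) 0 :=
      inter_eq_right.2 (Ico_subset_Ico_right ht.1)
    have e2 : Ico (-1 : ℝ) t ∩ Icc 0 T = Ico 0 t := by
      ext x
      simp only [mem_inter_iff, mem_Ico, mem_Icc]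
      constructor
      · rintro ⟨⟨_, h⟩, h', _⟩; exact ⟨h', h⟩
      · rintro ⟨h, h'⟩; exact ⟨⟨by linarith, h'⟩, h, by linarith [ht.2]⟩
    rw [integral_indicator measurableSet_Ico]
    simp only [hF]
    rw [integral_add h2 h3, setIntegral_indicator measurableSet_Ico,
      setIntegral_indicator measurableSet_Icc, e1, e2]
    simp

lemma measurable_indicator_of_continuousOn {T : ℝ} {g : ℝ → ℂ} (h : ContinuousOn g (Icc 0 T)) :
    Measurable ((Icc 0 T).indicator g) := by
  classical
  rw [← piecewise_eq_indicator]
  exact h.measurable_piecewise continuousOn_const measurableSet_Icc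

/-- Duhamel's formula gives the superposition directly, without any Bourgain norm. -/
lemma IsStrongSolution.exists_profile {s T : ℝ} {u₀ : L2Torus} {w : ℝ → L2Torus}
    (hu₀ : sobolevENorm s u₀ < ⊤) (h : IsStrongSolution s T u₀ w) :
    ∃ m F M S, IsProfile 1 s (Icc 0 T) (modes w) m F M S := by
  rw [sobolevENorm_lt_top_iff] at hu₀
  have hE : energy s (Icc 0 T) (fun k => (Icc 0 T).indicator (forcing w k)) < ⊤ := by
    rw [energy_congr measurableSet_Icc (N' := fun k t => nonlin (w t) k)]
    · exact h.energy_lt_top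
    · intro k t ht
      rw [indicator_of_mem ht, enorm_forcing]
  obtain ⟨m, F, P⟩ := isProfile_duhamel (y := modes w) (α := fun n => coeffL n u₀)
    (γ := fun k => (Icc 0 T).indicator (forcing w k)) h.aemeasurable_modes
    (fun n => measurable_indicator_of_continuousOn (h.continuousOn_forcing n)) hu₀ hE
    (fun t ht n => by
      rw [h.duhamel n ht, setIntegral_indicator measurableSet_Icc,
        inter_eq_left.2 (Ico_subset_Icc_self.trans (Icc_subset_Icc_right ht.2))])
  exact ⟨m, F, _, _, P⟩

/-! ### Uniqueness of strong solutions -/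

lemma eq_zero_of_le_half_mul {E : ℝ≥0∞} (hE : E < ⊤) (h : E ≤ ENNReal.ofReal (1 / 2) * E) :
    E = 0 := by
  lift E to NNReal using hE.ne
  rw [ENNReal.ofReal, ← ENNReal.coe_mul, ENNReal.coe_le_coe] at h
  have h5 : (E : ℝ) ≤ 1 / 2 * E := by
    have := NNReal.coe_le_coe.2 h
    simpa using this
  have h6 : (E : ℝ) = 0 := le_antisymm (by linarith) E.2
  exact_mod_cast h6

namespace IsStrongSolution

variable {s T : ℝ} {u₀ v₀ : L2Torus} {w₁ w₂ : ℝ → L2Torus}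

lemma measurable_indicator_forcing (h : IsStrongSolution s T u₀ w₁) (k : ℤ) :
    Measurable ((Icc 0 T).indicator (forcing w₁ k)) :=
  measurable_indicator_of_continuousOn (h.continuousOn_forcing k)

lemma energy_indicator_forcing (w : ℝ → L2Torus) :
    energy s (Icc 0 T) (fun k => (Icc 0 T).indicator (forcing w k)) =
      energy s (Icc 0 T) (fun k t => nonlin (w t) k) := by
  refine energy_congr measurableSet_Icc fun k t ht => ?_
  rw [indicator_of_mem ht, enorm_forcing]

/-- The sum is the second factor in the difference of squares. Both Duhamel formulas use the same
kernel, so their data and forcings simply add. -/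
lemma exists_profile_add (hu₀ : sobolevENorm s u₀ < ⊤) (h₁ : IsStrongSolution s T u₀ w₁)
    (h₂ : IsStrongSolution s T u₀ w₂) :
    ∃ m F M S, IsProfile 1 s (Icc 0 T) (modes fun t => w₁ t + w₂ t) m F M S := by
  rw [sobolevENorm_lt_top_iff] at hu₀
  have hsub : ∀ {t : ℝ}, t ∈ Icc 0 T → Ico 0 t ∩ Icc 0 T = Ico 0 t := fun ht =>
    inter_eq_left.2 (Ico_subset_Icc_self.trans (Icc_subset_Icc_right ht.2))
  obtain ⟨m, F, P⟩ := isProfile_duhamel (s := s) (T := T) (y := modes fun t => w₁ t + w₂ t)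
    (α := fun n => coeffL n u₀ + coeffL n u₀)
    (γ := fun k τ => (Icc 0 T).indicator (forcing w₁ k) τ + (Icc 0 T).indicator (forcing w₂ k) τ)
    (fun n => by
      refine ((h₁.aemeasurable_modes n).add (h₂.aemeasurable_modes n)).congr ?_
      exact Eventually.of_forall fun t => by simp [modes])
    (fun n => (h₁.measurable_indicator_forcing n).add (h₂.measurable_indicator_forcing n))
    (by
      refine lt_of_le_of_lt (ENNReal.tsum_le_tsum (g := fun n =>
        4 * (wt s n * ‖coeffL n u₀‖ₑ ^ 2)) fun n => ?_) ?_
      · calc _ ≤ wt s n * (2 * (‖coeffL n u₀‖ₑ ^ 2 + ‖coeffL n u₀‖ₑ ^ 2)) := by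
              gcongr; exact enorm_add_sq_le _ _
          _ = _ := by ring
      · rw [ENNReal.tsum_mul_left]; exact ENNReal.mul_lt_top (by simp) hu₀)
    (by
      refine (energy_add_le fun k => (h₁.measurable_indicator_forcing k).aemeasurable).trans_lt ?_
      rw [energy_indicator_forcing, energy_indicator_forcing]
      exact ENNReal.mul_lt_top (by simp)
        (ENNReal.add_lt_top.2 ⟨h₁.energy_lt_top, h₂.energy_lt_top⟩))
    (fun t ht n => by
      have i1 := (h₁.integrableOn_forcing n).mono_set
        (Ico_subset_Icc_self.trans (Icc_subset_Icc_right ht.2))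
      have i2 := (h₂.integrableOn_forcing n).mono_set
        (Ico_subset_Icc_self.trans (Icc_subset_Icc_right ht.2))
      have e1 := h₁.duhamel n ht
      have e2 := h₂.duhamel n ht
      rw [modes] at e1 e2
      rw [integral_add]
      · rw [setIntegral_indicator measurableSet_Icc, setIntegral_indicator measurableSet_Icc,
          hsub ht, modes, map_add, e1, e2]
        ring
      · rw [IntegrableOn] at i1
        exact (integrable_indicator_iff measurableSet_Icc).2 (by
          rw [IntegrableOn, Measure.restrict_restrict measurableSet_Icc, inter_comm, hsub ht]
          exact i1)
      · exact (integrable_indicator_iff measurableSet_Icc).2 (by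
          rw [IntegrableOn, Measure.restrict_restrict measurableSet_Icc, inter_comm, hsub ht]
          exact i2))
  exact ⟨m, F, _, _, P⟩

/-- The difference of two solutions, with an exponential weight in time. -/
lemma isProfile_sub {l : ℝ} (hl : 0 < l) (h₁ : IsStrongSolution s T u₀ w₁)
    (h₂ : IsStrongSolution s T u₀ w₂) :
    ∃ m F, IsProfile 1 s (Icc 0 T)
      (modes fun t => ((Real.exp (-(l * t)) : ℝ) : ℂ) • (w₁ t - w₂ t)) m F
      (ENNReal.ofReal (1 / (2 * l))) (energy s (Icc 0 T) fun k t =>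
        ((Real.exp (-(l * t)) : ℝ) : ℂ) * (nonlin (w₁ t) k - nonlin (w₂ t) k)) := by
  set F : ℤ → ℝ → ℂ := fun k τ => ((Real.exp (-(l * τ)) : ℝ) : ℂ) *
    ((Icc 0 T).indicator (forcing w₁ k) τ - (Icc 0 T).indicator (forcing w₂ k) τ) with hF
  -- The weight is split as e^{-lt} = e^{-l(t-τ)} e^{-lτ} between kernel and density. The initial
  -- data cancel in the difference, and the kernel has squared norm at most ∫_{-∞}^t e^{-2l(t-τ)} dτ
  -- = 1/(2l).
  set m : ℝ → ℝ → ℂ := fun t => (Ico 0 t).indicator fun τ =>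
    ((Real.exp (-(l * (t - τ))) : ℝ) : ℂ) with hm
  have hFsq : ∀ k, ∫⁻ τ, ‖F k τ‖ₑ ^ 2 = ∫⁻ t in Icc 0 T, ‖((Real.exp (-(l * t)) : ℝ) : ℂ) *
      (nonlin (w₁ t) k - nonlin (w₂ t) k)‖ₑ ^ 2 := by
    intro k
    rw [← lintegral_indicator measurableSet_Icc]
    refine lintegral_congr fun τ => ?_
    simp only [hF]
    by_cases h : τ ∈ Icc 0 T
    · have e : ‖Complex.exp (-(Complex.I * (1 * disp k : ℝ) * τ))‖ₑ = 1 := by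
        rw [← ofReal_norm, Complex.norm_exp]; simp
      simp only [indicator_of_mem h, forcing]
      rw [← mul_sub, enorm_mul, enorm_mul, e, one_mul, enorm_mul]
    · simp [indicator_of_notMem h]
  refine ⟨m, F, fun n => ?_, fun t => ?_, fun n => ?_, fun t ht => ?_, ?_,
    ENNReal.ofReal_lt_top, ?_, fun t ht n => ?_⟩
  · have hc : Measurable fun t : ℝ => ((Real.exp (-(l * t)) : ℝ) : ℂ) := by fun_prop
    refine (hc.aemeasurable.mul ((h₁.aemeasurable_modes n).sub (h₂.aemeasurable_modes n))).congr ?_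
    exact Eventually.of_forall fun t => by simp [modes]
  · exact Measurable.indicator (by fun_prop) measurableSet_Ico
  · exact Measurable.mul (by fun_prop)
      ((h₁.measurable_indicator_forcing n).sub (h₂.measurable_indicator_forcing n))
  · rw [← lintegral_exp_neg_mul_sub (by positivity : 0 < 2 * l) t,
      ← lintegral_indicator measurableSet_Iio]
    refine lintegral_mono fun τ => ?_
    by_cases h : τ ∈ Ico 0 t
    · simp only [hm, indicator_of_mem h, indicator_of_mem (show τ ∈ Iio t from h.2)]
      rw [← ofReal_norm, Complex.norm_real, Real.norm_of_nonneg (Real.exp_pos _).le,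
        ← ENNReal.ofReal_pow (Real.exp_pos _).le, ← Real.exp_nat_mul]
      refine le_of_eq ?_
      congr 2; push_cast; ring
    · simp [hm, indicator_of_notMem h]
  · rw [energy]
    simp_rw [hFsq]
    exact le_rfl
  · calc _ ≤ energy s (Icc 0 T) (fun k t => (Icc 0 T).indicator (forcing w₁ k) t +
          -(Icc 0 T).indicator (forcing w₂ k) t) := by
          refine energy_mono measurableSet_Icc fun k t ht => ?_
          have e : ‖Complex.exp (-(Complex.I * (1 * disp k : ℝ) * t))‖ₑ = 1 := by
            rw [← ofReal_norm, Complex.norm_exp]; simp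
          have e2 : ‖((Real.exp (-(l * t)) : ℝ) : ℂ)‖ₑ ≤ 1 := by
            rw [← ofReal_norm, Complex.norm_real, Real.norm_of_nonneg (Real.exp_pos _).le,
              ENNReal.ofReal_le_one, Real.exp_le_one_iff]
            have := mul_nonneg hl.le ht.1
            linarith
          rw [← sub_eq_add_neg, indicator_of_mem ht, indicator_of_mem ht, forcing, forcing,
            ← mul_sub, enorm_mul, enorm_mul, e, one_mul]
          exact mul_le_of_le_one_left zero_le e2
      _ ≤ _ := energy_add_le fun k => (h₁.measurable_indicator_forcing k).aemeasurable
      _ < ⊤ := by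
          refine ENNReal.mul_lt_top (by simp) (ENNReal.add_lt_top.2 ⟨?_, ?_⟩)
          · rw [energy_indicator_forcing]; exact h₁.energy_lt_top
          · rw [energy_congr measurableSet_Icc (N' := fun k => (Icc 0 T).indicator (forcing w₂ k))
              (fun k t _ => enorm_neg _), energy_indicator_forcing]
            exact h₂.energy_lt_top
  · have hsub := Ico_subset_Icc_self.trans (Icc_subset_Icc_right ht.2 : Icc 0 t ⊆ Icc 0 T)
    have i1 := (h₁.integrableOn_forcing n).mono_set hsub
    have i2 := (h₂.integrableOn_forcing n).mono_set hsub
    have e1 := h₁.duhamel n ht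
    have e2 := h₂.duhamel n ht
    rw [modes] at e1 e2
    have e3 : ∀ τ, m t τ * F n τ = (Ico 0 t).indicator (fun τ =>
        ((Real.exp (-(l * t)) : ℝ) : ℂ) * (forcing w₁ n τ - forcing w₂ n τ)) τ := by
      intro τ
      by_cases h : τ ∈ Ico 0 t
      · simp only [hm, hF, indicator_of_mem h, indicator_of_mem (hsub h)]
        rw [← mul_assoc, ← Complex.ofReal_mul, ← Real.exp_add]
        congr 4; ring
      · simp [hm, indicator_of_notMem h]
    simp_rw [e3]
    rw [integral_indicator measurableSet_Ico, integral_const_mul, integral_sub i1 i2, modes,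
      map_smul, map_sub, e1, e2, smul_eq_mul]
    ring

/-- Unconditional uniqueness of strong solutions. -/
theorem eqOn (hs : 0 ≤ s) (hu₀ : sobolevENorm s u₀ < ⊤)
    (h₁ : IsStrongSolution s T u₀ w₁) (h₂ : IsStrongSolution s T u₀ w₂) :
    EqOn w₁ w₂ (Icc 0 T) := by
  obtain ⟨m', G, M', S', Q⟩ := exists_profile_add hu₀ h₁ h₂
  set K : ℝ≥0∞ := nlConst s T * (1 + M' * S') with hK
  have hKt : K < ⊤ := ENNReal.mul_lt_top (nlConst_lt_top s T) (ENNReal.add_lt_top.2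
    ⟨ENNReal.one_lt_top, ENNReal.mul_lt_top Q.kernel_lt_top Q.density_lt_top⟩)
  -- With this choice K/(2l) ≤ 1/2.
  set l : ℝ := K.toReal + 1 with hl
  have hl0 : 0 < l := by have := K.toReal_nonneg; linarith
  obtain ⟨m, F, P⟩ := isProfile_sub hl0 h₁ h₂
  set E := energy s (Icc 0 T) fun k t =>
    ((Real.exp (-(l * t)) : ℝ) : ℂ) * (nonlin (w₁ t) k - nonlin (w₂ t) k) with hE
  -- The density of the weighted difference has size E itself, so the bilinear estimate bounds E by
  -- a small multiple of E; finiteness of E then forces E = 0.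
  have hle : E ≤ nlConst s T * ((ENNReal.ofReal (1 / (2 * l)) * E) * (1 + M' * S')) := by
    refine energy_le_of_norm_le hs P Q fun k t _ => ?_
    have hc : ∀ f : L2Torus, twoRe (((Real.exp (-(l * t)) : ℝ) : ℂ) • f) =
        ((Real.exp (-(l * t)) : ℝ) : ℂ) • twoRe f := by
      intro f
      refine ext_coeffL fun k => ?_
      simp only [coeffL_twoRe, map_smul, smul_eq_mul, map_mul, Complex.conj_ofReal]
      ring
    have hc2 : ∀ f g : L2Torus, mulCoeff (((Real.exp (-(l * t)) : ℝ) : ℂ) • f) g k =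
        ((Real.exp (-(l * t)) : ℝ) : ℂ) * mulCoeff f g k := by
      intro f g
      refine (hasSum_mulCoeff _ g k).unique ?_
      have := (hasSum_mulCoeff f g k).mul_left ((Real.exp (-(l * t)) : ℝ) : ℂ)
      simpa only [map_smul, smul_eq_mul, mul_assoc] using this
    have h := norm_nonlin_sub_le (w₁ t) (w₂ t) k
    have h0 : (0 : ℝ) ≤ ‖((Real.exp (-(l * t)) : ℝ) : ℂ)‖ := norm_nonneg _
    rw [hc, hc2, map_smul, smul_eq_mul, norm_mul, norm_mul, norm_mul]
    refine (mul_le_mul_of_nonneg_left h h0).trans (le_of_eq ?_)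
    split_ifs <;> ring
  have hEt : E < ⊤ := P.density_lt_top
  have hE0 : E = 0 := by
    have h3 : K * ENNReal.ofReal (1 / (2 * l)) ≤ ENNReal.ofReal (1 / 2) := by
      rw [← ENNReal.ofReal_toReal hKt.ne, ← ENNReal.ofReal_mul K.toReal_nonneg]
      refine ENNReal.ofReal_le_ofReal ?_
      rw [mul_one_div, div_le_div_iff₀ (by positivity) (by norm_num), hl]
      linarith
    have h4 : E ≤ ENNReal.ofReal (1 / 2) * E := by
      calc E ≤ (K * ENNReal.ofReal (1 / (2 * l))) * E := hle.trans (le_of_eq (by rw [hK]; ring))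
        _ ≤ _ := by gcongr
    exact eq_zero_of_le_half_mul hEt h4
  intro t ht
  have h1 := P.tsum_wt_le ht
  rw [hE0, mul_zero, nonpos_iff_eq_zero, ENNReal.tsum_eq_zero] at h1
  refine ext_coeffL fun k => ?_
  have h2 := h1 k
  rw [mul_eq_zero, or_iff_right (wt_ne_zero s k), sq_eq_zero_iff, enorm_eq_zero, modes, map_smul,
    smul_eq_zero, or_iff_right (by exact_mod_cast (Real.exp_pos _).ne'), map_sub, sub_eq_zero] at h2
  exact h2

end IsStrongSolution

/-! ### Strong solutions belong to X^{s,b}(T) -/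

lemma lintegral_sq_eq_enorm_sq (f : L2Line) : ∫⁻ x, ‖f x‖ₑ ^ 2 = ‖f‖ₑ ^ 2 := by
  rw [Lp.enorm_def, eLpNorm_eq_lintegral_rpow_enorm_toReal (by norm_num) (by norm_num),
    ← ENNReal.rpow_mul_natCast]
  norm_num

lemma memLp_two_of_lintegral {E : Type*} [NormedAddCommGroup E] {f : ℝ → E}
    (hf : AEStronglyMeasurable f) (h : ∫⁻ x, ‖f x‖ₑ ^ 2 < ⊤) : MemLp f 2 := by
  refine ⟨hf, ?_⟩
  rw [eLpNorm_lt_top_iff_lintegral_rpow_enorm_lt_top (by norm_num) (by norm_num)]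
  simpa using h

/-- Plancherel's identity for functions in `L¹ ∩ L²`. -/
lemma lintegral_fourier_sq {G : ℝ → ℂ} (hG : Integrable G) (h2 : ∫⁻ x, ‖G x‖ₑ ^ 2 < ⊤) :
    ∫⁻ x, ‖𝓕 G x‖ₑ ^ 2 = ∫⁻ x, ‖G x‖ₑ ^ 2 := by
  have hL := memLp_two_of_lintegral hG.1 h2
  set g : L2Line := hL.toLp G with hg
  have hgG : (g : ℝ → ℂ) =ᵐ[volume] G := hL.coeFn_toLp
  have e1 := coeFn_fourier_of_integrable g (hG.congr hgG.symm)
  have e2 : 𝓕 (g : ℝ → ℂ) = 𝓕 G := by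
    ext x
    rw [Real.fourier_eq, Real.fourier_eq]
    refine integral_congr_ae ?_
    filter_upwards [hgG] with y hy
    rw [hy]
  rw [e2] at e1
  have h3 : ∫⁻ x, ‖G x‖ₑ ^ 2 = ∫⁻ x, ‖g x‖ₑ ^ 2 :=
    lintegral_congr_ae (by filter_upwards [hgG] with x hx; rw [hx])
  have h4 : ∫⁻ x, ‖𝓕 G x‖ₑ ^ 2 = ∫⁻ x, ‖(𝓕 g : L2Line) x‖ₑ ^ 2 :=
    lintegral_congr_ae (by filter_upwards [e1] with x hx; rw [hx])
  rw [h3, h4, lintegral_sq_eq_enorm_sq, lintegral_sq_eq_enorm_sq, ← ofReal_norm, ← ofReal_norm,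
    Lp.norm_fourier_eq]

/-- The kernel `e^{-ar}`, `r > 0`. -/
noncomputable def decay (a : ℝ) : ℝ → ℂ :=
  (Ioi 0).indicator fun r => ((Real.exp (-(a * r)) : ℝ) : ℂ)

lemma measurable_decay (a : ℝ) : Measurable (decay a) :=
  Measurable.indicator (by fun_prop) measurableSet_Ioi

lemma integrable_decay {a : ℝ} (ha : 0 < a) : Integrable (decay a) := by
  rw [decay, integrable_indicator_iff measurableSet_Ioi]
  have h := exp_neg_integrableOn_Ioi 0 ha
  simp only [neg_mul] at h
  exact h.ofReal

lemma enorm_decay_sub {a : ℝ} (t τ : ℝ) :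
    ‖decay a (t - τ)‖ₑ = (Iio t).indicator
      (fun τ => ENNReal.ofReal (Real.exp (-(a * (t - τ))))) τ := by
  by_cases h : τ < t
  · rw [indicator_of_mem (show τ ∈ Iio t from h), decay,
      indicator_of_mem (show t - τ ∈ Ioi 0 from sub_pos.2 h), ← ofReal_norm, Complex.norm_real,
      Real.norm_of_nonneg (Real.exp_pos _).le]
  · rw [indicator_of_notMem (show τ ∉ Iio t from h), decay,
      indicator_of_notMem (show t - τ ∉ Ioi 0 from fun h' => h (sub_pos.1 h')), enorm_zero]

/-- Writing the kernel as a square and applying Cauchy-Schwarz to (G · e^{-r/2}) · e^{-r/2} gives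
pointwise and L² bounds for `damp` with constant one, since e^{-r} has integral one on the
half-line. -/
lemma decay_half_sq (r : ℝ) : decay (1 / 2) r * decay (1 / 2) r = decay 1 r := by
  unfold decay
  by_cases h : r ∈ Ioi (0 : ℝ)
  · simp only [indicator_of_mem h]
    rw [← Complex.ofReal_mul, ← Real.exp_add]
    congr 2; ring
  · simp [indicator_of_notMem h]

lemma fourier_decay (ξ : ℝ) :
    𝓕 (decay 1) ξ = (1 + 2 * Real.pi * ξ * Complex.I)⁻¹ := by
  have hre : (-(1 + 2 * Real.pi * ξ * Complex.I) : ℂ).re < 0 := by simp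
  have h := integral_exp_mul_complex_Ioi hre 0
  rw [Real.fourier_eq']
  have e : ∀ r : ℝ, Complex.exp (↑(-2 * Real.pi * inner ℝ r ξ) * Complex.I) • decay 1 r =
      (Ioi 0).indicator (fun r : ℝ => Complex.exp (-(1 + 2 * Real.pi * ξ * Complex.I) * r)) r := by
    intro r
    unfold decay
    by_cases h : r ∈ Ioi (0 : ℝ)
    · simp only [indicator_of_mem h]
      rw [smul_eq_mul, Complex.ofReal_exp, ← Complex.exp_add]
      congr 1
      simp only [RCLike.inner_apply, conj_trivial]
      push_cast
      ring
    · simp [indicator_of_notMem h]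
  simp_rw [e]
  rw [integral_indicator measurableSet_Ioi, h]
  simp [neg_div_neg_eq, -neg_add_rev]

/-- The solution `∫_{-∞}^t e^{-(t-τ)} G(τ) dτ` of `W' + W = G`. -/
noncomputable def damp (G : ℝ → ℂ) : ℝ → ℂ :=
  convolution G (decay 1) (ContinuousLinearMap.mul ℂ ℂ) volume

lemma damp_apply (G : ℝ → ℂ) (t : ℝ) : damp G t = ∫ τ, G τ * decay 1 (t - τ) := rfl

lemma integrable_damp {G : ℝ → ℂ} (hG : Integrable G) : Integrable (damp G) :=
  hG.integrable_convolution _ (integrable_decay one_pos)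

lemma fourier_damp {G : ℝ → ℂ} (hG : Integrable G) (ξ : ℝ) :
    𝓕 (damp G) ξ = 𝓕 G ξ * (1 + 2 * Real.pi * ξ * Complex.I)⁻¹ := by
  rw [damp, Real.fourier_mul_convolution_eq hG (integrable_decay one_pos), fourier_decay]

lemma lintegral_decay_half_sq (t : ℝ) : ∫⁻ τ, ‖decay (1 / 2) (t - τ)‖ₑ ^ 2 = 1 := by
  have h := lintegral_exp_neg_mul_sub one_pos t
  rw [← lintegral_indicator measurableSet_Iio] at h
  simp only [div_one, ENNReal.ofReal_one] at h
  rw [← h]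
  refine lintegral_congr fun τ => ?_
  rw [← enorm_decay_sub, sq, ← enorm_mul, decay_half_sq]

lemma enorm_decay_half_le (r : ℝ) : ‖decay (1 / 2) r‖ₑ ≤ 1 := by
  unfold decay
  by_cases h : r ∈ Ioi (0 : ℝ)
  · rw [indicator_of_mem h, ← ofReal_norm, Complex.norm_real,
      Real.norm_of_nonneg (Real.exp_pos _).le, ENNReal.ofReal_le_one, Real.exp_le_one_iff]
    have : (0 : ℝ) < r := h
    linarith
  · simp [indicator_of_notMem h]

lemma enorm_damp_sq_le {G : ℝ → ℂ} (hG : Measurable G) (t : ℝ) :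
    ‖damp G t‖ₑ ^ 2 ≤ ∫⁻ τ, ‖G τ‖ₑ ^ 2 * ‖decay (1 / 2) (t - τ)‖ₑ ^ 2 := by
  have hd : Measurable fun τ => decay (1 / 2) (t - τ) := (measurable_decay _).comp (by fun_prop)
  have h : damp G t = ∫ τ, (G τ * decay (1 / 2) (t - τ)) * decay (1 / 2) (t - τ) := by
    simp_rw [damp_apply, mul_assoc, decay_half_sq]
  rw [h]
  refine (enorm_integral_mul_sq_le (hG.mul hd).aemeasurable hd.aemeasurable).trans (le_of_eq ?_)
  rw [lintegral_decay_half_sq, mul_one]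
  simp only [Pi.mul_apply, enorm_mul, mul_pow]

lemma enorm_damp_sq_le' {G : ℝ → ℂ} (hG : Measurable G) (t : ℝ) :
    ‖damp G t‖ₑ ^ 2 ≤ ∫⁻ τ, ‖G τ‖ₑ ^ 2 := by
  refine (enorm_damp_sq_le hG t).trans (lintegral_mono fun τ => ?_)
  exact mul_le_of_le_one_right zero_le (pow_le_one₀ zero_le (enorm_decay_half_le _))

lemma lintegral_damp_sq_le {G : ℝ → ℂ} (hG : Measurable G) :
    ∫⁻ t, ‖damp G t‖ₑ ^ 2 ≤ ∫⁻ τ, ‖G τ‖ₑ ^ 2 := by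
  refine (lintegral_mono fun t => enorm_damp_sq_le hG t).trans ?_
  have hm : Measurable (Function.uncurry fun (t τ : ℝ) =>
      ‖G τ‖ₑ ^ 2 * ‖decay (1 / 2) (t - τ)‖ₑ ^ 2) :=
    ((hG.comp measurable_snd).enorm.pow_const 2).mul
      (((measurable_decay _).comp (by fun_prop)).enorm.pow_const 2)
  rw [lintegral_lintegral_swap hm.aemeasurable]
  refine lintegral_mono fun τ => ?_
  have h1 : Measurable fun t => ‖decay (1 / 2) (t - τ)‖ₑ ^ 2 :=
    ((measurable_decay _).comp (by fun_prop)).enorm.pow_const 2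
  rw [lintegral_const_mul _ h1]
  have h2 : ∫⁻ t, ‖decay (1 / 2) (t - τ)‖ₑ ^ 2 = 1 := by
    rw [lintegral_sub_right_eq_self (fun t => ‖decay (1 / 2) t‖ₑ ^ 2) τ]
    rw [← lintegral_sub_left_eq_self _ (0 : ℝ)]
    exact lintegral_decay_half_sq 0
  rw [h2, mul_one]

lemma fourier_exp_mul (f : ℝ → ℂ) (d ξ : ℝ) :
    𝓕 (fun t : ℝ => Complex.exp (Complex.I * d * t) * f t) ξ = 𝓕 f (ξ - d / (2 * Real.pi)) := by
  rw [Real.fourier_eq', Real.fourier_eq']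
  refine integral_congr_ae (Eventually.of_forall fun t => ?_)
  simp only [smul_eq_mul]
  rw [← mul_assoc, ← Complex.exp_add]
  congr 2
  have : (Real.pi : ℂ) ≠ 0 := by exact_mod_cast Real.pi_ne_zero
  simp only [RCLike.inner_apply, conj_trivial]
  push_cast
  field_simp
  ring

lemma lintegral_comp_div {c : ℝ} (hc : 0 < c) {f : ℝ → ℝ≥0∞} (hf : Measurable f) :
    ∫⁻ x, f (x / c) = ENNReal.ofReal c * ∫⁻ x, f x := by
  have h := Real.map_volume_mul_left (inv_ne_zero hc.ne')
  have h2 := lintegral_map (μ := volume) hf (measurable_const_mul c⁻¹)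
  rw [h, lintegral_smul_measure, inv_inv, abs_of_pos hc, smul_eq_mul] at h2
  rw [h2]
  simp only [div_eq_inv_mul]

/-- This is where b ≤ 1 enters: the multiplier (1 + iτ)⁻¹ of `damp` has modulus ⟨τ⟩⁻¹, a gain of one
full power of the modulation weight. -/
lemma norm_rpow_mul_inv_le {b : ℝ} (hb : b ≤ 1) (τ : ℝ) :
    ‖((jap τ ^ b : ℝ) : ℂ) * (1 + (τ : ℂ) * Complex.I)⁻¹‖ ≤ 1 := by
  have h1 : ‖(1 + (τ : ℂ) * Complex.I)‖ = jap τ := by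
    rw [jap, ← Complex.ofReal_one, Complex.norm_add_mul_I]; norm_num
  rw [norm_mul, norm_inv, h1, Complex.norm_real,
    Real.norm_of_nonneg (Real.rpow_nonneg (jap_pos _).le _), ← div_eq_mul_inv,
    div_le_one (jap_pos _)]
  exact (Real.rpow_le_rpow_of_exponent_le (one_le_jap τ) hb).trans (le_of_eq (Real.rpow_one _))

lemma aestronglyMeasurable_ofCoeff {V : ℤ → ℝ → ℂ} (hV : ∀ k, AEStronglyMeasurable (V k))
    (h : ∀ t, Memℓp (fun k => V k t) 2) :
    AEStronglyMeasurable (fun t => ofCoeff fun k => V k t) := by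
  refine aestronglyMeasurable_of_tendsto_ae (atTop : Filter (Finset ℤ))
    (f := fun A t => ∑ k ∈ A, V k t • (fourierBasis k : L2Torus)) (fun A => ?_) ?_
  · exact Finset.aestronglyMeasurable_fun_sum _ fun k _ => (hV k).smul_const _
  · refine Eventually.of_forall fun t => ?_
    have := (fourierBasis (T := 2 * Real.pi)).hasSum_repr (ofCoeff fun k => V k t)
    simp only [fourierBasis_repr, ← coeffL_apply, coeffL_ofCoeff (h t)] at this
    exact this

/-- Functions `u` with `e^{-it√(k⁴+1)}û_k(t) = ∫_{-∞}^t e^{-(t-τ)} G_k(τ) dτ`, `G ∈ L²(ℝ, H^s)`,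
belong to `X^{s,b}`, `b ≤ 1`. -/
lemma exists_bourgain_of_damp {s b : ℝ} (hs : 0 ≤ s) (hb : b ≤ 1) {G : ℤ → ℝ → ℂ}
    (hGm : ∀ k, Measurable (G k)) (hGi : ∀ k, Integrable (G k))
    (hG2 : ∑' k, wt s k * ∫⁻ τ, ‖G k τ‖ₑ ^ 2 < ⊤) :
    ∃ v : L2SpaceTime, bourgainENorm s b v < ⊤ ∧ ∀ᵐ t, ∀ k,
      coeffL k (v t) = Complex.exp (Complex.I * (1 * disp k : ℝ) * t) * damp (G k) t := by
  have hpi : (0 : ℝ) < 2 * Real.pi := Real.two_pi_pos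
  set V : ℤ → ℝ → ℂ := fun k t => Complex.exp (Complex.I * (1 * disp k : ℝ) * t) * damp (G k) t
    with hV
  have hG2' : ∑' k, ∫⁻ τ, ‖G k τ‖ₑ ^ 2 < ⊤ :=
    (ENNReal.tsum_le_tsum fun k => le_mul_of_one_le_left zero_le (one_le_wt hs k)).trans_lt hG2
  have hVn : ∀ k t, ‖V k t‖ₑ = ‖damp (G k) t‖ₑ := by
    intro k t
    simp only [hV]
    rw [enorm_mul, ← ofReal_norm, norm_exp_I_mul, ENNReal.ofReal_one, one_mul]
  have hVl : ∀ t, Memℓp (fun k => V k t) 2 := by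
    intro t
    refine memLp_two_of_tsum ((ENNReal.tsum_le_tsum fun k => ?_).trans_lt hG2')
    rw [hVn]
    exact enorm_damp_sq_le' (hGm k) t
  have hVi : ∀ k, Integrable (V k) := by
    intro k
    refine (integrable_damp (hGi k)).bdd_mul (c := 1) (by fun_prop) ?_
    exact Eventually.of_forall fun t => (norm_exp_I_mul _ _).le
  have hvL : MemLp (fun t => ofCoeff fun k => V k t) 2 := by
    refine memLp_two_of_lintegral (aestronglyMeasurable_ofCoeff (fun k => (hVi k).1) hVl) ?_
    simp_rw [enorm_sq_eq_tsum, coeffL_ofCoeff (hVl _)]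
    rw [lintegral_tsum fun k => (hVi k).1.aemeasurable.enorm.pow_const 2]
    refine (ENNReal.tsum_le_tsum fun k => ?_).trans_lt hG2'
    simp_rw [hVn]
    exact lintegral_damp_sq_le (hGm k)
  refine ⟨hvL.toLp _, ?_, ?_⟩
  · rw [bourgainENorm_eq, ENNReal.rpow_lt_top_iff_of_pos (by norm_num)]
    refine (ENNReal.tsum_le_tsum (g := fun k => ENNReal.ofReal (2 * Real.pi) *
      (wt s k * ∫⁻ τ, ‖G k τ‖ₑ ^ 2)) fun k => ?_).trans_lt ?_
    · rw [mul_left_comm]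
      gcongr wt s k * ?_
      have hc : ((coeffL k).compLp (hvL.toLp _) : ℝ → ℂ) =ᵐ[volume] V k := by
        filter_upwards [(coeffL k).coeFn_compLp (hvL.toLp _), hvL.coeFn_toLp] with t h1 h2
        rw [h1, h2, coeffL_ofCoeff (hVl t)]
      have hF : (fourierMode (hvL.toLp _) k : ℝ → ℂ) =ᵐ[volume] 𝓕 (V k) := by
        rw [fourierMode_eq]
        have e2 : 𝓕 (((coeffL k).compLp (hvL.toLp _) : L2Line) : ℝ → ℂ) = 𝓕 (V k) := by
          ext x
          rw [Real.fourier_eq, Real.fourier_eq]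
          refine integral_congr_ae ?_
          filter_upwards [hc] with y hy
          rw [hy]
        rw [← e2]
        exact coeFn_fourier_of_integrable _ ((hVi k).congr hc.symm)
      have hGk : ∫⁻ τ, ‖G k τ‖ₑ ^ 2 < ⊤ := (ENNReal.le_tsum k).trans_lt hG2'
      have hFc : Continuous (𝓕 (G k)) :=
        VectorFourier.fourierIntegral_continuous Real.continuous_fourierChar
          (by exact continuous_inner) (hGi k)
      rw [← lintegral_fourier_sq (hGi k) hGk, ← lintegral_comp_div hpi
        (hFc.measurable.enorm.pow_const 2)]
      refine lintegral_mono_ae ?_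
      have hq : Measure.QuasiMeasurePreserving (fun τ : ℝ => (τ + disp k) / (2 * Real.pi))
          volume volume :=
        (quasiMeasurePreserving_div hpi.ne').comp
          (measurePreserving_add_right volume (disp k)).quasiMeasurePreserving
      filter_upwards [hq.ae hF] with τ hτ
      -- The phase e^{it√(k⁴+1)} translates the transform and cancels the shift by √(k⁴+1) in the
      -- Bourgain weight.
      have e1 : 𝓕 (V k) ((τ + disp k) / (2 * Real.pi)) =
          𝓕 (G k) (τ / (2 * Real.pi)) * (1 + (τ : ℂ) * Complex.I)⁻¹ := by
        simp only [hV]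
        rw [fourier_exp_mul, one_mul, ← sub_div, add_sub_cancel_right, fourier_damp (hGi k)]
        congr 3
        have : (Real.pi : ℂ) ≠ 0 := by exact_mod_cast Real.pi_ne_zero
        push_cast
        field_simp
      rw [hτ, e1]
      refine pow_le_pow_left' ?_ 2
      rw [mul_left_comm, enorm_mul]
      refine mul_le_of_le_one_right zero_le ?_
      rw [← ofReal_norm, ENNReal.ofReal_le_one]
      exact norm_rpow_mul_inv_le hb τ
    · rw [ENNReal.tsum_mul_left]
      exact ENNReal.mul_lt_top ENNReal.ofReal_lt_top hG2
  · filter_upwards [hvL.coeFn_toLp] with t ht k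
    rw [ht, coeffL_ofCoeff (hVl t)]

/-- The mode of `e^{-it⟨∂ₓ²⟩}w(t)`. -/
noncomputable def interaction (w : ℝ → L2Torus) (k : ℤ) (t : ℝ) : ℂ :=
  Complex.exp (-(Complex.I * (1 * disp k : ℝ) * t)) * modes w k t

lemma enorm_interaction (w : ℝ → L2Torus) (k : ℤ) (t : ℝ) :
    ‖interaction w k t‖ₑ = ‖modes w k t‖ₑ := by
  have h : ‖Complex.exp (-(Complex.I * (1 * disp k : ℝ) * t))‖ = 1 := by
    rw [Complex.norm_exp]; simp
  rw [interaction, enorm_mul, ← ofReal_norm, h, ENNReal.ofReal_one, one_mul]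

lemma modes_eq_interaction (w : ℝ → L2Torus) (k : ℤ) (t : ℝ) :
    modes w k t = Complex.exp (Complex.I * (1 * disp k : ℝ) * t) * interaction w k t := by
  rw [interaction, ← mul_assoc, ← Complex.exp_add]; simp

lemma integral_Ico_exp : ∫ τ in Ico (-1 : ℝ) 0, Real.exp τ = 1 - Real.exp (-1) := by
  rw [integral_Ico_eq_integral_Ioo, ← integral_Ioc_eq_integral_Ioo,
    ← intervalIntegral.integral_of_le (by norm_num), integral_exp, Real.exp_zero]

lemma one_sub_exp_neg_one_pos : 0 < 1 - Real.exp (-1) := by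
  have : Real.exp (-1) < 1 := Real.exp_zero ▸ Real.exp_lt_exp.2 (by norm_num)
  linarith

/-- The source `G` for which `damp G` extends the interaction picture of `w` from `[0,T]`
to `ℝ`. -/
noncomputable def source (T : ℝ) (w : ℝ → L2Torus) (k : ℤ) (τ : ℝ) : ℂ :=
  (Ico (-1 : ℝ) 0).indicator (fun _ => (((1 - Real.exp (-1))⁻¹ : ℝ) : ℂ) * modes w k 0) τ +
    (Icc 0 T).indicator (fun τ => interaction w k τ + forcing w k τ) τ

namespace IsStrongSolution

variable {s b T : ℝ} {u₀ : L2Torus} {w : ℝ → L2Torus}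

lemma hasDerivWithinAt_interaction (h : IsStrongSolution s T u₀ w) (k : ℤ) {t : ℝ}
    (ht : t ∈ Icc 0 T) :
    HasDerivWithinAt (interaction w k) (forcing w k t) (Icc 0 T) t :=
  h.hasDerivWithinAt k ht

lemma continuousOn_interaction (h : IsStrongSolution s T u₀ w) (k : ℤ) :
    ContinuousOn (interaction w k) (Icc 0 T) := fun _ ht =>
  (h.hasDerivWithinAt_interaction k ht).continuousWithinAt

lemma integral_exp_mul (h : IsStrongSolution s T u₀ w) (k : ℤ) {t : ℝ} (ht : t ∈ Icc 0 T) :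
    ∫ τ in Ico 0 t, ((Real.exp τ : ℝ) : ℂ) * (interaction w k τ + forcing w k τ) =
      ((Real.exp t : ℝ) : ℂ) * interaction w k t - modes w k 0 := by
  have hsub : Icc 0 t ⊆ Icc 0 T := Icc_subset_Icc_right ht.2
  have hd : ∀ x ∈ Icc 0 T, HasDerivWithinAt (fun r : ℝ =>
      ((Real.exp r : ℝ) : ℂ) * interaction w k r)
      (((Real.exp x : ℝ) : ℂ) * (interaction w k x + forcing w k x)) (Icc 0 T) x := by
    intro x hx
    have h1 : HasDerivWithinAt (fun r : ℝ => ((Real.exp r : ℝ) : ℂ)) ((Real.exp x : ℝ) : ℂ)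
        (Icc 0 T) x := (Real.hasDerivAt_exp x).ofReal_comp.hasDerivWithinAt
    refine (h1.mul (h.hasDerivWithinAt_interaction k hx)).congr_deriv ?_
    ring
  have hc : ContinuousOn (fun x : ℝ => ((Real.exp x : ℝ) : ℂ) *
      (interaction w k x + forcing w k x)) (Icc 0 T) :=
    ContinuousOn.mul (by fun_prop) ((h.continuousOn_interaction k).add (h.continuousOn_forcing k))
  have h1 := intervalIntegral.integral_eq_sub_of_hasDeriv_right_of_le (a := 0) (b := t)
    (f := fun r : ℝ => ((Real.exp r : ℝ) : ℂ) * interaction w k r)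
    (f' := fun x : ℝ => ((Real.exp x : ℝ) : ℂ) * (interaction w k x + forcing w k x))
    ht.1 (fun x hx => ((hd x (hsub hx)).continuousWithinAt).mono hsub)
    (fun x hx => ((hd x (hsub (Ioo_subset_Icc_self hx))).hasDerivAt
      (Icc_mem_nhds hx.1 (hx.2.trans_le ht.2))).hasDerivWithinAt)
    ((hc.mono hsub).intervalIntegrable_of_Icc ht.1)
  rw [intervalIntegral.integral_of_le ht.1, integral_Ioc_eq_integral_Ioo,
    ← integral_Ico_eq_integral_Ioo] at h1
  rw [h1]
  simp [interaction]

lemma measurable_source (h : IsStrongSolution s T u₀ w) (k : ℤ) : Measurable (source T w k) :=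
  (measurable_const.indicator measurableSet_Ico).add (measurable_indicator_of_continuousOn
    ((h.continuousOn_interaction k).add (h.continuousOn_forcing k)))

lemma integrable_source (h : IsStrongSolution s T u₀ w) (k : ℤ) : Integrable (source T w k) := by
  refine Integrable.add ?_ ?_
  · rw [integrable_indicator_iff measurableSet_Ico]
    exact integrableOn_const (by simp)
  · rw [integrable_indicator_iff measurableSet_Icc]
    exact ((h.continuousOn_interaction k).add
      (h.continuousOn_forcing k)).integrableOn_compact isCompact_Icc

/-- On [0,T] the source is W + W', so that e^τ times it is the derivative of e^τ W. The constant on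
[-1,0) is normalised by ∫_{-1}^0 e^τ dτ = 1 - e^{-1}, so that this part supplies exactly W(0). -/
lemma damp_source (h : IsStrongSolution s T u₀ w) (k : ℤ) {t : ℝ} (ht : t ∈ Icc 0 T) :
    damp (source T w k) t = interaction w k t := by
  have h0 := one_sub_exp_neg_one_pos
  have e1 : ∀ τ, source T w k τ * decay 1 (t - τ) = ((Real.exp (-t) : ℝ) : ℂ) *
      ((Ico (-1 : ℝ) 0).indicator (fun τ => (((1 - Real.exp (-1))⁻¹ : ℝ) : ℂ) * modes w k 0 *
        ((Real.exp τ : ℝ) : ℂ)) τ +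
      (Ico 0 t).indicator (fun τ => ((Real.exp τ : ℝ) : ℂ) *
        (interaction w k τ + forcing w k τ)) τ) := by
    intro τ
    have hexp : ((Real.exp (-(1 * (t - τ))) : ℝ) : ℂ) =
        ((Real.exp (-t) : ℝ) : ℂ) * ((Real.exp τ : ℝ) : ℂ) := by
      rw [← Complex.ofReal_mul, ← Real.exp_add]; congr 2; ring
    unfold source decay
    by_cases h1 : τ < t
    · rw [indicator_of_mem (show t - τ ∈ Ioi 0 from sub_pos.2 h1), hexp]
      by_cases h2 : τ < 0
      · have n1 : τ ∉ Icc 0 T := fun h' => absurd h'.1 (not_le.2 h2)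
        have n2 : τ ∉ Ico 0 t := fun h' => absurd h'.1 (not_le.2 h2)
        simp only [indicator_of_notMem n1, indicator_of_notMem n2]
        by_cases h3 : τ ∈ Ico (-1 : ℝ) 0
        · simp only [indicator_of_mem h3]; ring
        · simp only [indicator_of_notMem h3]; ring
      · have n1 : τ ∈ Icc 0 T := ⟨not_lt.1 h2, h1.le.trans ht.2⟩
        have n2 : τ ∈ Ico 0 t := ⟨not_lt.1 h2, h1⟩
        have n3 : τ ∉ Ico (-1 : ℝ) 0 := fun h' => h2 h'.2
        simp only [indicator_of_mem n1, indicator_of_mem n2, indicator_of_notMem n3]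
        ring
    · have n1 : t - τ ∉ Ioi 0 := fun h' => h1 (sub_pos.1 h')
      have n2 : τ ∉ Ico 0 t := fun h' => h1 h'.2
      have n3 : τ ∉ Ico (-1 : ℝ) 0 := fun h' => h1 (h'.2.trans_le ht.1)
      simp only [indicator_of_notMem n1, indicator_of_notMem n2, indicator_of_notMem n3]
      ring
  have hc : ContinuousOn (fun x : ℝ => ((Real.exp x : ℝ) : ℂ) *
      (interaction w k x + forcing w k x)) (Icc 0 T) :=
    ContinuousOn.mul (by fun_prop) ((h.continuousOn_interaction k).add (h.continuousOn_forcing k))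
  rw [damp_apply]
  simp_rw [e1]
  rw [integral_const_mul, integral_add, integral_indicator measurableSet_Ico,
    integral_indicator measurableSet_Ico, h.integral_exp_mul k ht, integral_const_mul,
    integral_complex_ofReal, integral_Ico_exp]
  · have e2 : (((1 - Real.exp (-1))⁻¹ : ℝ) : ℂ) * ((1 - Real.exp (-1) : ℝ) : ℂ) = 1 := by
      rw [← Complex.ofReal_mul, inv_mul_cancel₀ h0.ne', Complex.ofReal_one]
    have e3 : ((Real.exp (-t) : ℝ) : ℂ) * ((Real.exp t : ℝ) : ℂ) = 1 := by
      rw [← Complex.ofReal_mul, ← Real.exp_add]; simp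
    linear_combination (((Real.exp (-t) : ℝ) : ℂ) * modes w k 0) * e2 + interaction w k t * e3
  · rw [integrable_indicator_iff measurableSet_Ico]
    exact ((ContinuousOn.integrableOn_compact (K := Icc (-1 : ℝ) 0) isCompact_Icc
      (by fun_prop))).mono_set Ico_subset_Icc_self
  · rw [integrable_indicator_iff measurableSet_Ico]
    exact (hc.integrableOn_compact isCompact_Icc).mono_set
      (Ico_subset_Icc_self.trans (Icc_subset_Icc_right ht.2))

lemma tsum_source_lt_top (hu₀ : sobolevENorm s u₀ < ⊤) (h : IsStrongSolution s T u₀ w) :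
    ∑' k, wt s k * ∫⁻ τ, ‖source T w k τ‖ₑ ^ 2 < ⊤ := by
  obtain ⟨m, F, M, S, P⟩ := h.exists_profile hu₀
  rw [sobolevENorm_lt_top_iff] at hu₀
  set κ : ℂ := (((1 - Real.exp (-1))⁻¹ : ℝ) : ℂ)
  have hE : energy s (Icc 0 T) (fun k τ => interaction w k τ + forcing w k τ) < ⊤ := by
    refine (energy_add_le fun k =>
      (h.continuousOn_interaction k).aemeasurable measurableSet_Icc).trans_lt ?_
    refine ENNReal.mul_lt_top (by simp) (ENNReal.add_lt_top.2 ⟨?_, ?_⟩)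
    · rw [energy_congr measurableSet_Icc fun k t _ => enorm_interaction w k t]
      exact (P.tsum_lintegral_le measurableSet_Icc).trans_lt
        (ENNReal.mul_lt_top (by simp) (ENNReal.mul_lt_top P.kernel_lt_top P.density_lt_top))
    · rw [energy_congr measurableSet_Icc fun k t _ => enorm_forcing w k t]
      exact h.energy_lt_top
  have h0 : ∀ k, modes w k 0 = coeffL k u₀ := fun k => by rw [modes, h.isSolution.initial]
  refine (ENNReal.tsum_le_tsum (g := fun k => 2 * (‖κ‖ₑ ^ 2 * (wt s k * ‖coeffL k u₀‖ₑ ^ 2)) +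
    2 * (wt s k * ∫⁻ τ in Icc 0 T, ‖interaction w k τ + forcing w k τ‖ₑ ^ 2)) fun k => ?_).trans_lt
      ?_
  · have e : ∫⁻ τ, ‖source T w k τ‖ₑ ^ 2 ≤ ∫⁻ τ, 2 * ((Ico (-1 : ℝ) 0).indicator
        (fun _ => ‖κ * coeffL k u₀‖ₑ ^ 2) τ +
        (Icc 0 T).indicator (fun τ => ‖interaction w k τ + forcing w k τ‖ₑ ^ 2) τ) := by
      refine lintegral_mono fun τ => ?_
      refine (enorm_add_sq_le _ _).trans (le_of_eq ?_)
      rw [h0]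
      congr 2
      · by_cases h1 : τ ∈ Ico (-1 : ℝ) 0 <;> simp [h1, κ]
      · by_cases h1 : τ ∈ Icc 0 T <;> simp [h1]
    rw [lintegral_const_mul' _ _ (by simp),
      lintegral_add_left (measurable_const.indicator measurableSet_Ico),
      lintegral_indicator_const measurableSet_Ico, lintegral_indicator measurableSet_Icc] at e
    refine (mul_le_mul_right e (wt s k)).trans (le_of_eq ?_)
    simp only [Real.volume_Ico, sub_neg_eq_add, zero_add, ENNReal.ofReal_one, mul_one, enorm_mul]
    ring
  · rw [ENNReal.tsum_add, ENNReal.tsum_mul_left, ENNReal.tsum_mul_left, ENNReal.tsum_mul_left]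
    exact ENNReal.add_lt_top.2 ⟨ENNReal.mul_lt_top (by simp) (ENNReal.mul_lt_top
      (ENNReal.pow_lt_top enorm_lt_top) hu₀), ENNReal.mul_lt_top (by simp) hE⟩

/-- Strong solutions belong to `X^{s,b}(T)`, `b ≤ 1`. -/
theorem memBourgain (hs : 0 ≤ s) (hb : b ≤ 1) (hu₀ : sobolevENorm s u₀ < ⊤)
    (h : IsStrongSolution s T u₀ w) : MemBourgain s b T w := by
  obtain ⟨v, hv, hvw⟩ := exists_bourgain_of_damp hs hb (fun k => h.measurable_source k)
    (fun k => h.integrable_source k) (h.tsum_source_lt_top hu₀)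
  rw [MemBourgain, bourgainENormOn, iInf_lt_iff]
  refine ⟨⟨v, ?_⟩, hv⟩
  filter_upwards [ae_restrict_of_ae hvw, ae_restrict_mem measurableSet_Icc] with t ht hmem
  refine ext_coeffL fun k => ?_
  rw [ht k, h.damp_source k hmem, ← modes_eq_interaction, modes]

end IsStrongSolution

/-! ### Functions with prescribed datum and forcing -/

section

variable {s T : ℝ} {u₀ : L2Torus}

lemma integral_Ico_eq_intervalIntegral (f : ℝ → ℂ) {t : ℝ} (ht : 0 ≤ t) :
    ∫ τ in Ico 0 t, f τ = ∫ τ in (0 : ℝ)..t, f τ := by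
  rw [intervalIntegral.integral_of_le ht, integral_Ico_eq_integral_Ioo,
    integral_Ioc_eq_integral_Ioo]

lemma isStrongSolution_of_duhamel (hT : 0 ≤ T) {w : ℝ → L2Torus} (hc : ContinuousOn w (Icc 0 T))
    (hE : energy s (Icc 0 T) (fun k t => nonlin (w t) k) < ⊤)
    (hd : ∀ k, ∀ t ∈ Icc 0 T, modes w k t = Complex.exp (Complex.I * (1 * disp k : ℝ) * t) *
      (coeffL k u₀ + ∫ τ in Ico 0 t, forcing w k τ)) : IsStrongSolution s T u₀ w := by
  refine ⟨⟨?_, fun k t ht => ?_⟩, hc, hE⟩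
  · refine ext_coeffL fun k => ?_
    have := hd k 0 ⟨le_rfl, hT⟩
    simpa [modes] using this
  · have hf : ContinuousOn (forcing w k) (Icc 0 T) :=
      ContinuousOn.mul (by fun_prop) ((continuous_nonlin k).comp_continuousOn hc)
    -- Extending the forcing by its end values makes the integrand continuous on ℝ. The primitive is
    -- then differentiable on both sides of every point, including 0 and T.
    set f := IccExtend hT ((Icc 0 T).domRestrict (forcing w k)) with hfdef
    have hfc : Continuous f := (continuousOn_iff_continuous_domRestrict.1 hf).Icc_extend'
    have hfe : ∀ x ∈ Icc 0 T, f x = forcing w k x := fun x hx => by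
      rw [hfdef, IccExtend_of_mem _ _ hx]; rfl
    have h1 : HasDerivAt (fun r => ∫ τ in (0 : ℝ)..r, f τ) (f t) t :=
      (hfc.integral_hasStrictDerivAt 0 t).hasDerivAt
    have h2 : HasDerivAt (fun r : ℝ => Complex.exp (Complex.I * (1 * disp k : ℝ) * r))
        (Complex.exp (Complex.I * (1 * disp k : ℝ) * t) * (Complex.I * (1 * disp k : ℝ) * 1)) t :=
      ((hasDerivAt_id t).ofReal_comp.const_mul (Complex.I * (1 * disp k : ℝ))).cexp
    have h3 := h2.mul (h1.const_add (coeffL k u₀))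
    have h4 : ∀ r ∈ Icc 0 T, fourierCoeff (w r : Torus → ℂ) k =
        Complex.exp (Complex.I * (1 * disp k : ℝ) * r) *
          (coeffL k u₀ + ∫ τ in (0 : ℝ)..r, f τ) := by
      intro r hr
      rw [← coeffL_apply, ← integral_Ico_eq_intervalIntegral _ hr.1]
      refine (hd k r hr).trans ?_
      congr 2
      refine setIntegral_congr_fun measurableSet_Ico fun τ hτ => ?_
      exact (hfe τ ⟨hτ.1, hτ.2.le.trans hr.2⟩).symm
    refine (h3.hasDerivWithinAt.congr (fun r hr => h4 r hr) (h4 t ht)).congr_deriv ?_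
    rw [rhsCoeff_eq, coeffL_apply k (w t), h4 t ht, hfe t ht, forcing]
    have : Complex.exp (Complex.I * (1 * disp k : ℝ) * t) *
        Complex.exp (-(Complex.I * (1 * disp k : ℝ) * t)) = 1 := by
      rw [← Complex.exp_add]; simp
    push_cast at this ⊢
    linear_combination nonlin (w t) k * this

/-- The function with initial value `u₀` and forcing `g`. -/
noncomputable def curve (u₀ : L2Torus) (g : ℤ → ℝ → ℂ) (t : ℝ) : L2Torus :=
  ofCoeff fun k => Complex.exp (Complex.I * (1 * disp k : ℝ) * t) *
    (coeffL k u₀ + ∫ τ in Ico 0 t, g k τ)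

lemma continuousOn_duhamel {g : ℝ → ℂ} (hg : IntegrableOn g (Icc 0 T)) (c : ℂ) (d : ℝ) :
    ContinuousOn (fun t : ℝ => Complex.exp (Complex.I * d * t) * (c + ∫ τ in Ico 0 t, g τ))
      (Icc 0 T) := by
  have h := intervalIntegral.continuousOn_primitive hg
  simp_rw [integral_Ioc_eq_integral_Ioo, ← integral_Ico_eq_integral_Ioo] at h
  exact ContinuousOn.mul (by fun_prop) (continuousOn_const.add h)

lemma exists_duhamel_profile {c : ℤ → ℂ} (hc : ∑' k, wt s k * ‖c k‖ₑ ^ 2 < ⊤) {g : ℤ → ℝ → ℂ}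
    (hg : ∀ k, Measurable (g k)) (hE : energy s (Icc 0 T) g < ⊤) :
    ∃ m F, IsProfile 1 s (Icc 0 T) (fun k t => Complex.exp (Complex.I * (1 * disp k : ℝ) * t) *
      (c k + ∫ τ in Ico 0 t, g k τ)) m F (ENNReal.ofReal (1 + T))
      (∑' n, wt s n * ‖c n‖ₑ ^ 2 + energy s (Icc 0 T) g) :=
  isProfile_duhamel (fun k => (continuousOn_duhamel (integrableOn_of_energy hg hE k) _
    _).aemeasurable measurableSet_Icc) hg hc hE fun _ _ _ => rfl

lemma IsProfile.congr {a : ℝ} {I : Set ℝ} (hI : MeasurableSet I) {y z : ℤ → ℝ → ℂ}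
    {m : ℝ → ℝ → ℂ} {F : ℤ → ℝ → ℂ} {M S : ℝ≥0∞} (P : IsProfile a s I y m F M S)
    (h : ∀ k, ∀ t ∈ I, z k t = y k t) : IsProfile a s I z m F M S where
  aemeasurable n := (P.aemeasurable n).congr (by
    filter_upwards [ae_restrict_mem hI] with t ht
    exact (h n t ht).symm)
  measurable_kernel := P.measurable_kernel
  measurable_density := P.measurable_density
  kernel_le := P.kernel_le
  density_le := P.density_le
  kernel_lt_top := P.kernel_lt_top
  density_lt_top := P.density_lt_top
  eq t ht n := by rw [h n t ht, P.eq t ht n]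

/-- `ofCoeff` has the default value 0 on sequences that are not square summable. The representation
as a superposition excludes this case at every t in [0,T]. -/
lemma modes_curve (hs : 0 ≤ s) (hu₀ : sobolevENorm s u₀ < ⊤) {g : ℤ → ℝ → ℂ}
    (hg : ∀ k, Measurable (g k)) (hE : energy s (Icc 0 T) g < ⊤) (k : ℤ) {t : ℝ}
    (ht : t ∈ Icc 0 T) :
    modes (curve u₀ g) k t = Complex.exp (Complex.I * (1 * disp k : ℝ) * t) *
      (coeffL k u₀ + ∫ τ in Ico 0 t, g k τ) := by
  rw [sobolevENorm_lt_top_iff] at hu₀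
  obtain ⟨m, F, P⟩ := exists_duhamel_profile hu₀ hg hE
  refine coeffL_ofCoeff (memLp_two_of_tsum ?_) k
  refine (ENNReal.tsum_le_tsum fun n => ?_).trans_lt
    ((P.tsum_wt_le ht).trans_lt (ENNReal.mul_lt_top P.kernel_lt_top P.density_lt_top))
  exact le_mul_of_one_le_left zero_le (one_le_wt hs n)

lemma exists_profile_curve (hs : 0 ≤ s) (hu₀ : sobolevENorm s u₀ < ⊤) {g : ℤ → ℝ → ℂ}
    (hg : ∀ k, Measurable (g k)) (hE : energy s (Icc 0 T) g < ⊤) :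
    ∃ m F, IsProfile 1 s (Icc 0 T) (modes (curve u₀ g)) m F (ENNReal.ofReal (1 + T))
      (∑' n, wt s n * ‖coeffL n u₀‖ₑ ^ 2 + energy s (Icc 0 T) g) := by
  obtain ⟨m, F, P⟩ := exists_duhamel_profile ((sobolevENorm_lt_top_iff _ _).1 hu₀) hg hE
  exact ⟨m, F, P.congr measurableSet_Icc fun k t ht => modes_curve hs hu₀ hg hE k ht⟩

lemma continuousOn_curve (hs : 0 ≤ s) (hu₀ : sobolevENorm s u₀ < ⊤) {g : ℤ → ℝ → ℂ}
    (hg : ∀ k, Measurable (g k)) (hE : energy s (Icc 0 T) g < ⊤) :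
    ContinuousOn (curve u₀ g) (Icc 0 T) := by
  obtain ⟨m, F, P⟩ := exists_profile_curve hs hu₀ hg hE
  refine (P.continuousIntoSobolev fun k => ?_).continuousOn hs
  exact (continuousOn_duhamel (integrableOn_of_energy hg hE k) _ _).congr
    fun t ht => modes_curve hs hu₀ hg hE k ht

/-- A primitive, in the interaction picture, is a superposition of free waves; the kernel is
small on short intervals. -/
lemma isProfile_primitive {γ : ℤ → ℝ → ℂ} (hγ : ∀ n, Measurable (γ n))
    (hE : energy s (Icc 0 T) γ < ⊤) :
    ∃ m F, IsProfile 1 s (Icc 0 T) (fun n t => Complex.exp (Complex.I * (1 * disp n : ℝ) * t) *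
      ∫ τ in Ico 0 t, γ n τ) m F (ENNReal.ofReal T) (energy s (Icc 0 T) γ) := by
  refine ⟨fun t => (Ico 0 t).indicator fun _ => 1, fun n => (Icc 0 T).indicator (γ n),
    fun n => ?_, fun t => measurable_const.indicator measurableSet_Ico,
    fun n => (hγ n).indicator measurableSet_Icc, fun t ht => ?_, ?_, ENNReal.ofReal_lt_top, hE,
    fun t ht n => ?_⟩
  · have h := continuousOn_duhamel (integrableOn_of_energy hγ hE n) 0 (1 * disp n)
    simp only [zero_add] at h
    exact h.aemeasurable measurableSet_Icc
  · have : ∀ τ, ‖(Ico 0 t).indicator (fun _ => (1 : ℂ)) τ‖ₑ ^ 2 =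
        (Ico 0 t).indicator (fun _ => (1 : ℝ≥0∞)) τ := by
      intro τ
      by_cases h : τ ∈ Ico 0 t <;> simp [h]
    simp_rw [this]
    rw [lintegral_indicator_const measurableSet_Ico, one_mul, Real.volume_Ico]
    exact ENNReal.ofReal_le_ofReal (by linarith [ht.2])
  · refine le_of_eq (tsum_congr fun n => ?_)
    rw [← lintegral_indicator measurableSet_Icc]
    congr 2
    ext τ
    by_cases h : τ ∈ Icc 0 T <;> simp [h]
  · congr 1
    have h1 : ∀ τ, (Ico 0 t).indicator (fun _ => (1 : ℂ)) τ * (Icc 0 T).indicator (γ n) τ =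
        (Ico 0 t).indicator (γ n) τ := by
      intro τ
      by_cases h : τ ∈ Ico 0 t
      · simp [h, show τ ∈ Icc 0 T from ⟨h.1, h.2.le.trans ht.2⟩, -mem_Icc, -mem_Ico]
      · simp [h, -mem_Ico]
    simp_rw [h1]
    rw [integral_indicator measurableSet_Ico]

lemma energy_nonlin_curve_le (hs : 0 ≤ s) (hu₀ : sobolevENorm s u₀ < ⊤) {g : ℤ → ℝ → ℂ}
    (hg : ∀ k, Measurable (g k)) (hE : energy s (Icc 0 T) g < ⊤) :
    energy s (Icc 0 T) (fun k t => nonlin (curve u₀ g t) k) ≤ nlConst s T *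
      ((ENNReal.ofReal (1 + T) * (∑' n, wt s n * ‖coeffL n u₀‖ₑ ^ 2 + energy s (Icc 0 T) g)) *
      (1 + ENNReal.ofReal (1 + T) *
        (∑' n, wt s n * ‖coeffL n u₀‖ₑ ^ 2 + energy s (Icc 0 T) g))) := by
  obtain ⟨m, F, P⟩ := exists_profile_curve hs hu₀ hg hE
  exact energy_le_of_norm_le hs P P fun k t _ => norm_nonlin_le _ _

/-- The common datum cancels in the difference of the curves, which leaves a pure primitive with
kernel size T. The sum of the curves has datum 2u₀ and only needs to be bounded. -/
lemma energy_nonlin_curve_sub_le (hs : 0 ≤ s) (hu₀ : sobolevENorm s u₀ < ⊤) {g h : ℤ → ℝ → ℂ}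
    (hg : ∀ k, Measurable (g k)) (hgE : energy s (Icc 0 T) g < ⊤)
    (hh : ∀ k, Measurable (h k)) (hhE : energy s (Icc 0 T) h < ⊤) :
    energy s (Icc 0 T) (fun k t => nonlin (curve u₀ g t) k - nonlin (curve u₀ h t) k) ≤
      nlConst s T * ((ENNReal.ofReal T * energy s (Icc 0 T) (fun k t => g k t - h k t)) *
      (1 + ENNReal.ofReal (1 + T) * (4 * ∑' n, wt s n * ‖coeffL n u₀‖ₑ ^ 2 +
        2 * (energy s (Icc 0 T) g + energy s (Icc 0 T) h)))) := by
  have hA := (sobolevENorm_lt_top_iff _ _).1 hu₀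
  have hsubE : energy s (Icc 0 T) (fun k t => g k t - h k t) < ⊤ := by
    simp_rw [sub_eq_add_neg]
    refine (energy_add_le (N' := fun k t => -h k t) fun k => (hg k).aemeasurable).trans_lt ?_
    rw [energy_congr measurableSet_Icc (N := fun k t => -h k t) fun k t _ => enorm_neg (h k t)]
    exact ENNReal.mul_lt_top (by simp) (ENNReal.add_lt_top.2 ⟨hgE, hhE⟩)
  have haddE' : energy s (Icc 0 T) (fun k t => g k t + h k t) ≤
    2 * (energy s (Icc 0 T) g + energy s (Icc 0 T) h) := energy_add_le fun k => (hg k).aemeasurable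
  have haddE : energy s (Icc 0 T) (fun k t => g k t + h k t) < ⊤ :=
    haddE'.trans_lt (ENNReal.mul_lt_top (by simp) (ENNReal.add_lt_top.2 ⟨hgE, hhE⟩))
  have hcle : ∑' n, wt s n * ‖coeffL n u₀ + coeffL n u₀‖ₑ ^ 2 ≤
      4 * ∑' n, wt s n * ‖coeffL n u₀‖ₑ ^ 2 := by
    rw [← ENNReal.tsum_mul_left]
    refine ENNReal.tsum_le_tsum fun n => ?_
    calc _ ≤ wt s n * (2 * (‖coeffL n u₀‖ₑ ^ 2 + ‖coeffL n u₀‖ₑ ^ 2)) := by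
          gcongr; exact enorm_add_sq_le _ _
      _ = _ := by ring
  have hsplit : ∀ k, ∀ t ∈ Icc 0 T, IntegrableOn (g k) (Ico 0 t) ∧ IntegrableOn (h k) (Ico 0 t) :=
    fun k t ht => by
      have hsub := Ico_subset_Icc_self.trans (Icc_subset_Icc_right ht.2 : Icc 0 t ⊆ Icc 0 T)
      exact ⟨(integrableOn_of_energy hg hgE k).mono_set hsub,
        (integrableOn_of_energy hh hhE k).mono_set hsub⟩
  obtain ⟨m, F, P⟩ := isProfile_primitive (fun k => (hg k).sub (hh k)) hsubE
  obtain ⟨m', G, Q⟩ := exists_duhamel_profile (s := s) (T := T)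
    (hcle.trans_lt (ENNReal.mul_lt_top (by simp) hA)) (fun k => (hg k).add (hh k)) haddE
  have P' : IsProfile 1 s (Icc 0 T) (modes fun t => curve u₀ g t - curve u₀ h t) m F
      (ENNReal.ofReal T) (energy s (Icc 0 T) fun k t => g k t - h k t) := by
    refine P.congr measurableSet_Icc fun k t ht => ?_
    have e1 := modes_curve hs hu₀ hg hgE k ht
    have e2 := modes_curve hs hu₀ hh hhE k ht
    rw [modes] at e1 e2
    obtain ⟨i1, i2⟩ := hsplit k t ht
    have e3 : ∫ τ in Ico 0 t, (g k - h k) τ = (∫ τ in Ico 0 t, g k τ) - ∫ τ in Ico 0 t, h k τ :=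
      integral_sub i1 i2
    rw [modes, map_sub, e1, e2]
    refine Eq.trans ?_ (congrArg _ e3.symm)
    ring
  have Q' : IsProfile 1 s (Icc 0 T) (modes fun t => curve u₀ g t + curve u₀ h t) m' G
      (ENNReal.ofReal (1 + T)) (∑' n, wt s n * ‖coeffL n u₀ + coeffL n u₀‖ₑ ^ 2 +
        energy s (Icc 0 T) fun k t => g k t + h k t) := by
    refine Q.congr measurableSet_Icc fun k t ht => ?_
    have e1 := modes_curve hs hu₀ hg hgE k ht
    have e2 := modes_curve hs hu₀ hh hhE k ht
    rw [modes] at e1 e2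
    obtain ⟨i1, i2⟩ := hsplit k t ht
    have e3 : ∫ τ in Ico 0 t, (g k + h k) τ = (∫ τ in Ico 0 t, g k τ) + ∫ τ in Ico 0 t, h k τ :=
      integral_add i1 i2
    rw [modes, map_add, e1, e2]
    refine Eq.trans ?_ (congrArg (fun x => Complex.exp (Complex.I * (1 * disp k : ℝ) * t) *
      (coeffL k u₀ + coeffL k u₀ + x)) e3.symm)
    ring
  refine (energy_le_of_norm_le hs P' Q' fun k t _ => norm_nonlin_sub_le _ _ _).trans ?_
  gcongr

end

/-! ### Local existence by contraction -/

/-- The measure on `ℤ × [0, T]` whose space `L²` is `L²([0, T], H^s)`. -/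
noncomputable def modeMeasure (s T : ℝ) : Measure (ℤ × ℝ) :=
  (Measure.count.withDensity (wt s)).prod (volume.restrict (Icc 0 T))

section

variable {s T : ℝ} {u₀ : L2Torus}

lemma eLpNorm_modeMeasure_sq {f : ℤ × ℝ → ℂ} (hf : Measurable f) :
    eLpNorm f 2 (modeMeasure s T) ^ 2 = energy s (Icc 0 T) fun k t => f (k, t) := by
  have h1 : eLpNorm f 2 (modeMeasure s T) ^ 2 = ∫⁻ p, ‖f p‖ₑ ^ 2 ∂modeMeasure s T := by
    rw [eLpNorm_eq_lintegral_rpow_enorm_toReal (by norm_num) (by norm_num),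
      ← ENNReal.rpow_mul_natCast]
    simp
  rw [h1, modeMeasure, lintegral_prod _ (by fun_prop),
    lintegral_withDensity_eq_lintegral_mul _ measurable_from_top measurable_from_top,
    lintegral_count]
  rfl

lemma memLp_modeMeasure {f : ℤ × ℝ → ℂ} (hf : Measurable f)
    (h : energy s (Icc 0 T) (fun k t => f (k, t)) < ⊤) : MemLp f 2 (modeMeasure s T) := by
  refine ⟨hf.aestronglyMeasurable, ?_⟩
  rw [← eLpNorm_modeMeasure_sq hf] at h
  by_contra hc
  rw [not_lt, top_le_iff] at hc
  simp [hc] at h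

lemma measurable_coeFn (g : Lp ℂ 2 (modeMeasure s T)) : Measurable (g : ℤ × ℝ → ℂ) :=
  (Lp.stronglyMeasurable g).measurable

lemma measurable_coeFn_mk (g : Lp ℂ 2 (modeMeasure s T)) (k : ℤ) : Measurable fun t => g (k, t) :=
  (measurable_coeFn g).comp measurable_prodMk_left

lemma enorm_sq_eq_energy (g : Lp ℂ 2 (modeMeasure s T)) :
    ‖g‖ₑ ^ 2 = energy s (Icc 0 T) fun k t => g (k, t) := by
  rw [Lp.enorm_def, eLpNorm_modeMeasure_sq (measurable_coeFn g)]

lemma energy_coeFn_lt_top (g : Lp ℂ 2 (modeMeasure s T)) :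
    energy s (Icc 0 T) (fun k t => g (k, t)) < ⊤ := by
  rw [← enorm_sq_eq_energy]
  exact ENNReal.pow_lt_top enorm_lt_top

lemma enorm_sub_sq_eq_energy (g h : Lp ℂ 2 (modeMeasure s T)) :
    ‖g - h‖ₑ ^ 2 = energy s (Icc 0 T) fun k t => g (k, t) - h (k, t) := by
  rw [Lp.enorm_def, eLpNorm_congr_ae (Lp.coeFn_sub g h),
    eLpNorm_modeMeasure_sq ((measurable_coeFn g).sub (measurable_coeFn h))]
  rfl

lemma ae_eq_of_energy_sub_eq_zero {g h : ℤ → ℝ → ℂ} (hg : ∀ k, Measurable (g k))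
    (hh : ∀ k, Measurable (h k)) (hE : energy s (Icc 0 T) (fun k t => g k t - h k t) = 0) (k : ℤ) :
    g k =ᵐ[volume.restrict (Icc 0 T)] h k := by
  have h1 := (mul_eq_zero.1 (ENNReal.tsum_eq_zero.1 hE k)).resolve_left (wt_ne_zero s k)
  have hm : Measurable fun t => ‖g k t - h k t‖ₑ ^ 2 := ((hg k).sub (hh k)).enorm.pow_const 2
  rw [lintegral_eq_zero_iff hm] at h1
  filter_upwards [h1] with t ht
  simpa [sub_eq_zero] using ht

/-- The forcing of the function with initial value `u₀` and forcing `g`. -/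
noncomputable def reforce (u₀ : L2Torus) (T : ℝ) (g : ℤ → ℝ → ℂ) (p : ℤ × ℝ) : ℂ :=
  (Icc 0 T).indicator (forcing (curve u₀ g) p.1) p.2

lemma energy_reforce (g : ℤ → ℝ → ℂ) :
    energy s (Icc 0 T) (fun k t => reforce u₀ T g (k, t)) =
      energy s (Icc 0 T) (fun k t => nonlin (curve u₀ g t) k) :=
  IsStrongSolution.energy_indicator_forcing _

lemma energy_reforce_sub (g h : ℤ → ℝ → ℂ) :
    energy s (Icc 0 T) (fun k t => reforce u₀ T g (k, t) - reforce u₀ T h (k, t)) =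
      energy s (Icc 0 T) (fun k t => nonlin (curve u₀ g t) k - nonlin (curve u₀ h t) k) := by
  refine energy_congr measurableSet_Icc fun k t ht => ?_
  have h : ‖Complex.exp (-(Complex.I * (1 * disp k : ℝ) * t))‖ = 1 := by
    rw [Complex.norm_exp]; simp
  simp only [reforce, indicator_of_mem ht, forcing]
  rw [← mul_sub, enorm_mul, ← ofReal_norm, h, ENNReal.ofReal_one, one_mul]

lemma continuousOn_forcing_of_continuousOn {w : ℝ → L2Torus} (hw : ContinuousOn w (Icc 0 T))
    (k : ℤ) : ContinuousOn (forcing w k) (Icc 0 T) :=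
  ContinuousOn.mul (by fun_prop) ((continuous_nonlin k).comp_continuousOn hw)

lemma measurable_reforce (hs : 0 ≤ s) (hu₀ : sobolevENorm s u₀ < ⊤) {g : ℤ → ℝ → ℂ}
    (hg : ∀ k, Measurable (g k)) (hE : energy s (Icc 0 T) g < ⊤) :
    Measurable (reforce u₀ T g) :=
  measurable_from_prod_countable_right fun k => measurable_indicator_of_continuousOn
    (continuousOn_forcing_of_continuousOn (continuousOn_curve hs hu₀ hg hE) k)

/-- A fixed point in L² satisfies its equation only for almost every time. The forcing enters
Duhamel's formula under an integral, so the formula holds at every t. -/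
lemma isStrongSolution_curve (hs : 0 ≤ s) (hT : 0 ≤ T) (hu₀ : sobolevENorm s u₀ < ⊤)
    {g : ℤ → ℝ → ℂ} (hg : ∀ k, Measurable (g k)) (hE : energy s (Icc 0 T) g < ⊤)
    (hfix : energy s (Icc 0 T) (fun k t => reforce u₀ T g (k, t) - g k t) = 0) :
    IsStrongSolution s T u₀ (curve u₀ g) := by
  have hm := measurable_reforce hs hu₀ hg hE
  refine isStrongSolution_of_duhamel hT (continuousOn_curve hs hu₀ hg hE) ?_ fun k t ht => ?_
  · refine (energy_nonlin_curve_le hs hu₀ hg hE).trans_lt ?_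
    have hA := ENNReal.add_lt_top.2 ⟨(sobolevENorm_lt_top_iff _ _).1 hu₀, hE⟩
    have hB := ENNReal.mul_lt_top (ENNReal.ofReal_lt_top (r := 1 + T)) hA
    exact ENNReal.mul_lt_top (nlConst_lt_top _ _)
      (ENNReal.mul_lt_top hB (ENNReal.add_lt_top.2 ⟨ENNReal.one_lt_top, hB⟩))
  · have h1 := ae_eq_of_energy_sub_eq_zero (g := fun k t => reforce u₀ T g (k, t))
      (fun k => hm.comp measurable_prodMk_left) hg hfix k
    rw [modes_curve hs hu₀ hg hE k ht]
    congr 2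
    have hsub : Ico 0 t ⊆ Icc 0 T := Ico_subset_Icc_self.trans (Icc_subset_Icc_right ht.2)
    refine setIntegral_congr_ae measurableSet_Ico ?_
    filter_upwards [(ae_restrict_iff' measurableSet_Icc).1 h1] with τ hτ hτt
    rw [← hτ (hsub hτt), reforce, indicator_of_mem (hsub hτt)]

lemma enorm_le_of_sq_le {x y : ℝ≥0∞} (h : x ^ 2 ≤ y ^ 2) : x ≤ y :=
  (ENNReal.pow_le_pow_left_iff two_ne_zero).1 h

open scoped NNReal in
/-- Local existence. -/
lemma exists_isStrongSolution (hs : 0 ≤ s) (hu₀ : sobolevENorm s u₀ < ⊤) :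
    ∃ T > 0, ∃ w, IsStrongSolution s T u₀ w := by
  set A := ∑' n, wt s n * ‖coeffL n u₀‖ₑ ^ 2 with hA
  have hAtop : A < ⊤ := (sobolevENorm_lt_top_iff _ _).1 hu₀
  have hK := nlConst_lt_top s 1
  -- B bounds the squared norm of the image of 0. C, multiplied by T, bounds the squared Lipschitz
  -- constant on the ball where ‖g‖² ≤ 4B. All constants are taken for T ≤ 1, before T is chosen.
  set B := nlConst s 1 * ((2 * A) * (1 + 2 * A)) with hB
  have hBtop : B < ⊤ := by finiteness
  set C := nlConst s 1 * (1 + 2 * (4 * A + 2 * (4 * B + 4 * B))) with hC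
  have hCtop : C < ⊤ := by finiteness
  -- The energies are squared norms, so 1/4 corresponds to the Lipschitz constant 1/2.
  obtain ⟨T, hT, hT1, hTC⟩ : ∃ T : ℝ, 0 < T ∧ T ≤ 1 ∧ ENNReal.ofReal T * C ≤ 1 / 4 := by
    have hp : 0 < 4 * (C.toReal + 1) := by positivity
    refine ⟨1 / (4 * (C.toReal + 1)), by positivity, ?_, ?_⟩
    · rw [div_le_one hp]
      linarith [C.toReal_nonneg]
    · nth_rw 2 [← ENNReal.ofReal_toReal hCtop.ne]
      rw [← ENNReal.ofReal_mul (by positivity)]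
      have e : (1 / 4 : ℝ≥0∞) = ENNReal.ofReal (1 / 4) := by
        rw [ENNReal.ofReal_div_of_pos (by norm_num)]; simp
      rw [e]
      refine ENNReal.ofReal_le_ofReal ?_
      rw [div_mul_eq_mul_div, div_le_div_iff₀ hp (by norm_num)]
      linarith
  refine ⟨T, hT, ?_⟩
  have hKT : nlConst s T ≤ nlConst s 1 := nlConst_mono s hT.le hT1
  have hT2 : ENNReal.ofReal (1 + T) ≤ 2 := by
    rw [show (2 : ℝ≥0∞) = ENNReal.ofReal 2 by simp]
    exact ENNReal.ofReal_le_ofReal (by linarith)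
  let rep : Lp ℂ 2 (modeMeasure s T) → ℤ → ℝ → ℂ := fun g k t => g (k, t)
  have hrm : ∀ g k, Measurable (rep g k) := measurable_coeFn_mk
  have hrE : ∀ g, energy s (Icc 0 T) (rep g) < ⊤ := energy_coeFn_lt_top
  have hmeas : ∀ g, Measurable (reforce u₀ T (rep g)) := fun g =>
    measurable_reforce hs hu₀ (hrm g) (hrE g)
  have hbound : ∀ g, energy s (Icc 0 T) (fun k t => reforce u₀ T (rep g) (k, t)) ≤
      nlConst s 1 * ((2 * (A + ‖g‖ₑ ^ 2)) * (1 + 2 * (A + ‖g‖ₑ ^ 2))) := fun g => by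
    rw [energy_reforce, enorm_sq_eq_energy]
    refine (energy_nonlin_curve_le hs hu₀ (hrm g) (hrE g)).trans ?_
    gcongr
  have hmem : ∀ g, MemLp (reforce u₀ T (rep g)) 2 (modeMeasure s T) := fun g =>
    memLp_modeMeasure (hmeas g) ((hbound g).trans_lt (by finiteness))
  -- The unknown is the forcing in the interaction picture: Φ sends g to the forcing produced by the
  -- curve with datum u₀ and forcing g.
  let Φ : Lp ℂ 2 (modeMeasure s T) → Lp ℂ 2 (modeMeasure s T) := fun g => (hmem g).toLp _
  have hlip : ∀ g h, ‖g‖ₑ ^ 2 ≤ 4 * B → ‖h‖ₑ ^ 2 ≤ 4 * B → ‖Φ g - Φ h‖ₑ ≤ 1 / 2 * ‖g - h‖ₑ := by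
    intro g h hg hh
    refine enorm_le_of_sq_le ?_
    have e1 : ‖Φ g - Φ h‖ₑ ^ 2 = energy s (Icc 0 T)
        (fun k t => nonlin (curve u₀ (rep g) t) k - nonlin (curve u₀ (rep h) t) k) := by
      rw [← energy_reforce_sub, ← MemLp.toLp_sub, Lp.enorm_toLp,
        eLpNorm_modeMeasure_sq ((hmeas g).sub (hmeas h))]
      rfl
    rw [e1]
    refine (energy_nonlin_curve_sub_le hs hu₀ (hrm g) (hrE g) (hrm h) (hrE h)).trans ?_
    rw [enorm_sq_eq_energy] at hg hh
    rw [mul_pow, enorm_sub_sq_eq_energy]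
    calc _ ≤ nlConst s 1 * ((ENNReal.ofReal T * energy s (Icc 0 T) fun k t => rep g k t - rep h k t)
          * (1 + 2 * (4 * A + 2 * (4 * B + 4 * B)))) := by
          gcongr
      _ = (ENNReal.ofReal T * C) * energy s (Icc 0 T) fun k t => rep g k t - rep h k t := by
          rw [hC]; ring
      _ ≤ _ := by
          gcongr
          refine hTC.trans (le_of_eq ?_)
          rw [one_div, one_div, ← ENNReal.inv_pow]; norm_num
  have hΦ0 : ‖Φ 0‖ₑ ^ 2 ≤ B := by
    rw [Lp.enorm_toLp, eLpNorm_modeMeasure_sq (hmeas 0)]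
    refine (hbound 0).trans (le_of_eq ?_)
    simp [hB]
  set r := B ^ (1 / 2 : ℝ) with hr
  have hr2 : r ^ 2 = B := by
    rw [hr, ← ENNReal.rpow_mul_natCast]; norm_num
  have hrtop : r < ⊤ := ENNReal.rpow_lt_top_of_nonneg (by norm_num) hBtop.ne
  have hball : ∀ g, g ∈ Metric.closedEBall (0 : Lp ℂ 2 (modeMeasure s T)) (2 * r) →
      ‖g‖ₑ ^ 2 ≤ 4 * B := by
    intro g hg
    rw [Metric.mem_closedEBall, edist_zero_right] at hg
    refine (pow_le_pow_left' hg 2).trans (le_of_eq ?_)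
    rw [mul_pow, hr2]; norm_num
  have h0 : (0 : Lp ℂ 2 (modeMeasure s T)) ∈ Metric.closedEBall 0 (2 * r) := by simp
  -- The ball of radius 2r about 0 is invariant, because ‖Φ g‖ ≤ ½ · 2r + ‖Φ 0‖ ≤ 2r.
  have hmaps : MapsTo Φ (Metric.closedEBall 0 (2 * r)) (Metric.closedEBall 0 (2 * r)) := by
    intro g hg
    have h1 := hlip g 0 (hball g hg) (hball 0 h0)
    rw [Metric.mem_closedEBall, edist_zero_right] at hg ⊢
    rw [sub_zero] at h1
    calc ‖Φ g‖ₑ = ‖(Φ g - Φ 0) + Φ 0‖ₑ := by rw [sub_add_cancel]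
      _ ≤ ‖Φ g - Φ 0‖ₑ + ‖Φ 0‖ₑ := enorm_add_le _ _
      _ ≤ 1 / 2 * (2 * r) + r := by
          gcongr
          · exact h1.trans (by gcongr)
          · exact enorm_le_of_sq_le (by rwa [hr2])
      _ = 2 * r := by
          rw [← mul_assoc, one_div, ENNReal.inv_mul_cancel (by simp) (by simp)]; ring
  have hcontr : ContractingWith (1 / 2 : ℝ≥0) (hmaps.restrict Φ _ _) := by
    refine ⟨by rw [← NNReal.coe_lt_coe]; norm_num, fun g h => ?_⟩
    rw [Subtype.edist_eq, Subtype.edist_eq, edist_eq_enorm_sub, edist_eq_enorm_sub]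
    refine (hlip g h (hball g g.2) (hball h h.2)).trans (le_of_eq ?_)
    simp
  obtain ⟨g, hg, hfix, -⟩ := hcontr.exists_fixedPoint' Metric.isClosed_closedEBall.isComplete
    hmaps h0 (edist_ne_top _ _)
  refine ⟨curve u₀ (rep g), isStrongSolution_curve hs hT.le hu₀ (hrm g) (hrE g) ?_⟩
  have h1 : (g : ℤ × ℝ → ℂ) =ᵐ[modeMeasure s T] reforce u₀ T (rep g) := by
    have := (hmem g).coeFn_toLp
    rw [show (hmem g).toLp _ = g from hfix] at this
    exact this
  rw [← eLpNorm_modeMeasure_sq (f := fun p => reforce u₀ T (rep g) p - g p)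
    ((hmeas g).sub (measurable_coeFn g))]
  rw [eLpNorm_congr_ae (g := fun _ => 0) (by
    filter_upwards [h1] with p hp
    rw [← hp, sub_self])]
  simp

end

/-! ### Restriction and continuation of strong solutions -/

lemma energy_union_le (s : ℝ) (I J : Set ℝ) (N : ℤ → ℝ → ℂ) :
    energy s (I ∪ J) N ≤ energy s I N + energy s J N := by
  rw [energy, energy, energy, ← ENNReal.tsum_add]
  refine ENNReal.tsum_le_tsum fun k => ?_
  rw [← mul_add]
  gcongr
  exact lintegral_union_le _ _ _

lemma energy_comp_sub_right (s T a b : ℝ) (N : ℤ → ℝ → ℂ) :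
    energy s (Icc (a + T) (b + T)) (fun k t => N k (t - T)) = energy s (Icc a b) N := by
  refine tsum_congr fun k => ?_
  congr 1
  rw [← lintegral_indicator measurableSet_Icc, ← lintegral_indicator measurableSet_Icc]
  refine Eq.trans (lintegral_congr fun t => ?_) (lintegral_sub_right_eq_self _ T)
  simp [indicator_apply, le_sub_iff_add_le]

section

variable {s T ε : ℝ} {u₀ : L2Torus} {w v : ℝ → L2Torus}

lemma IsStrongSolution.mono {T' : ℝ} (h : IsStrongSolution s T u₀ w) (hT : T' ≤ T) :
    IsStrongSolution s T' u₀ w := by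
  have hsub : Icc 0 T' ⊆ Icc 0 T := Icc_subset_Icc_right hT
  refine ⟨⟨h.isSolution.initial, fun k t ht =>
    (h.isSolution.equation k t (hsub ht)).mono hsub⟩, h.continuousOn.mono hsub, ?_⟩
  refine lt_of_le_of_lt ?_ h.energy_lt_top
  refine ENNReal.tsum_le_tsum fun k => ?_
  gcongr

/-- A solution on `[0, T]` is continued by a solution that starts from its value at `T`. -/
lemma IsStrongSolution.exists_extension (h : IsStrongSolution s T u₀ w) (hT : 0 ≤ T) (hε : 0 ≤ ε)
    (h' : IsStrongSolution s ε (w T) v) : ∃ z, IsStrongSolution s (T + ε) u₀ z := by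
  set z : ℝ → L2Torus := fun t => if t ≤ T then w t else v (t - T) with hz
  have hzw : EqOn z w (Icc 0 T) := fun t ht => by simp [hz, ht.2]
  have hzv : EqOn z (fun t => v (t - T)) (Icc T (T + ε)) := fun t ht => by
    rcases ht.1.eq_or_lt with rfl | hlt
    · simp [hz, h'.isSolution.initial]
    · simp [hz, hlt.not_ge]
  have hun : Icc 0 (T + ε) = Icc 0 T ∪ Icc T (T + ε) :=
    (Icc_union_Icc_eq_Icc hT (by linarith)).symm
  have hmaps : MapsTo (fun t => t - T) (Icc T (T + ε)) (Icc 0 ε) := fun t ht =>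
    ⟨sub_nonneg.2 ht.1, by linarith [ht.2]⟩
  refine ⟨z, ⟨?_, fun k t ht => ?_⟩, ?_, ?_⟩
  · rw [hzw ⟨le_rfl, hT⟩, h.isSolution.initial]
  · rw [hun]
    -- At a point outside one of the closed pieces the derivative within that piece is vacuous. At
    -- the joint t = T both pieces contribute the same right-hand side, because v(0) = w(T).
    refine HasDerivWithinAt.union ?_ ?_
    · by_cases hm : t ∈ Icc 0 T
      · rw [hzw hm]
        exact (h.isSolution.equation k t hm).congr (fun r hr => by rw [hzw hr]) (by rw [hzw hm])
      · exact HasFDerivWithinAt.of_notMem_closure (by rwa [isClosed_Icc.closure_eq])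
    · by_cases hm : t ∈ Icc T (T + ε)
      · rw [hzv hm]
        have h1 := (h'.isSolution.equation k _ (hmaps hm)).scomp t
          ((hasDerivWithinAt_id t _).sub_const T) hmaps
        rw [one_smul] at h1
        exact h1.congr (fun r hr => by rw [hzv hr]; rfl) (by rw [hzv hm]; rfl)
      · exact HasFDerivWithinAt.of_notMem_closure (by rwa [isClosed_Icc.closure_eq])
  · rw [hun]
    exact (h.continuousOn.congr hzw).union_of_isClosed
      ((h'.continuousOn.comp (by fun_prop) hmaps).congr hzv) isClosed_Icc isClosed_Icc
  · rw [hun]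
    refine (energy_union_le _ _ _ _).trans_lt (ENNReal.add_lt_top.2 ⟨?_, ?_⟩)
    · rw [energy_congr measurableSet_Icc (N' := fun k t => nonlin (w t) k)
        fun k t ht => by rw [hzw ht]]
      exact h.energy_lt_top
    · rw [energy_congr measurableSet_Icc (N' := fun k t => nonlin (v (t - T)) k)
        fun k t ht => by rw [hzv ht]]
      have := energy_comp_sub_right s T 0 ε fun k t => nonlin (v t) k
      rw [zero_add, add_comm ε T] at this
      rw [this]
      exact h'.energy_lt_top

end

end GoodBoussinesq

/-! ### The maximal existence time -/

open GoodBoussinesq in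
theorem mainTheorem3 (s b : ℝ) (hs : 0 ≤ s) (hb : b ∈ Set.Ioo (1 / 2 : ℝ) 1) :
    -- `X^{s,b}(T) ⊆ C([0,T], H^s)`, functions being identified almost everywhere
    (∀ T : ℝ, 0 < T → ∀ u : ℝ → L2Torus, MemBourgain s b T u →
      ∃ w : ℝ → L2Torus, w =ᵐ[volume.restrict (Set.Icc 0 T)] u ∧
        ContinuousIntoSobolev s (Set.Icc 0 T) w) ∧
    -- the maximal existence time
    ∀ u₀ : L2Torus, sobolevENorm s u₀ < ⊤ →
      ∃ Ts : EReal, 0 < Ts ∧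
        (∀ T : ℝ, 0 < T → (T : EReal) < Ts →
          ∃ u : ℝ → L2Torus,
            MemBourgain s b T u ∧ ContinuousIntoSobolev s (Set.Icc 0 T) u ∧
            IsSolution T u₀ u ∧
            ∀ w : ℝ → L2Torus, MemBourgain s b T w → IsSolution T u₀ w →
              Set.EqOn w u (Set.Icc 0 T)) ∧
        (∀ T : ℝ, 0 < T → Ts ≤ (T : EReal) →
          ¬ ∃ w : ℝ → L2Torus, MemBourgain s b T w ∧ IsSolution T u₀ w) := by
  have hb' : 1 / 2 < b := hb.1
  refine ⟨fun T hT u hu => ?_, fun u₀ hu₀ => ?_⟩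
  · obtain ⟨w, hw, hc, m, F, M, S, P⟩ := exists_rep_of_memBourgain hs hb' hu
    exact ⟨w, hw, P.continuousIntoSobolev fun k => (hc k).continuousOn⟩
  -- Existence times are collected for strong solutions, so that this set does not depend on b; the
  -- supremum is taken in the extended reals to allow global solutions.
  set E : Set ℝ := {T | 0 < T ∧ ∃ w, IsStrongSolution s T u₀ w} with hE
  refine ⟨sSup ((↑) '' E), ?_, fun T hT hlt => ?_, ?_⟩
  · obtain ⟨T, hT, w, hw⟩ := exists_isStrongSolution hs hu₀
    exact (EReal.coe_pos.2 hT).trans_le (le_sSup ⟨T, ⟨hT, w, hw⟩, rfl⟩)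
  · obtain ⟨_, ⟨T', ⟨hT', w, hw⟩, rfl⟩, hTT'⟩ := lt_sSup_iff.1 hlt
    have hw' := hw.mono (EReal.coe_le_coe_iff.1 hTT'.le)
    have hB := hw'.memBourgain hs hb.2.le hu₀
    refine ⟨w, hB, (hw'.isSolution.isStrongSolution hs hb' hT hB).2, hw'.isSolution,
      fun v hv hvs => ?_⟩
    -- Any competitor in X^{s,b}(T) is itself strong, so uniqueness in the larger class applies.
    exact (hvs.isStrongSolution hs hb' hT hv).1.eqOn hs hu₀ hw'
  · rintro T hT hle ⟨w, hwB, hw⟩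
    obtain ⟨hws, hwc⟩ := hw.isStrongSolution hs hb' hT hwB
    -- The value at time T lies in H^s and can be taken as a new datum. Existence up to T + ε > T
    -- then contradicts that T is an upper bound of the existence times.
    obtain ⟨ε, hε, v, hv⟩ := exists_isStrongSolution hs (hwc T ⟨hT.le, le_rfl⟩).1
    obtain ⟨z, hz⟩ := hws.exists_extension hT.le hε.le hv
    have h1 : ((T + ε : ℝ) : EReal) ≤ sSup ((↑) '' E) :=
      le_sSup ⟨T + ε, ⟨by linarith, z, hz⟩, rfl⟩
    have h2 := EReal.coe_le_coe_iff.1 (h1.trans hle)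
    linarith
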